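/- **Setting.** Let $X=(\Omega,\mathscr F,(\mathscr F_t)_{t\ge0},(X_t)_{t\ge0},(\theta_t)_{t\ge 0},(\mathbb P_x)_{x\in E})$ be a conservative Borel right process on a metric space $E$ with its Borel $\sigma$-algebra: a time-homogeneous strong Markov process with right-continuous paths, no killing, $\mathbb P_x(X_0=x)=1$, Borel transition function and shift operators $\theta_t$, where $(\mathscr F_t)$ is the right-continuous filtration generated by $X$ and completed by the $\mathbb P_\mu$-null sets for all initial laws $\mu$. Let $S=(S_t)_{t\ge0}$ be a Markovian pricing kernel: a strictly positive semimartingale (adapted, RCLL) with strictly positive left limits, $S_0=1$, $S_{t+\tau}=S_t\cdot (S_\tau\circ\theta_t)$ a.s. and $\mathbb E_x[S_t]<\infty$ for all $t>0$, $x\in E$. Put $\mathscr P_tf(x)=\mathbb E_x[S_tf(X_t)]$. Processes are required to be RCLL and identities to hold $\mathbb P_x$-almost surely, for each $x$. Let $\pi_R>0$ be a universally measurable function and $\lambda\in\mathbb R$ with $\mathscr P_t\pi_R(x)=e^{-\lambda t}\pi_R(x)$ for all $t>0$, $x\in E$. Set $M_t^{\pi_R}=S_te^{\lambda t}\pi_R(X_t)/\pi_R(X_0)$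 and let $\mathbb Q_x^{\pi_R}$ be the eigen-measure, $\mathbb Q^{\pi_R}_x|_{\mathscr F_t}=M_t^{\pi_R}\,\mathbb P_x|_{\mathscr F_t}$. Assume that $\pi_R$ is a recurrent eigenfunction, i.e. for each Borel $B\subseteq E$ the quantity $\int_0^\infty\mathbb Q^{\pi_R}_x(X_t\in B)\,dt$ is $0$ for all $x$ or $\infty$ for all $x$. **Exponential ergodicity.** Assume there are a probability measure $\varsigma$ on $E$ with $\int_E\pi_R^{-1}\,d\varsigma<\infty$ and constants $c,\alpha,t_0>0$ such that for all Borel $f$ with $|f|\le1$, all $t\ge t_0$ and $x\in E$, $$\Big|\mathbb E_x^{\mathbb Q^{\pi_R}}\big[f(X_t)/\pi_R(X_t)\big]-c_f\Big|\le \frac{c\,e^{-\alpha t}}{\pi_R(x)},\qquad c_f=\int_E\frac{f(y)}{\pi_R(y)}\,\varsigma(dy).$$ **Bonds.** For $0\le t\le T$ let $P_t^T=\mathbb E_x[S_T\mid\mathscr F_t]/S_t$ (an adapted RCLL version, unique up to indistinguishability) be the price of the zero-coupon bond of maturity $T$. For $T>0$ let $B_t^T=\big(\prod_{i=0}^kP_{iT}^{(i+1)T}\big)^{-1}P_t^{(k+1)T}$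 for $t\in[kT,(k+1)T)$, $k=0,1,\dots$, let $M_t^T=S_tB_t^T$, and let $\mathbb Q^T$ be the $T$-forward measure, $\mathbb Q^T|_{\mathscr F_t}=M_t^T\,\mathbb P_x|_{\mathscr F_t}$. **Theorem.** For each $x\in E$, under $\mathbb P_x$: 1. For each $t>0$, $M_t^{\pi_R}$ is $\mathscr F_t$-measurable and a.s. positive, and $$\frac{\mathbb E_x[S_T\mid\mathscr F_t]}{\mathbb E_x[S_T]}\xrightarrow{L^1}M_t^{\pi_R}\quad\text{as }T\to\infty .$$ 2. The bond price processes exist in RCLL versions. There are RCLL processes $M^\infty$ and $B^\infty$ such that, for every $t\ge 0$, a.s. $M^\infty_t=M_t^{\pi_R}$ and $$B_t^\infty=e^{\lambda t}\,\frac{\pi_R(X_t)}{\pi_R(x)};$$ $M^\infty$ is a positive martingale; $B^\infty$ is a valuation process (a positive semimartingale with positive left limits such that $SB^\infty$ is a martingale); and $S_t=M_t^\infty/B_t^\infty$ for all $t$. 3. $B^\infty$ is the long bond: as $T\to\infty$, $\mathbb P_x(\sup_{s\le t}|B^T_s-B^\infty_s|>K)\to0$ for all $t,K>0$. Moreover $M^T\to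 M^\infty$ and $B^T\to B^\infty$ in Émery's semimartingale topology. 4. $\mathbb Q_x^{\pi_R}$ is the long forward measure $\mathbb L$: it is a probability measure equivalent to $\mathbb P_x$ on each $\mathscr F_t$, and $\mathbb Q^T(A)\to\mathbb Q_x^{\pi_R}(A)$ for each $A\in\mathscr F_t$, $t\ge0$. The convergence holds in total variation on each $\mathscr F_t$. In addition, with the same constants $c,\alpha,t_0$, for every bounded Borel $f$, every $t\ge t_0$ and every $x\in E$, $$\big|\mathscr P_tf(x)-c_f\,e^{-\lambda t}\pi_R(x)\big|\le c\,\|f\|_{\infty}\,e^{-(\lambda+\alpha)t},\qquad \|f\|_\infty=\sup_{y\in E}|f(y)|.$$ -/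

import Mathlib

open MeasureTheory Filter Topology Set
open scoped NNReal ENNReal

namespace LongTermRisk

noncomputable section

/-! ### Real-valued processes on a filtered space -/

section Processes

variable {Ω : Type*} {mΩ : MeasurableSpace Ω}

/-- Right-continuous with left limits (at `t = 0` the left-limit clause is void). -/
def IsRCLL (f : ℝ≥0 → ℝ) : Prop :=
  ∀ t, ContinuousWithinAt f (Ici t) t ∧ ∃ l, Tendsto f (𝓝[<] t) (𝓝 l)

/-- The path has strictly positive left limits. -/
def HasPosLeftLimits (f : ℝ≥0 → ℝ) : Prop :=
  ∀ t, ∃ l, 0 < l ∧ Tendsto f (𝓝[<] t) (𝓝 l)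

/-- An elementary predictable process bounded by one,
`η = η₀ 1_{{0}} + ∑_{i < n} h_i 1_{(t_i, t_{i+1}]}`, where `t_0 ≤ t_1 ≤ …`, `η₀` is
`ℱ_0`-measurable, `h_i` is `ℱ_{t_i}`-measurable, `|η₀| ≤ 1` and `|h_i| ≤ 1`. -/
structure ElementaryIntegrand (ℱ : Filtration ℝ≥0 mΩ) where
  n : ℕ
  time : ℕ → ℝ≥0
  time_mono : Monotone time
  init : Ω → ℝ
  init_meas : Measurable[ℱ 0] init
  init_le : ∀ ω, |init ω| ≤ 1
  coef : ℕ → Ω → ℝ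
  coef_meas : ∀ i, Measurable[ℱ (time i)] (coef i)
  coef_le : ∀ i ω, |coef i ω| ≤ 1

/-- `η_0 Z_0 + ∫_0^t η dZ` for an elementary predictable process `η`. -/
def ElementaryIntegrand.integral {ℱ : Filtration ℝ≥0 mΩ} (η : ElementaryIntegrand ℱ)
    (Z : ℝ≥0 → Ω → ℝ) (t : ℝ≥0) (ω : Ω) : ℝ :=
  η.init ω * Z 0 ω +
    ∑ i ∈ Finset.range η.n,
      η.coef i ω * (Z (min (η.time (i + 1)) t) ω - Z (min (η.time i) t) ω)

/-- Semimartingale: an adapted process with (a.s.) RCLL paths which is a good integrator, i.e. for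
every horizon `t` the elementary integrals `∫_0^t η dZ`, `|η| ≤ 1`, are bounded in probability.
By the Bichteler–Dellacherie theorem these are exactly the adapted RCLL processes that are sums of
a local martingale and a process of finite variation. -/
structure IsSemimartingale (ℱ : Filtration ℝ≥0 mΩ) (μ : Measure Ω) (Z : ℝ≥0 → Ω → ℝ) : Prop where
  adapted : Adapted ℱ Z
  rcll : ∀ᵐ ω ∂μ, IsRCLL (fun t => Z t ω)
  bounded_in_prob : ∀ t : ℝ≥0, ∀ ε : ℝ≥0∞, 0 < ε → ∃ K : ℝ, ∀ η : ElementaryIntegrand ℱ,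
    μ {ω | K < |η.integral Z t ω|} ≤ ε

/-- Émery's distance
`∑_{n ≥ 1} 2^{-n} sup_{|η| ≤ 1} E[1 ∧ |η_0 (X_0 - Y_0) + ∫_0^n η d(X - Y)|]`.
The supremum is over elementary predictable `η`; for semimartingales it coincides with the
supremum over all predictable `|η| ≤ 1`, because the stochastic integral of such an `η` is a limit
in probability of integrals of elementary ones bounded by one. -/
def emeryDist (ℱ : Filtration ℝ≥0 mΩ) (μ : Measure Ω) (X Y : ℝ≥0 → Ω → ℝ) : ℝ≥0∞ :=
  ∑' n : ℕ, (2⁻¹ : ℝ≥0∞) ^ (n + 1) *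
    ⨆ η : ElementaryIntegrand ℱ,
      ∫⁻ ω, min 1 (ENNReal.ofReal |η.integral (fun t ω => X t ω - Y t ω) ((n : ℝ≥0) + 1) ω|) ∂μ

/-- A valuation process priced by `S`: a positive semimartingale `V` with positive left limits such
that `S V` is a martingale. -/
structure IsValuationProcess (ℱ : Filtration ℝ≥0 mΩ) (μ : Measure Ω) (S V : ℝ≥0 → Ω → ℝ) :
    Prop where
  semimartingale : IsSemimartingale ℱ μ V
  pos : ∀ᵐ ω ∂μ, ∀ t, 0 < V t ω
  leftLim_pos : ∀ᵐ ω ∂μ, HasPosLeftLimits (fun t => V t ω)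
  martingale : Martingale (fun t ω => S t ω * V t ω) ℱ μ

/-- `p` is the price process `P_t^T = E_t[S_T / S_t] = E_t[S_T] / S_t`, `0 ≤ t ≤ T`, of the
zero-coupon bond of maturity `T`, in a version that is adapted with (a.s.) RCLL paths on
`[0, T]`. (The values `p t` for `t > T` are irrelevant.) -/
structure IsZeroCouponBond (ℱ : Filtration ℝ≥0 mΩ) (μ : Measure Ω) (S : ℝ≥0 → Ω → ℝ)
    (T : ℝ≥0) (p : ℝ≥0 → Ω → ℝ) : Prop where
  adapted : ∀ t ≤ T, Measurable[ℱ t] (p t)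
  rcll : ∀ᵐ ω ∂μ, IsRCLL (fun t => p (min t T) ω)
  price : ∀ t ≤ T, p t =ᵐ[μ] fun ω => (μ[S T | ℱ t]) ω / S t ω

/-- Value of the roll-over strategy in `T`-maturity bonds; `p T t` is the time-`t` price of the
bond of maturity `T`:
`B_t^T = (∏_{i=0}^k P_{iT}^{(i+1)T})⁻¹ P_t^{(k+1)T}` for `t ∈ [kT, (k+1)T)`. -/
def rollOver (p : ℝ≥0 → ℝ≥0 → Ω → ℝ) (T t : ℝ≥0) (ω : Ω) : ℝ :=
  (∏ i ∈ Finset.range (⌊t / T⌋₊ + 1), p (((i : ℝ≥0) + 1) * T) ((i : ℝ≥0) * T) ω)⁻¹ *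
    p (((⌊t / T⌋₊ : ℝ≥0) + 1) * T) t ω

/-- `B` is the long bond: a strictly positive semimartingale to which the roll-over strategies
converge uniformly on compacts in probability. -/
structure IsLongBond (ℱ : Filtration ℝ≥0 mΩ) (μ : Measure Ω) (p : ℝ≥0 → ℝ≥0 → Ω → ℝ)
    (B : ℝ≥0 → Ω → ℝ) : Prop where
  semimartingale : IsSemimartingale ℱ μ B
  pos : ∀ᵐ ω ∂μ, ∀ t, 0 < B t ω
  ucp : ∀ t : ℝ≥0, 0 < t → ∀ K : ℝ, 0 < K →
    Tendsto (fun T => μ {ω | ∃ s ≤ t, K < |rollOver p T s ω - B s ω|}) atTop (𝓝 0)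

/-- The measure on `ℱ_t` with density `D_t` with respect to `μ`. -/
def densityMeasure (ℱ : Filtration ℝ≥0 mΩ) (μ : Measure Ω) (D : ℝ≥0 → Ω → ℝ) (t : ℝ≥0) :
    @Measure Ω (ℱ t) :=
  (μ.withDensity fun ω => ENNReal.ofReal (D t ω)).trim (ℱ.le t)

/-- The `T`-forward measure on `ℱ_t`; its density is `M_t^T = S_t B_t^T`. -/
def forwardMeasure (ℱ : Filtration ℝ≥0 mΩ) (μ : Measure Ω) (S : ℝ≥0 → Ω → ℝ)
    (p : ℝ≥0 → ℝ≥0 → Ω → ℝ) (T t : ℝ≥0) : @Measure Ω (ℱ t) :=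
  densityMeasure ℱ μ (fun t ω => S t ω * rollOver p T t ω) t

/-- `L`, a consistent family of probability measures `L t` on the σ-algebras `ℱ_t`, is the long
forward measure: it is equivalent to `μ` on each `ℱ_t`, and the `T`-forward measures converge to it
setwise on each `ℱ_t`. -/
structure IsLongForwardMeasure (ℱ : Filtration ℝ≥0 mΩ) (μ : Measure Ω) (S : ℝ≥0 → Ω → ℝ)
    (p : ℝ≥0 → ℝ≥0 → Ω → ℝ) (L : (t : ℝ≥0) → @Measure Ω (ℱ t)) : Prop where
  prob : ∀ t, IsProbabilityMeasure (L t)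
  consistent : ∀ s t (hst : s ≤ t), (L t).trim (ℱ.mono hst) = L s
  ac : ∀ t, (L t).AbsolutelyContinuous (μ.trim (ℱ.le t))
  ac' : ∀ t, (μ.trim (ℱ.le t)).AbsolutelyContinuous (L t)
  tendsto : ∀ t A, MeasurableSet[ℱ t] A →
    Tendsto (fun T => forwardMeasure ℱ μ S p T t A) atTop (𝓝 (L t A))

end Processes

/-! ### Borel right processes -/

section Markov

variable {E Ω : Type*}

/-- The σ-algebra `σ(X_s : s ≥ 0)`. -/
@[reducible] def rawSigma [mE : MeasurableSpace E] (X : ℝ≥0 → Ω → E) : MeasurableSpace Ω :=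
  ⨆ s, mE.comap (X s)

/-- The σ-algebra `σ(X_s : s ≤ t)`. -/
@[reducible] def rawSigmaUpTo [mE : MeasurableSpace E] (X : ℝ≥0 → Ω → E) (t : ℝ≥0) : MeasurableSpace Ω :=
  ⨆ s, ⨆ _ : s ≤ t, mE.comap (X s)

/-- `A` lies in the completion of the sub-σ-algebra `m` of `σ(X_s : s ≥ 0)` by the `P_μ`-null sets,
for every initial law `μ`; here `P_μ(N) = ∫ P_x(N) μ(dx)`. -/
def InCompletion [MeasurableSpace E] [MeasurableSpace Ω] (X : ℝ≥0 → Ω → E) (P : E → Measure Ω)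
    (m : MeasurableSpace Ω) (A : Set Ω) : Prop :=
  ∀ μ : Measure E, IsProbabilityMeasure μ →
    ∃ A₀ N : Set Ω, MeasurableSet[m] A₀ ∧ MeasurableSet[rawSigma X] N ∧
      ∫⁻ x, P x N ∂μ = 0 ∧ symmDiff A A₀ ⊆ N

/-- A conservative Borel right process with state space `E`: a time-homogeneous strong Markov
process with right-continuous paths, no killing, a Borel transition function, shift operators, and
the (right-continuous) filtration generated by `X` and completed with the `P_μ`-null sets for all
initial laws `μ`. The given σ-algebra of `Ω` is the completion of `σ(X_s : s ≥ 0)`. -/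
structure BorelRightProcess (E Ω : Type*) [MetricSpace E] [MeasurableSpace E]
    [mΩ : MeasurableSpace Ω] where
  X : ℝ≥0 → Ω → E
  θ : ℝ≥0 → Ω → Ω
  P : E → Measure Ω
  ℱ : Filtration ℝ≥0 mΩ
  prob : ∀ x, IsProbabilityMeasure (P x)
  start : ∀ x, ∀ᵐ ω ∂(P x), X 0 ω = x
  right_cont : ∀ ω t, ContinuousWithinAt (fun s => X s ω) (Ici t) t
  shift : ∀ s t ω, X s (θ t ω) = X (t + s) ω
  measurable_prob : ∀ A, MeasurableSet[rawSigma X] A → Measurable fun x => P x A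
  measurableSet_iff : ∀ A, MeasurableSet A ↔ InCompletion X P (rawSigma X) A
  filtration_iff : ∀ t A, MeasurableSet[ℱ t] A ↔ InCompletion X P (rawSigmaUpTo X t) A
  filtration_right_cont : ∀ t, (⨅ s, ⨅ _ : t < s, ℱ s) ≤ ℱ t
  /-- Strong Markov property: for every stopping time `τ` and `A ∈ σ(X_s : s ≥ 0)`,
  `P_x(θ_τ ∈ A | ℱ_τ) = P_{X_τ}(A)` on `{τ < ∞}`. -/
  strong_markov : ∀ x (τ : Ω → WithTop ℝ≥0) (hτ : IsStoppingTime ℱ τ) (Γ : Set Ω),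
    MeasurableSet[hτ.measurableSpace] Γ → ∀ A, MeasurableSet[rawSigma X] A →
      P x {ω | ω ∈ Γ ∧ τ ω ≠ ⊤ ∧ θ ((τ ω).untopD 0) ω ∈ A} =
        ∫⁻ ω in {ω | ω ∈ Γ ∧ τ ω ≠ ⊤}, P (X ((τ ω).untopD 0) ω) A ∂(P x)

/-- Universally measurable real functions on `E`. -/
def IsUniversallyMeasurable [MeasurableSpace E] (f : E → ℝ) : Prop :=
  ∀ μ : Measure E, IsProbabilityMeasure μ → AEMeasurable f μ

variable [MetricSpace E] [MeasurableSpace E] [MeasurableSpace Ω]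

/-- A Markovian pricing kernel: a positive semimartingale multiplicative functional `S` of `X` with
positive left limits, `S_0 = 1` and `E_x[S_t] < ∞`. -/
structure IsMarkovianPricingKernel (proc : BorelRightProcess E Ω) (S : ℝ≥0 → Ω → ℝ) : Prop where
  semimartingale : ∀ x, IsSemimartingale proc.ℱ (proc.P x) S
  pos : ∀ x, ∀ᵐ ω ∂(proc.P x), ∀ t, 0 < S t ω
  leftLim_pos : ∀ x, ∀ᵐ ω ∂(proc.P x), HasPosLeftLimits (fun t => S t ω)
  init : ∀ x, ∀ᵐ ω ∂(proc.P x), S 0 ω = 1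
  multiplicative : ∀ x t τ, ∀ᵐ ω ∂(proc.P x), S (t + τ) ω = S t ω * S τ (proc.θ t ω)
  integrable : ∀ x t, 0 < t → Integrable (S t) (proc.P x)

/-- The pricing operators `𝒫_t f(x) = E_x[S_t f(X_t)]`. -/
def pricingOp (proc : BorelRightProcess E Ω) (S : ℝ≥0 → Ω → ℝ) (t : ℝ≥0) (f : E → ℝ) (x : E) : ℝ :=
  ∫ ω, S t ω * f (proc.X t ω) ∂(proc.P x)

/-- `π` is a positive eigenfunction of the pricing operators with eigenvalues `e^{-λ t}`. (The
integral is non-zero, hence `S_t π(X_t)` is automatically `P_x`-integrable.) -/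
structure IsPositiveEigenfunction (proc : BorelRightProcess E Ω) (S : ℝ≥0 → Ω → ℝ) (lam : ℝ)
    (π : E → ℝ) : Prop where
  measurable : IsUniversallyMeasurable π
  pos : ∀ x, 0 < π x
  eigen : ∀ t : ℝ≥0, 0 < t → ∀ x, pricingOp proc S t π x = Real.exp (-lam * t) * π x

/-- `M_t^π = S_t e^{λ t} π(X_t) / π(X_0)`. -/
def eigenMartingale (proc : BorelRightProcess E Ω) (S : ℝ≥0 → Ω → ℝ) (lam : ℝ) (π : E → ℝ)
    (t : ℝ≥0) (ω : Ω) : ℝ :=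
  S t ω * Real.exp (lam * t) * (π (proc.X t ω) / π (proc.X 0 ω))

/-- The eigen-measure `Q_x^π` on `ℱ_t`; its density with respect to `P_x` is `M_t^π`. -/
def eigenMeasure (proc : BorelRightProcess E Ω) (S : ℝ≥0 → Ω → ℝ) (lam : ℝ) (π : E → ℝ)
    (x : E) (t : ℝ≥0) : @Measure Ω (proc.ℱ t) :=
  densityMeasure proc.ℱ (proc.P x) (eigenMartingale proc S lam π) t

/-- `π` is a recurrent eigenfunction: a positive eigenfunction such that `X` is recurrent under the
eigen-measure, i.e. for each Borel set `B` the expected occupation time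
`∫_0^∞ Q_x^π(X_t ∈ B) dt` is either zero for all `x` or infinite for all `x`. -/
structure IsRecurrentEigenfunction (proc : BorelRightProcess E Ω) (S : ℝ≥0 → Ω → ℝ) (lam : ℝ)
    (π : E → ℝ) : Prop extends IsPositiveEigenfunction proc S lam π where
  recurrent : ∀ B : Set E, MeasurableSet B →
    (∀ x, ∫⁻ t in Ioi (0 : ℝ),
      eigenMeasure proc S lam π x t.toNNReal (proc.X t.toNNReal ⁻¹' B) = 0) ∨
    (∀ x, ∫⁻ t in Ioi (0 : ℝ),
      eigenMeasure proc S lam π x t.toNNReal (proc.X t.toNNReal ⁻¹' B) = ⊤)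

/-- The exponential ergodicity estimate under the eigen-measure, with limit law `ς`, constants
`c, α, t₀`, and `c_f = ∫ f / π dς` for Borel `|f| ≤ 1` (these integrals exist). -/
structure IsExponentiallyErgodic (proc : BorelRightProcess E Ω) (S : ℝ≥0 → Ω → ℝ) (lam : ℝ)
    (π : E → ℝ) (ς : Measure E) (c α : ℝ) (t₀ : ℝ≥0) : Prop where
  prob : IsProbabilityMeasure ς
  c_pos : 0 < c
  α_pos : 0 < α
  t₀_pos : 0 < t₀
  integrable : Integrable (fun y => 1 / π y) ς
  estimate : ∀ f : E → ℝ, Measurable f → (∀ y, |f y| ≤ 1) → ∀ t : ℝ≥0, t₀ ≤ t → ∀ x,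
    |(∫ ω, f (proc.X t ω) / π (proc.X t ω) ∂(eigenMeasure proc S lam π x t)) -
        ∫ y, f y / π y ∂ς| ≤ c * Real.exp (-α * t) / π x

end Markov

end

end LongTermRisk

open LongTermRisk

/-! By the Markov property and multiplicativity of `S`, the density `E_x[S_T | ℱ_t] / E_x[S_T]`
equals `S_t 𝒫_{T-t}1(X_t) / 𝒫_T 1(x)`. In terms of the pricing operators, the ergodicity hypothesis
multiplied by `π(x)` reads `e^{λt} 𝒫_t f(x) = c_f π(x) + O(e^{-αt})` with an error uniform in `x`
(`pricingOp_estimate`). With `f = 1` the leading coefficient `κ = ∫ 1/π dς` is positive and cancels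
in the ratio. The density therefore differs from `M_t^π` by at most `e^{-α(T-t)}` times a fixed
integrable variable, up to a constant (`tendsto_integral_abs_forwardDensity_sub`). Scaling `f` in
the same estimate gives the long-term pricing bound.

Everything else follows from this `L¹` convergence. Before time `T` no bond has been rolled over, so
on `[0, N]` and for `T > N` the process `S B^T` is a version of the martingale of forward densities.
Total variation on `ℱ_t` is bounded by the `L¹` distance of the densities. For the semimartingale
topology, Burkholder's weak-type inequality (`transform_martingale`) bounds `P(|∫ η dZ| > K)` by a
constant times `E|Z_N| / K`, uniformly over integrands `|η| ≤ 1`; it is applied to `Z = M^T - M^∞`.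

The passage from `M^T → M^∞` to `B^T = M^T / S → B^∞` needs no stochastic calculus. `IsControlled`
says that the path and all elementary integrals are bounded by a level outside events of small
probability, and discrete integration by parts shows that it is stable under products and
reciprocals.

Two technical points remain. Since `π` is only universally measurable, `π(X_t)` has no path
regularity, and `M^∞` is built by Doob's regularization along the dyadic times
(`exists_rcll_modification`); its positivity and that of its left limits come from a minimal
inequality. And since `S` is measurable only for the completed σ-algebras, the Markov property has
to be carried over from `σ(X_s : s ≥ 0)` to the completion (`exists_markov_version`). -/

namespace LongTermRisk

/-! ### Discrete time: maximal inequalities and the weak-type bound for martingale transforms. -/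

section DiscreteMartingales

variable {Ω : Type*} {mΩ : MeasurableSpace Ω} {μ : Measure Ω} [IsProbabilityMeasure μ]

lemma integral_mul_condExp_of_memLp_top {m : MeasurableSpace Ω} (hm : m ≤ mΩ) {f g : Ω → ℝ}
    (hg : StronglyMeasurable[m] g) (hg' : MemLp g ⊤ μ) (hf : MemLp f ⊤ μ) :
    ∫ ω, g ω * (μ[f | m]) ω ∂μ = ∫ ω, g ω * f ω ∂μ := by
  have h1 : Integrable (g * f) μ := (hf.mul (r := ⊤) hg').integrable le_top
  have h2 := condExp_mul_of_stronglyMeasurable_left hg h1 (hf.integrable le_top)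
  rw [← integral_condExp hm (f := fun ω => g ω * f ω)]
  exact (integral_congr_ae h2).symm

variable {𝒢 : Filtration ℕ mΩ} {h y : ℕ → Ω → ℝ} {K : ℝ}

/-- `L²` bound for the transform of the martingale part of a supermartingale in `[0, K]`. -/
lemma integral_transform_martingalePart_sq_le (hy : Supermartingale y 𝒢 μ)
    (h0 : ∀ i, 0 ≤ᵐ[μ] y i) (hK : ∀ i ω, y i ω ≤ K) (hm : ∀ i, StronglyMeasurable[𝒢 i] (h i))
    (hb : ∀ i ω, |h i ω| ≤ 1) (n : ℕ) :
    Integrable (fun ω => (∑ i ∈ Finset.range n,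
      h i ω * (y (i + 1) ω - y i ω - (μ[y (i + 1) - y i | 𝒢 i]) ω)) ^ 2) μ ∧
    ∫ ω, (∑ i ∈ Finset.range n,
      h i ω * (y (i + 1) ω - y i ω - (μ[y (i + 1) - y i | 𝒢 i]) ω)) ^ 2 ∂μ ≤
      2 * K * ∫ ω, y 0 ω ∂μ := by
  set d : ℕ → Ω → ℝ := fun i => y (i + 1) - y i with hd
  set e : ℕ → Ω → ℝ := fun i => μ[d i | 𝒢 i] with he
  have ymem : ∀ i, MemLp (y i) ⊤ μ := fun i => by
    refine memLp_top_of_bound (hy.integrable i).1 K ?_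
    filter_upwards [h0 i] with ω hω
    rw [Real.norm_eq_abs, abs_of_nonneg hω]
    exact hK i ω
  have hmem : ∀ i, MemLp (h i) ⊤ μ := fun i =>
    memLp_top_of_bound ((hm i).mono (𝒢.le i)).aestronglyMeasurable 1 (ae_of_all _ (hb i))
  have dmem : ∀ i, MemLp (d i) ⊤ μ := fun i => (ymem _).sub (ymem _)
  have emem : ∀ i, MemLp (e i) ⊤ μ := fun i => (dmem i).condExp le_top
  have e_sm : ∀ i, StronglyMeasurable[𝒢 i] (e i) := fun i => stronglyMeasurable_condExp
  have y_sm : ∀ i, StronglyMeasurable[𝒢 i] (y i) := hy.stronglyMeasurable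
  have mulmem : ∀ {f g : Ω → ℝ}, MemLp f ⊤ μ → MemLp g ⊤ μ → MemLp (fun ω => f ω * g ω) ⊤ μ :=
    fun hf hg => hg.mul (r := ⊤) hf
  have int : ∀ {f : Ω → ℝ}, MemLp f ⊤ μ → Integrable f μ := fun hf => hf.integrable le_top
  have dint : ∀ i, ∫ ω, e i ω ∂μ = ∫ ω, y (i + 1) ω ∂μ - ∫ ω, y i ω ∂μ := fun i => by
    rw [he, integral_condExp (𝒢.le i)]
    exact integral_sub (int (ymem _)) (int (ymem _))
  have e_nonpos : ∀ i, e i ≤ᵐ[μ] 0 := fun i => by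
    filter_upwards [hy.condExp_ae_le (Nat.le_succ i), condExp_sub (int (ymem (i + 1)))
      (int (ymem i)) (𝒢 i)] with ω h1 h2
    have h3 : (μ[y i | 𝒢 i]) ω = y i ω := by
      rw [condExp_of_stronglyMeasurable (𝒢.le i) (y_sm i) (int (ymem i))]
    have : e i ω = (μ[y (i + 1) | 𝒢 i] - μ[y i | 𝒢 i]) ω := h2
    rw [this, Pi.sub_apply, h3, Pi.zero_apply]
    exact sub_nonpos.2 h1
  -- `d² = y_{i+1}² - y_i² - 2 y_i d_i`, and `E[y_i d_i] = E[y_i e_i] ≥ K E[e_i]` because `e_i ≤ 0`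
  -- and `y_i ≤ K`. The resulting bound telescopes.
  have dsq : ∀ i, ∫ ω, d i ω ^ 2 ∂μ ≤ (∫ ω, y (i + 1) ω ^ 2 ∂μ - ∫ ω, y i ω ^ 2 ∂μ)
      - 2 * K * (∫ ω, y (i + 1) ω ∂μ - ∫ ω, y i ω ∂μ) := fun i => by
    have h1 : ∫ ω, y i ω * e i ω ∂μ = ∫ ω, y i ω * d i ω ∂μ :=
      integral_mul_condExp_of_memLp_top (𝒢.le i) (y_sm i) (ymem i) (dmem i)
    have h2 : K * ∫ ω, e i ω ∂μ ≤ ∫ ω, y i ω * e i ω ∂μ := by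
      rw [← integral_const_mul]
      refine integral_mono_ae ((int (emem i)).const_mul K) (int (mulmem (ymem i) (emem i))) ?_
      filter_upwards [e_nonpos i] with ω hω
      exact mul_le_mul_of_nonpos_right (hK i ω) hω
    have h3 : ∫ ω, d i ω ^ 2 ∂μ = ∫ ω, ((y (i + 1) ω ^ 2 - y i ω ^ 2) - 2 * (y i ω * d i ω)) ∂μ := by
      refine integral_congr_ae (ae_of_all _ fun ω => ?_)
      simp only [hd, Pi.sub_apply]; ring
    have sq_int : ∀ i, Integrable (fun ω => y i ω ^ 2) μ := fun i => by
      simpa only [sq] using int (mulmem (ymem i) (ymem i))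
    have i1 : Integrable (fun ω => y (i + 1) ω ^ 2 - y i ω ^ 2) μ := (sq_int _).sub (sq_int _)
    rw [h3, integral_sub i1 ((int (mulmem (ymem i) (dmem i))).const_mul 2),
      integral_sub (sq_int _) (sq_int _), integral_const_mul, ← h1]
    rw [dint] at h2
    linarith
  -- Conditional expectation is an orthogonal projection: `E(d - e)² = E d² - E e²`.
  have msq : ∀ i, ∫ ω, (d i ω - e i ω) ^ 2 ∂μ ≤ ∫ ω, d i ω ^ 2 ∂μ := fun i => by
    have h1 : ∫ ω, e i ω * e i ω ∂μ = ∫ ω, e i ω * d i ω ∂μ :=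
      integral_mul_condExp_of_memLp_top (𝒢.le i) (e_sm i) (emem i) (dmem i)
    have h3 : ∫ ω, (d i ω - e i ω) ^ 2 ∂μ =
        ∫ ω, ((d i ω * d i ω - 2 * (e i ω * d i ω)) + e i ω * e i ω) ∂μ :=
      integral_congr_ae (ae_of_all _ fun ω => by ring)
    have h4 : 0 ≤ ∫ ω, e i ω * e i ω ∂μ := integral_nonneg fun ω => mul_self_nonneg _
    have i1 := int (mulmem (dmem i) (dmem i))
    have i2 := (int (mulmem (emem i) (dmem i))).const_mul 2
    have i3 : Integrable (fun ω => d i ω * d i ω - 2 * (e i ω * d i ω)) μ := i1.sub i2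
    rw [h3, integral_add i3 (int (mulmem (emem i) (emem i))), integral_sub i1 i2,
      integral_const_mul, ← h1]
    simp only [sq]
    linarith
  set W : ℕ → Ω → ℝ := fun n ω => ∑ i ∈ Finset.range n, h i ω * (d i ω - e i ω) with hW
  have W_succ : ∀ n ω, W (n + 1) ω = W n ω + h n ω * (d n ω - e n ω) := fun n ω =>
    Finset.sum_range_succ _ _
  have mmem : ∀ i, MemLp (fun ω => d i ω - e i ω) ⊤ μ := fun i => (dmem i).sub (emem i)
  have Wmem : ∀ n, MemLp (W n) ⊤ μ := fun n => by
    induction n with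
    | zero => simp only [hW, Finset.range_zero, Finset.sum_empty]; exact memLp_const 0
    | succ k ih =>
      have : W (k + 1) = W k + fun ω => h k ω * (d k ω - e k ω) := funext (W_succ k)
      rw [this]
      exact ih.add (mulmem (hmem k) (mmem k))
  have W_sm : ∀ n, StronglyMeasurable[𝒢 n] (W n) := fun n => by
    refine Finset.stronglyMeasurable_fun_sum _ fun i hi => ?_
    have hin : i + 1 ≤ n := Finset.mem_range.1 hi
    have hin' : i ≤ n := (Nat.le_succ i).trans hin
    exact ((hm i).mono (𝒢.mono hin')).mul ((((y_sm (i + 1)).mono (𝒢.mono hin)).sub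
      ((y_sm i).mono (𝒢.mono hin'))).sub ((e_sm i).mono (𝒢.mono hin')))
  -- Martingale differences are orthogonal to the past, so the cross term vanishes.
  have step : ∀ n, ∫ ω, W (n + 1) ω ^ 2 ∂μ ≤ ∫ ω, W n ω ^ 2 ∂μ + ∫ ω, d n ω ^ 2 ∂μ := fun n => by
    have cross : ∫ ω, (W n ω * h n ω) * (d n ω - e n ω) ∂μ = 0 := by
      have h1 := integral_mul_condExp_of_memLp_top (𝒢.le n) ((W_sm n).mul (hm n))
        (mulmem (Wmem n) (hmem n)) (dmem n)
      have : ∀ ω, (W n ω * h n ω) * (d n ω - e n ω) =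
        (W n ω * h n ω) * d n ω - (W n ω * h n ω) * e n ω := fun ω => by ring
      simp only [this]
      rw [integral_sub (int (mulmem (mulmem (Wmem n) (hmem n)) (dmem n)))
        (int (mulmem (mulmem (Wmem n) (hmem n)) (emem n)))]
      exact sub_eq_zero.2 h1.symm
    have i1 := int (mulmem (Wmem n) (Wmem n))
    have i2 := (int (mulmem (mulmem (Wmem n) (hmem n)) (mmem n))).const_mul 2
    have i3 := int (mulmem (mulmem (hmem n) (mmem n)) (mulmem (hmem n) (mmem n)))
    have h3 : ∫ ω, W (n + 1) ω ^ 2 ∂μ = ∫ ω, ((W n ω * W n ω +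
        2 * ((W n ω * h n ω) * (d n ω - e n ω))) +
        (h n ω * (d n ω - e n ω)) * (h n ω * (d n ω - e n ω))) ∂μ :=
      integral_congr_ae (ae_of_all _ fun ω => by simp only [W_succ]; ring)
    have i4 : Integrable (fun ω => W n ω * W n ω +
      2 * ((W n ω * h n ω) * (d n ω - e n ω))) μ := i1.add i2
    rw [h3, integral_add i4 i3, integral_add i1 i2, integral_const_mul, cross]
    have h4 : ∫ ω, (h n ω * (d n ω - e n ω)) * (h n ω * (d n ω - e n ω)) ∂μ ≤
        ∫ ω, (d n ω - e n ω) ^ 2 ∂μ := by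
      refine integral_mono i3 (by simpa only [sq] using int (mulmem (mmem n) (mmem n))) fun ω => ?_
      have h5 : h n ω ^ 2 ≤ 1 := (sq_le_one_iff_abs_le_one _).2 (hb n ω)
      change (h n ω * (d n ω - e n ω)) * (h n ω * (d n ω - e n ω)) ≤ (d n ω - e n ω) ^ 2
      nlinarith [sq_nonneg (d n ω - e n ω)]
    have h6 := msq n
    simp only [sq] at h4 h6 ⊢
    linarith
  have tot : ∀ n, ∫ ω, W n ω ^ 2 ∂μ ≤ (∫ ω, y n ω ^ 2 ∂μ - ∫ ω, y 0 ω ^ 2 ∂μ)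
      - 2 * K * (∫ ω, y n ω ∂μ - ∫ ω, y 0 ω ∂μ) := fun n => by
    induction n with
    | zero => simp [hW]
    | succ k ih => linarith [step k, dsq k]
  have hWi : Integrable (fun ω => W n ω ^ 2) μ := by
    simpa only [sq] using int (mulmem (Wmem n) (Wmem n))
  refine ⟨hWi, (tot n).trans ?_⟩
  -- `E y_n² ≤ K E y_n` is absorbed by the term `-2K E y_n` of `tot`, which leaves `2K E y_0`.
  have hy2 : ∫ ω, y n ω ^ 2 ∂μ ≤ K * ∫ ω, y n ω ∂μ := by
    rw [← integral_const_mul]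
    refine integral_mono_ae (by simpa only [sq] using int (mulmem (ymem n) (ymem n)))
      ((int (ymem n)).const_mul K) ?_
    filter_upwards [h0 n] with ω hω
    have h1 : (0 : ℝ) ≤ y n ω := hω
    change y n ω ^ 2 ≤ K * y n ω
    nlinarith [hK n ω]
  have hyn : 0 ≤ K * ∫ ω, y n ω ∂μ := (integral_nonneg fun ω => sq_nonneg _).trans hy2
  have hy02 : 0 ≤ ∫ ω, y 0 ω ^ 2 ∂μ := integral_nonneg fun ω => sq_nonneg _
  linarith

/-- Doob decomposition. The martingale part is handled by Chebyshev in `L²` at level `K/2`, which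
costs `8 E y_0 / K`. The decreasing part has expected total variation at most `E y_0`, and Markov's
inequality at level `K/2` costs `2 E y_0 / K`. -/
lemma transform_bounded_supermartingale (hy : Supermartingale y 𝒢 μ)
    (h0 : ∀ i, 0 ≤ᵐ[μ] y i) (hK : ∀ i ω, y i ω ≤ K) (hK0 : 0 < K)
    (hm : ∀ i, StronglyMeasurable[𝒢 i] (h i)) (hb : ∀ i ω, |h i ω| ≤ 1) (n : ℕ) :
    μ.real {ω | K < |∑ i ∈ Finset.range n, h i ω * (y (i + 1) ω - y i ω)|} ≤
      10 * (∫ ω, y 0 ω ∂μ) / K := by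
  obtain ⟨hWi, hW⟩ := integral_transform_martingalePart_sq_le hy h0 hK hm hb n
  set e : ℕ → Ω → ℝ := fun i => μ[y (i + 1) - y i | 𝒢 i] with he
  set W : Ω → ℝ := fun ω => ∑ i ∈ Finset.range n, h i ω * (y (i + 1) ω - y i ω - e i ω) with hWd
  have e_nonpos : ∀ i, e i ≤ᵐ[μ] 0 := fun i => by
    filter_upwards [hy.condExp_ae_le (Nat.le_succ i), condExp_sub (hy.integrable (i + 1))
      (hy.integrable i) (𝒢 i)] with ω h1 h2
    have h3 : (μ[y i | 𝒢 i]) ω = y i ω := by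
      rw [condExp_of_stronglyMeasurable (𝒢.le i) (hy.stronglyMeasurable i) (hy.integrable i)]
    have : e i ω = (μ[y (i + 1) | 𝒢 i] - μ[y i | 𝒢 i]) ω := h2
    rw [this, Pi.sub_apply, h3, Pi.zero_apply]
    exact sub_nonpos.2 h1
  have dint : ∀ i, ∫ ω, e i ω ∂μ = ∫ ω, y (i + 1) ω ∂μ - ∫ ω, y i ω ∂μ := fun i => by
    rw [he, integral_condExp (𝒢.le i)]
    exact integral_sub (hy.integrable _) (hy.integrable _)
  have eint : ∀ i, Integrable (e i) μ := fun i => integrable_condExp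
  have hA : ∫ ω, ∑ i ∈ Finset.range n, |e i ω| ∂μ ≤ ∫ ω, y 0 ω ∂μ := by
    rw [integral_finsetSum _ fun i _ => (eint i).abs]
    have : ∀ i, ∫ ω, |e i ω| ∂μ = ∫ ω, y i ω ∂μ - ∫ ω, y (i + 1) ω ∂μ := fun i => by
      rw [← neg_sub, ← dint, ← integral_neg]
      refine integral_congr_ae ?_
      filter_upwards [e_nonpos i] with ω hω using abs_of_nonpos hω
    simp only [this]
    rw [Finset.sum_range_sub']
    linarith [integral_nonneg_of_ae (h0 n)]
  have m1 := mul_meas_ge_le_integral_of_nonneg (μ := μ) (f := fun ω => W ω ^ 2)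
    (ae_of_all _ fun ω => sq_nonneg (W ω)) hWi ((K / 2) ^ 2)
  have m2 := mul_meas_ge_le_integral_of_nonneg (μ := μ)
    (f := fun ω => ∑ i ∈ Finset.range n, |e i ω|)
    (ae_of_all _ fun ω => Finset.sum_nonneg fun i _ => abs_nonneg _)
    (integrable_finsetSum _ fun i _ => (eint i).abs) (K / 2)
  have hsub : {ω | K < |∑ i ∈ Finset.range n, h i ω * (y (i + 1) ω - y i ω)|} ⊆
      {ω | (K / 2) ^ 2 ≤ W ω ^ 2} ∪ {ω | K / 2 ≤ ∑ i ∈ Finset.range n, |e i ω|} := by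
    intro ω hω
    by_contra hcon
    simp only [mem_union, mem_ofPred_eq, not_or, not_le] at hcon hω
    have h1 : |W ω| < K / 2 := abs_lt_of_sq_lt_sq hcon.1 (by positivity)
    have h2 : ∑ i ∈ Finset.range n, h i ω * (y (i + 1) ω - y i ω) =
        W ω + ∑ i ∈ Finset.range n, h i ω * e i ω := by
      rw [hWd, ← Finset.sum_add_distrib]
      exact Finset.sum_congr rfl fun i _ => by ring
    have h3 : |∑ i ∈ Finset.range n, h i ω * e i ω| ≤ ∑ i ∈ Finset.range n, |e i ω| := by
      refine (Finset.abs_sum_le_sum_abs _ _).trans (Finset.sum_le_sum fun i _ => ?_)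
      rw [abs_mul]
      exact mul_le_of_le_one_left (abs_nonneg _) (hb i ω)
    rw [h2] at hω
    linarith [abs_add_le (W ω) (∑ i ∈ Finset.range n, h i ω * e i ω)]
  refine (measureReal_mono hsub).trans ((measureReal_union_le _ _).trans ?_)
  rw [le_div_iff₀ hK0]
  have m1' := m1.trans hW
  have m2' := m2.trans hA
  have : K * (μ.real {ω | (K / 2) ^ 2 ≤ W ω ^ 2} * K / 4) ≤ K * (2 * ∫ ω, y 0 ω ∂μ) := by
    linarith
  linarith [le_of_mul_le_mul_left this hK0]

lemma supermartingale_min_const {Y : ℕ → Ω → ℝ} (hY : Martingale Y 𝒢 μ) (K : ℝ) :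
    Supermartingale (fun i ω => min (Y i ω) K) 𝒢 μ := by
  have h1 := (hY.neg.submartingale.sup (martingale_const 𝒢 μ (-K)).submartingale).neg
  refine (congrArg (fun f => Supermartingale f 𝒢 μ) ?_).mpr h1
  funext i ω
  change min (Y i ω) K = -(max (-(Y i ω)) (-K))
  rw [max_neg_neg, neg_neg]

lemma maximal_ineq_real {f : ℕ → Ω → ℝ} (hf : Submartingale f 𝒢 μ) (h0 : 0 ≤ f) (hK : 0 ≤ K)
    (n : ℕ) : K * μ.real {ω | ∃ k ≤ n, K ≤ f k ω} ≤ ∫ ω in {ω | ∃ k ≤ n, K ≤ f k ω}, f n ω ∂μ := by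
  lift K to ℝ≥0 using hK
  have h1 := maximal_ineq hf h0 (ε := K) n
  have h2 : {ω | (K : ℝ) ≤ (Finset.range (n + 1)).sup' Finset.nonempty_range_add_one
      fun k => f k ω} = {ω | ∃ k ≤ n, K ≤ f k ω} := by
    ext ω
    simp only [mem_ofPred_eq, Finset.le_sup'_iff, Finset.mem_range, Nat.lt_succ_iff]
  rw [h2] at h1
  have h3 := ENNReal.toReal_mono ENNReal.ofReal_ne_top h1
  rwa [ENNReal.toReal_mul, ENNReal.coe_toReal, ENNReal.toReal_ofReal
    (integral_nonneg fun ω => h0 n ω)] at h3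

lemma martingale_maximal_ineq {Y : ℕ → Ω → ℝ} (hY : Martingale Y 𝒢 μ) (hK : 0 ≤ K) (n : ℕ) :
    K * μ.real {ω | ∃ k ≤ n, K ≤ |Y k ω|} ≤ ∫ ω, |Y n ω| ∂μ := by
  have h1 : Submartingale (fun i ω => |Y i ω|) 𝒢 μ := hY.submartingale.sup hY.neg.submartingale
  refine (maximal_ineq_real h1 (fun i ω => abs_nonneg _) hK n).trans ?_
  exact setIntegral_le_integral (h1.integrable n) (ae_of_all _ fun ω => abs_nonneg _)

/-- A martingale that becomes small has a small final value. -/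
lemma martingale_minimal_ineq {Y : ℕ → Ω → ℝ} (hY : Martingale Y 𝒢 μ) {ε : ℝ} (hε0 : 0 ≤ ε)
    (hε : ε < 1) (n : ℕ) : ∫ ω in {ω | ∃ k ≤ n, Y k ω ≤ ε}, min 1 (Y n ω) ∂μ ≤ ε := by
  -- The submartingale `(1 - Y)⁺` reaches `1 - ε` exactly when `Y` falls to `ε`, and `min 1 Y = 1 -
  -- (1 - Y)⁺`. On the event `A` in question the maximal inequality then gives `∫_A min 1 Y_n ≤ μ(A)
  -- - (1 - ε) μ(A)`.
  have h1 : Submartingale (fun i ω => max (1 - Y i ω) 0) 𝒢 μ :=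
    (((martingale_const 𝒢 μ (1 : ℝ)).sub hY).submartingale).pos
  have h2 := maximal_ineq_real (K := 1 - ε) h1 (fun i ω => le_max_right _ _) (by linarith) n
  have h3 : {ω | ∃ k ≤ n, 1 - ε ≤ max (1 - Y k ω) 0} = {ω | ∃ k ≤ n, Y k ω ≤ ε} := by
    ext ω
    refine exists_congr fun k => and_congr_right fun _ => ?_
    rw [le_max_iff]
    constructor
    · rintro (h | h) <;> linarith
    · intro h; left; linarith
  rw [h3] at h2
  have h4 : ∀ ω, min 1 (Y n ω) = 1 - max (1 - Y n ω) 0 := fun ω => by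
    rcases le_total (Y n ω) 1 with h | h
    · rw [min_eq_right h, max_eq_left (by linarith)]; ring
    · rw [min_eq_left h, max_eq_right (by linarith)]; ring
  simp only [h4]
  rw [integral_sub (integrable_const _) (h1.integrable n).integrableOn]
  have h5 : μ.real {ω | ∃ k ≤ n, Y k ω ≤ ε} ≤ 1 := measureReal_le_one
  simp only [integral_const, smul_eq_mul, mul_one, measureReal_restrict_apply_univ]
  nlinarith

/-- Unless `Y` reaches `K`, its transform coincides with that of the bounded supermartingale `min Y
K`. Doob's maximal inequality for the exceptional event raises the constant from 10 to 11. -/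
lemma transform_nonneg_martingale {Y : ℕ → Ω → ℝ} (hY : Martingale Y 𝒢 μ)
    (h0 : ∀ i, 0 ≤ᵐ[μ] Y i) (hK0 : 0 < K)
    (hm : ∀ i, StronglyMeasurable[𝒢 i] (h i)) (hb : ∀ i ω, |h i ω| ≤ 1) (n : ℕ) :
    μ.real {ω | K < |∑ i ∈ Finset.range n, h i ω * (Y (i + 1) ω - Y i ω)|} ≤
      11 * (∫ ω, Y n ω ∂μ) / K := by
  have int_eq : ∫ ω, Y 0 ω ∂μ = ∫ ω, Y n ω ∂μ := by
    simpa using hY.setIntegral_eq (Nat.zero_le n) (MeasurableSet.univ)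
  have hsup := supermartingale_min_const hY K
  have t1 := transform_bounded_supermartingale hsup
    (fun i => (h0 i).mono fun ω hω => le_min hω hK0.le) (fun i ω => min_le_right _ _) hK0 hm hb n
  have t2 := martingale_maximal_ineq hY hK0.le n
  have hsub : {ω | K < |∑ i ∈ Finset.range n, h i ω * (Y (i + 1) ω - Y i ω)|} ⊆
      {ω | K < |∑ i ∈ Finset.range n, h i ω * (min (Y (i + 1) ω) K - min (Y i ω) K)|} ∪
      {ω | ∃ k ≤ n, K ≤ |Y k ω|} := by
    intro ω hω
    by_cases hc : ω ∈ {ω | ∃ k ≤ n, K ≤ |Y k ω|}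
    · exact Or.inr hc
    · left
      simp only [mem_ofPred_eq, not_exists, not_and, not_le] at hc hω ⊢
      have hmin : ∀ k ≤ n, min (Y k ω) K = Y k ω := fun k hk =>
        min_eq_left ((le_abs_self _).trans (hc k hk).le)
      rwa [Finset.sum_congr rfl fun i hi => ?_]
      rw [hmin _ (Finset.mem_range.1 hi), hmin _ (Finset.mem_range.1 hi).le]
  refine (measureReal_mono hsub).trans ((measureReal_union_le _ _).trans ?_)
  have h1 : ∫ ω, min (Y 0 ω) K ∂μ ≤ ∫ ω, Y n ω ∂μ := by
    rw [← int_eq]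
    exact integral_mono (hsup.integrable 0) (hY.integrable 0) fun ω => min_le_left _ _
  have h2 : ∫ ω, |Y n ω| ∂μ = ∫ ω, Y n ω ∂μ :=
    integral_congr_ae ((h0 n).mono fun ω hω => abs_of_nonneg hω)
  rw [le_div_iff₀ hK0] at t1 ⊢
  linarith

/-- Weak-type inequality for martingale transforms. -/
theorem transform_martingale {Y : ℕ → Ω → ℝ} (hY : Martingale Y 𝒢 μ) (hK0 : 0 < K)
    (hm : ∀ i, StronglyMeasurable[𝒢 i] (h i)) (hb : ∀ i ω, |h i ω| ≤ 1) (n : ℕ) :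
    μ.real {ω | K < |∑ i ∈ Finset.range n, h i ω * (Y (i + 1) ω - Y i ω)|} ≤
      22 * (∫ ω, |Y n ω| ∂μ) / K := by
  -- Up to time `n`, `Y` is the difference of the nonnegative martingales closed by `Y_n⁺` and
  -- `Y_n⁻`. Each is used at level `K/2`, whence `22 = 2 · 11`.
  set p : Ω → ℝ := fun ω => max (Y n ω) 0
  set q : Ω → ℝ := fun ω => max (-Y n ω) 0
  have hp : Integrable p μ := (hY.integrable n).pos_part
  have hq : Integrable q μ := (hY.integrable n).neg_part
  have hpq : p - q = Y n := funext fun ω => max_zero_sub_max_neg_zero_eq_self _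
  have nonneg : ∀ {g : Ω → ℝ}, 0 ≤ g → ∀ i, 0 ≤ᵐ[μ] μ[g | 𝒢 i] := fun hg i =>
    condExp_nonneg (ae_of_all _ hg)
  have tp := transform_nonneg_martingale (martingale_condExp p 𝒢 μ)
    (nonneg fun ω => le_max_right _ _) (half_pos hK0) hm hb n
  have tq := transform_nonneg_martingale (martingale_condExp q 𝒢 μ)
    (nonneg fun ω => le_max_right _ _) (half_pos hK0) hm hb n
  rw [integral_condExp (𝒢.le n)] at tp tq
  have dec : ∀ᵐ ω ∂μ, ∀ i ≤ n, Y i ω = (μ[p | 𝒢 i]) ω - (μ[q | 𝒢 i]) ω := by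
    refine ae_all_iff.2 fun i => ?_
    by_cases hi : i ≤ n
    · have h1 := hY.condExp_ae_eq hi
      rw [← hpq] at h1
      filter_upwards [h1, condExp_sub hp hq (𝒢 i)] with ω h1 h2 _
      rw [← h1, h2, Pi.sub_apply]
    · exact ae_of_all _ fun ω h => absurd h hi
  have hsub : ({ω | K < |∑ i ∈ Finset.range n, h i ω * (Y (i + 1) ω - Y i ω)|} : Set Ω) ≤ᵐ[μ]
      ({ω | K / 2 < |∑ i ∈ Finset.range n, h i ω * ((μ[p | 𝒢 (i + 1)]) ω - (μ[p | 𝒢 i]) ω)|} ∪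
      {ω | K / 2 < |∑ i ∈ Finset.range n, h i ω * ((μ[q | 𝒢 (i + 1)]) ω - (μ[q | 𝒢 i]) ω)|} :
        Set Ω) := by
    filter_upwards [dec] with ω hω (hlt : K < _)
    have h1 : ∑ i ∈ Finset.range n, h i ω * (Y (i + 1) ω - Y i ω) =
      ∑ i ∈ Finset.range n, h i ω * ((μ[p | 𝒢 (i + 1)]) ω - (μ[p | 𝒢 i]) ω) -
      ∑ i ∈ Finset.range n, h i ω * ((μ[q | 𝒢 (i + 1)]) ω - (μ[q | 𝒢 i]) ω) := by
      rw [← Finset.sum_sub_distrib]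
      refine Finset.sum_congr rfl fun i hi => ?_
      rw [hω _ (Finset.mem_range.1 hi), hω _ (Finset.mem_range.1 hi).le]
      ring
    rw [h1] at hlt
    by_contra hcon
    have hcon' := not_or.1 hcon
    simp only [mem_ofPred_eq, not_lt] at hcon'
    have := abs_sub (∑ i ∈ Finset.range n, h i ω * ((μ[p | 𝒢 (i + 1)]) ω - (μ[p | 𝒢 i]) ω))
      (∑ i ∈ Finset.range n, h i ω * ((μ[q | 𝒢 (i + 1)]) ω - (μ[q | 𝒢 i]) ω))
    linarith
  refine (ENNReal.toReal_mono (measure_ne_top _ _) (measure_mono_ae hsub)).trans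
    ((measureReal_union_le _ _).trans ?_)
  have habs : ∫ ω, |Y n ω| ∂μ = ∫ ω, p ω ∂μ + ∫ ω, q ω ∂μ := by
    rw [← integral_add hp hq]
    exact integral_congr_ae (ae_of_all _ fun ω => (max_zero_add_max_neg_zero_eq_abs_self _).symm)
  rw [le_div_iff₀ (by positivity)] at tp tq
  rw [habs, le_div_iff₀ hK0]
  linarith

end DiscreteMartingales

end LongTermRisk

namespace LongTermRisk

noncomputable section

/-! ### Dyadic times, and one-sided limits from upcrossing counts. -/

section Dyadics

/-- The dyadic number `k / 2 ^ n`. -/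
def dyadic (n k : ℕ) : ℝ≥0 := k / 2 ^ n

/-- The set of nonnegative dyadic numbers. -/
def dyadics : Set ℝ≥0 := range fun p : ℕ × ℕ => dyadic p.1 p.2

lemma countable_dyadics : dyadics.Countable := countable_range _

lemma dyadic_mem (n k : ℕ) : dyadic n k ∈ dyadics := ⟨(n, k), rfl⟩

lemma dyadic_lt_iff {n k l : ℕ} : dyadic n k < dyadic n l ↔ k < l := by
  rw [dyadic, dyadic, div_lt_div_iff_of_pos_right (by positivity), Nat.cast_lt]

lemma dyadic_le_iff {n k l : ℕ} : dyadic n k ≤ dyadic n l ↔ k ≤ l := by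
  rw [dyadic, dyadic, div_le_div_iff_of_pos_right (by positivity), Nat.cast_le]

lemma dyadic_mono (n : ℕ) : Monotone (dyadic n) := fun _ _ h => dyadic_le_iff.2 h

lemma dyadic_refine (n m k : ℕ) : dyadic (n + m) (k * 2 ^ m) = dyadic n k := by
  rw [dyadic, dyadic, pow_add]
  push_cast
  rw [mul_div_mul_right _ _ (by positivity)]

lemma dyadic_natCast (n N : ℕ) : dyadic n (N * 2 ^ n) = N := by
  rw [dyadic]
  push_cast
  rw [mul_div_cancel_right₀ _ (by positivity)]

lemma eventually_eq_dyadic {q : ℝ≥0} (hq : q ∈ dyadics) :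
    ∀ᶠ n in atTop, ∃ k, q = dyadic n k := by
  obtain ⟨⟨n, k⟩, rfl⟩ := hq
  filter_upwards [eventually_ge_atTop n] with m hm
  obtain ⟨j, rfl⟩ := Nat.exists_eq_add_of_le hm
  exact ⟨_, (dyadic_refine n j k).symm⟩

/-- The smallest dyadic number of level `n` that is greater than `t`. -/
def nextDyadic (n : ℕ) (t : ℝ≥0) : ℝ≥0 := dyadic n (⌊t * 2 ^ n⌋₊ + 1)

lemma nextDyadic_mem (n : ℕ) (t : ℝ≥0) : nextDyadic n t ∈ dyadics := dyadic_mem _ _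

lemma lt_nextDyadic (n : ℕ) (t : ℝ≥0) : t < nextDyadic n t := by
  rw [nextDyadic, dyadic, lt_div_iff₀ (by positivity)]
  push_cast
  exact Nat.lt_floor_add_one _

lemma nextDyadic_le (n : ℕ) (t : ℝ≥0) : nextDyadic n t ≤ t + (1 / 2) ^ n := by
  rw [nextDyadic, dyadic, div_le_iff₀ (by positivity), add_mul, one_div, inv_pow,
    inv_mul_cancel₀ (by positivity)]
  push_cast
  gcongr
  exact Nat.floor_le (by positivity)

lemma tendsto_nextDyadic (t : ℝ≥0) :
    Tendsto (fun n => nextDyadic n t) atTop (𝓝[dyadics ∩ Ioi t] t) := by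
  refine tendsto_nhdsWithin_iff.2 ⟨?_, Eventually.of_forall fun n =>
    ⟨nextDyadic_mem n t, lt_nextDyadic n t⟩⟩
  have h : Tendsto (fun n : ℕ => t + (1 / 2 : ℝ≥0) ^ n) atTop (𝓝 (t + 0)) :=
    tendsto_const_nhds.add (NNReal.tendsto_pow_atTop_nhds_zero_of_lt_one (by norm_num [NNReal.half_lt_self]))
  rw [add_zero] at h
  exact tendsto_of_tendsto_of_tendsto_of_le_of_le tendsto_const_nhds h
    (fun n => (lt_nextDyadic n t).le) fun n => nextDyadic_le n t

instance dyadics_right_neBot (t : ℝ≥0) : (𝓝[dyadics ∩ Ioi t] t).NeBot :=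
  (tendsto_nextDyadic t).neBot

/-- The path has right and left limits along the dyadic numbers. -/
structure HasDyadicLimits (f : ℝ≥0 → ℝ) : Prop where
  right : ∀ t, ∃ l, Tendsto f (𝓝[dyadics ∩ Ioi t] t) (𝓝 l)
  left : ∀ t, ∃ l, Tendsto f (𝓝[dyadics ∩ Iio t] t) (𝓝 l)

/-- The right limit along the dyadic numbers. -/
def rightLim (f : ℝ≥0 → ℝ) (t : ℝ≥0) : ℝ := limsup (fun n => f (nextDyadic n t)) atTop

lemma HasDyadicLimits.tendsto_rightLim {f : ℝ≥0 → ℝ} (hf : HasDyadicLimits f) (t : ℝ≥0) :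
    Tendsto f (𝓝[dyadics ∩ Ioi t] t) (𝓝 (rightLim f t)) := by
  obtain ⟨l, hl⟩ := hf.right t
  have h : rightLim f t = l := (hl.comp (tendsto_nextDyadic t)).limsup_eq
  rwa [h]

/-- A closed condition satisfied by `f` at the dyadic points of an open set passes to `rightLim f`
on the whole set. Closeness to a limit, expressed by closed balls, is such a condition. -/
lemma HasDyadicLimits.isRCLL_rightLim {f : ℝ≥0 → ℝ} (hf : HasDyadicLimits f) :
    IsRCLL (rightLim f) := by
  have key : ∀ (t : ℝ≥0) (U : Set ℝ≥0) (C : Set ℝ), IsOpen U → t ∈ U → IsClosed C →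
      (∀ q ∈ dyadics, q ∈ U → f q ∈ C) → rightLim f t ∈ C := by
    intro t U C hU ht hC h
    refine hC.mem_of_tendsto (hf.tendsto_rightLim t) ?_
    filter_upwards [self_mem_nhdsWithin, nhdsWithin_le_nhds (hU.mem_nhds ht)] with q h1 h2
    exact h q h1.1 h2
  intro t
  constructor
  · rw [← continuousWithinAt_Ioi_iff_Ici, ContinuousWithinAt,
      Metric.nhds_basis_closedBall.tendsto_right_iff]
    intro ε hε
    have h1 := (hf.tendsto_rightLim t).eventually (Metric.closedBall_mem_nhds _ hε)
    rw [nhdsWithin, eventually_inf_principal, eventually_nhds_iff] at h1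
    obtain ⟨V, hV, hVo, htV⟩ := h1
    filter_upwards [self_mem_nhdsWithin, nhdsWithin_le_nhds (hVo.mem_nhds htV)] with s hs hsV
    exact key s (V ∩ Ioi t) _ (hVo.inter isOpen_Ioi) ⟨hsV, hs⟩ Metric.isClosed_closedBall
      fun q hq hqV => hV q hqV.1 ⟨hq, hqV.2⟩
  · obtain ⟨l, hl⟩ := hf.left t
    refine ⟨l, ?_⟩
    rw [Metric.nhds_basis_closedBall.tendsto_right_iff]
    intro ε hε
    have h1 := hl.eventually (Metric.closedBall_mem_nhds _ hε)
    rw [nhdsWithin, eventually_inf_principal, eventually_nhds_iff] at h1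
    obtain ⟨V, hV, hVo, htV⟩ := h1
    filter_upwards [self_mem_nhdsWithin, nhdsWithin_le_nhds (hVo.mem_nhds htV)] with s hs hsV
    exact key s (V ∩ Iio t) _ (hVo.inter isOpen_Iio) ⟨hsV, hs⟩ Metric.isClosed_closedBall
      fun q hq hqV => hV q hqV.1 ⟨hq, hqV.2⟩

/-- The path makes `j` upcrossings of `[a, b]` along dyadic times before `v`. -/
def HasUpcrossings (f : ℝ≥0 → ℝ) (a b : ℝ) : ℕ → ℝ≥0 → Prop
  | 0, _ => True
  | j + 1, v => ∃ w, HasUpcrossings f a b j w ∧ ∃ p ∈ dyadics, ∃ q ∈ dyadics,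
      w ≤ p ∧ p < q ∧ q < v ∧ f p ≤ a ∧ b ≤ f q

variable {Ω : Type*}

/-- The finitely many witnessing times lie on every sufficiently fine dyadic grid, and there the
greedy crossing times never lag behind the witnesses. -/
lemma HasUpcrossings.le_upcrossingsBefore {Z : ℝ≥0 → Ω → ℝ} {ω : Ω} {a b : ℝ} (hab : a < b)
    {j : ℕ} {v : ℝ≥0} {N : ℕ} (h : HasUpcrossings (fun t => Z t ω) a b j v) (hv : v < N) :
    ∀ᶠ n in atTop, j ≤ upcrossingsBefore a b (fun k => Z (dyadic n k)) (N * 2 ^ n) ω := by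
  have key : ∀ j v, HasUpcrossings (fun t => Z t ω) a b j v → v < N → ∀ᶠ n in atTop,
      dyadic n (upperCrossingTime a b (fun k => Z (dyadic n k)) (N * 2 ^ n) j ω) ≤ v := by
    intro j
    induction j with
    | zero =>
      intro v _ _
      refine Eventually.of_forall fun n => ?_
      simp [dyadic]
    | succ j ih =>
      rintro v ⟨w, hw, p, hp, q, hq, hwp, hpq, hqv, hpa, hqb⟩ hv
      filter_upwards [ih w hw (hwp.trans_lt (hpq.trans (hqv.trans hv))), eventually_eq_dyadic hp,
        eventually_eq_dyadic hq] with n h1 ⟨k, hk⟩ ⟨l, hl⟩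
      subst hk hl
      have hlN : l ≤ N * 2 ^ n := by
        rw [← dyadic_le_iff (n := n), dyadic_natCast]
        exact (hqv.trans hv).le
      have hkl := dyadic_lt_iff.1 hpq
      refine le_trans (dyadic_mono n ?_) hqv.le
      rw [upperCrossingTime_succ_eq]
      refine hittingBtwn_le_of_mem ?_ hlN hqb
      refine le_trans ?_ hkl.le
      exact hittingBtwn_le_of_mem (dyadic_le_iff.1 (h1.trans hwp)) (hkl.le.trans hlN) hpa
  filter_upwards [key j v h hv] with n hn
  refine le_csSup (upperCrossingTime_lt_bddAbove hab) ?_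
  rw [mem_ofPred_eq, ← dyadic_lt_iff (n := n), dyadic_natCast]
  exact hn.trans_lt hv

/-- The oscillation accumulates at `t` from the right, so the last upcrossing is chosen first and
the others are placed before it, still after `t`. From the left the order of choice is reversed. -/
lemma hasUpcrossings_of_frequently_right {f : ℝ≥0 → ℝ} {a b : ℝ} {t : ℝ≥0}
    (h1 : ∃ᶠ q in 𝓝[dyadics ∩ Ioi t] t, f q < a) (h2 : ∃ᶠ q in 𝓝[dyadics ∩ Ioi t] t, b < f q)
    (j : ℕ) : ∀ v, t < v → HasUpcrossings f a b j v := by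
  induction j with
  | zero => exact fun _ _ => trivial
  | succ j ih =>
    intro v hv
    obtain ⟨q, ⟨hq, hqv⟩, hqD, htq⟩ := ((h2.and_eventually (nhdsWithin_le_nhds
      (Iio_mem_nhds hv))).and_eventually self_mem_nhdsWithin).exists
    obtain ⟨p, ⟨hp, hpv⟩, hpD, htp⟩ := ((h1.and_eventually (nhdsWithin_le_nhds
      (Iio_mem_nhds htq))).and_eventually self_mem_nhdsWithin).exists
    exact ⟨p, ih p htp, p, hpD, q, hqD, le_rfl, hpv, hqv, hp.le, hq.le⟩

lemma hasUpcrossings_of_frequently_left {f : ℝ≥0 → ℝ} {a b : ℝ} {t : ℝ≥0}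
    (h1 : ∃ᶠ q in 𝓝[dyadics ∩ Iio t] t, f q < a) (h2 : ∃ᶠ q in 𝓝[dyadics ∩ Iio t] t, b < f q)
    (j : ℕ) : ∃ v < t, HasUpcrossings f a b j v := by
  induction j with
  | zero =>
    obtain ⟨q, -, -, hq⟩ := (h1.and_eventually self_mem_nhdsWithin).exists
    exact ⟨q, hq, trivial⟩
  | succ j ih =>
    obtain ⟨w, hw, hj⟩ := ih
    obtain ⟨p, ⟨hp, hwp⟩, hpD, hpt⟩ := ((h1.and_eventually (nhdsWithin_le_nhds
      (Ioi_mem_nhds hw))).and_eventually self_mem_nhdsWithin).exists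
    obtain ⟨q, ⟨hq, hpq⟩, hqD, hqt⟩ := ((h2.and_eventually (nhdsWithin_le_nhds
      (Ioi_mem_nhds hpt))).and_eventually self_mem_nhdsWithin).exists
    obtain ⟨v, hqv, hvt⟩ := exists_between (show q < t from hqt)
    exact ⟨v, hvt, w, hj, p, hpD, q, hqD, le_of_lt hwp, hpq, hqv, hp.le, hq.le⟩

/-- A bounded path without a limit oscillates across some rational interval and makes arbitrarily
many upcrossings of it. A bound for infinitely many levels `n` suffices, since the lower bound of
`HasUpcrossings.le_upcrossingsBefore` holds for all large `n`. -/
lemma hasDyadicLimits_of_upcrossings {Z : ℝ≥0 → Ω → ℝ} {ω : Ω}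
    (hb : ∀ N : ℕ, ∃ K, ∀ q ∈ dyadics, q ≤ N → |Z q ω| ≤ K)
    (hu : ∀ (a b : ℚ) (N : ℕ), a < b → ∃ C : ℕ, ∃ᶠ n in atTop,
      upcrossingsBefore a b (fun k => Z (dyadic n k)) (N * 2 ^ n) ω ≤ C) :
    HasDyadicLimits (fun t => Z t ω) := by
  have bdd : ∀ (t : ℝ≥0) (s : Set ℝ≥0), ∃ K, ∀ᶠ q in 𝓝[dyadics ∩ s] t, |Z q ω| ≤ K := by
    intro t s
    obtain ⟨N, hN⟩ := exists_nat_gt t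
    obtain ⟨K, hK⟩ := hb N
    refine ⟨K, ?_⟩
    filter_upwards [self_mem_nhdsWithin, nhdsWithin_le_nhds (Iio_mem_nhds hN)] with q h1 h2
    exact hK q h1.1 (le_of_lt h2)
  have lim : ∀ (t : ℝ≥0) (s : Set ℝ≥0),
      (∀ a b : ℚ, a < b → (∃ᶠ q in 𝓝[dyadics ∩ s] t, Z q ω < a) →
        (∃ᶠ q in 𝓝[dyadics ∩ s] t, b < Z q ω) →
        ∀ j, ∃ v < t + 1, HasUpcrossings (fun t => Z t ω) a b j v) →
      ∃ l, Tendsto (fun t => Z t ω) (𝓝[dyadics ∩ s] t) (𝓝 l) := by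
    intro t s h
    obtain ⟨K, hK⟩ := bdd t s
    refine tendsto_of_no_upcrossings Rat.denseRange_cast ?_
      ⟨K, eventually_map.2 (hK.mono fun q hq => (abs_le.1 hq).2)⟩
      ⟨-K, eventually_map.2 (hK.mono fun q hq => (abs_le.1 hq).1)⟩
    rintro _ ⟨a, rfl⟩ _ ⟨b, rfl⟩ hab ⟨h1, h2⟩
    obtain ⟨N, hN⟩ := exists_nat_gt (t + 1)
    obtain ⟨C, hC⟩ := hu a b N (by exact_mod_cast hab)
    obtain ⟨v, hv, hj⟩ := h a b (by exact_mod_cast hab) h1 h2 (C + 1)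
    obtain ⟨n, hn1, hn2⟩ := (hC.and_eventually
      (hj.le_upcrossingsBefore hab (hv.trans hN))).exists
    omega
  refine ⟨fun t => lim t _ fun a b _ h1 h2 j => ?_, fun t => lim t _ fun a b _ h1 h2 j => ?_⟩
  · exact ⟨t + 1 / 2, by gcongr; norm_num [NNReal.half_lt_self], hasUpcrossings_of_frequently_right h1 h2 j _
      (lt_add_of_pos_right _ (by positivity))⟩
  · obtain ⟨v, hv, h⟩ := hasUpcrossings_of_frequently_left h1 h2 j
    exact ⟨v, hv.trans (lt_add_of_pos_right _ one_pos), h⟩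

end Dyadics

/-! ### Doob regularization: RCLL modifications of martingales. -/

section Regularization

variable {Ω : Type*} {mΩ : MeasurableSpace Ω} {μ : Measure Ω}

/-- The filtration observed at the times `τ 0 ≤ τ 1 ≤ …`. -/
def sampleFiltration (ℱ : Filtration ℝ≥0 mΩ) (τ : ℕ → ℝ≥0) (hτ : Monotone τ) :
    Filtration ℕ mΩ where
  seq i := ℱ (τ i)
  mono' _ _ h := ℱ.mono (hτ h)
  le' _ := ℱ.le _

variable {ℱ : Filtration ℝ≥0 mΩ} {Z : ℝ≥0 → Ω → ℝ}

lemma martingale_sample (hZ : Martingale Z ℱ μ) {τ : ℕ → ℝ≥0} (hτ : Monotone τ) :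
    Martingale (fun i => Z (τ i)) (sampleFiltration ℱ τ hτ) μ :=
  ⟨fun i => hZ.1 (τ i), fun _ _ h => hZ.2 _ _ (hτ h)⟩

lemma setOf_exists_dyadic (p : Ω → ℝ≥0 → Prop) (N : ℕ) :
    {ω | ∃ s ∈ dyadics, s ≤ N ∧ p ω s} = ⋃ n, {ω | ∃ k ≤ N * 2 ^ n, p ω (dyadic n k)} := by
  ext ω
  simp only [mem_ofPred_eq, mem_iUnion]
  constructor
  · rintro ⟨_, ⟨⟨n, k⟩, rfl⟩, hs, hp⟩
    refine ⟨n, k, ?_, hp⟩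
    rwa [← dyadic_le_iff (n := n), dyadic_natCast]
  · rintro ⟨n, k, hk, hp⟩
    refine ⟨_, dyadic_mem n k, ?_, hp⟩
    rwa [← dyadic_le_iff (n := n), dyadic_natCast] at hk

lemma monotone_setOf_exists_dyadic (p : Ω → ℝ≥0 → Prop) (N : ℕ) :
    Monotone fun n => {ω | ∃ k ≤ N * 2 ^ n, p ω (dyadic n k)} := by
  intro n m hnm ω ⟨k, hk, hp⟩
  obtain ⟨j, rfl⟩ := Nat.exists_eq_add_of_le hnm
  refine ⟨k * 2 ^ j, ?_, by rwa [dyadic_refine]⟩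
  rw [pow_add, ← mul_assoc]
  gcongr

variable [IsProbabilityMeasure μ]

/-- The grid events increase with the level and the discrete bound depends only on the final value
`Z_N`, so it survives the limit. -/
lemma martingale_dyadic_maximal_ineq (hZ : Martingale Z ℱ μ) {K : ℝ} (hK : 0 < K) (N : ℕ) :
    μ {ω | ∃ s ∈ dyadics, s ≤ N ∧ K ≤ |Z s ω|} ≤ ENNReal.ofReal ((∫ ω, |Z N ω| ∂μ) / K) := by
  rw [setOf_exists_dyadic (fun ω s => K ≤ |Z s ω|),
    (monotone_setOf_exists_dyadic (fun ω s => K ≤ |Z s ω|) N).measure_iUnion]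
  refine iSup_le fun n => ?_
  have h := martingale_maximal_ineq (martingale_sample hZ (dyadic_mono n)) hK.le (N * 2 ^ n)
  rw [dyadic_natCast] at h
  rw [← ENNReal.ofReal_toReal (measure_ne_top μ _)]
  refine ENNReal.ofReal_le_ofReal ?_
  rw [le_div_iff₀ hK, mul_comm]
  exact h

lemma martingale_dyadic_bounded (hZ : Martingale Z ℱ μ) :
    ∀ᵐ ω ∂μ, ∀ N : ℕ, ∃ K, ∀ q ∈ dyadics, q ≤ N → |Z q ω| ≤ K := by
  refine ae_all_iff.2 fun N => ?_
  rw [ae_iff]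
  have h1 : Tendsto (fun j : ℕ => ENNReal.ofReal ((∫ ω, |Z N ω| ∂μ) / ((j : ℝ) + 1))) atTop
      (𝓝 (ENNReal.ofReal 0)) :=
    (ENNReal.continuous_ofReal.tendsto _).comp
      (tendsto_const_nhds.div_atTop (tendsto_atTop_add_const_right _ _ tendsto_natCast_atTop_atTop))
  rw [ENNReal.ofReal_zero] at h1
  refine le_antisymm (ge_of_tendsto h1 (Eventually.of_forall fun j => ?_)) zero_le
  refine le_trans (measure_mono fun ω hω => ?_)
    (martingale_dyadic_maximal_ineq hZ (K := (j : ℝ) + 1) (by positivity) N)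
  simp only [mem_ofPred_eq, not_exists, not_forall, not_le] at hω
  obtain ⟨q, hq, hqN, h⟩ := hω ((j : ℝ) + 1)
  exact ⟨q, hq, hqN, h.le⟩

/-- A martingale with positive final value is bounded away from zero along the dyadic numbers. -/
lemma martingale_dyadic_bounded_below (hZ : Martingale Z ℱ μ) (N : ℕ)
    (hpos : ∀ᵐ ω ∂μ, 0 < Z N ω) :
    ∀ᵐ ω ∂μ, ∃ ε > 0, ∀ q ∈ dyadics, q ≤ N → ε ≤ Z q ω := by
  -- `martingale_minimal_ineq` bounds integrals of `min 1 Z_N`. Under the measure with this density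
  -- it is a bound on probabilities, and positivity of `Z_N` makes `μ` absolutely continuous with
  -- respect to `ν`.
  set ν := μ.withDensity fun ω => ENNReal.ofReal (min 1 (Z N ω)) with hν
  have hint : Integrable (fun ω => min 1 (Z N ω)) μ :=
    (integrable_const (1 : ℝ)).inf (hZ.integrable N)
  have hac : μ ≪ ν := by
    refine withDensity_absolutelyContinuous' hint.1.aemeasurable.ennreal_ofReal ?_
    filter_upwards [hpos] with ω hω
    exact (ENNReal.ofReal_pos.2 (lt_min one_pos hω)).ne'
  have bound : ∀ ε : ℝ, 0 ≤ ε → ε < 1 →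
      ν {ω | ∃ s ∈ dyadics, s ≤ N ∧ Z s ω ≤ ε} ≤ ENNReal.ofReal ε := by
    intro ε h0 h1
    rw [setOf_exists_dyadic (fun ω s => Z s ω ≤ ε),
      (monotone_setOf_exists_dyadic (fun ω s => Z s ω ≤ ε) N).measure_iUnion]
    refine iSup_le fun n => ?_
    have h := martingale_minimal_ineq (martingale_sample hZ (dyadic_mono n)) h0 h1 (N * 2 ^ n)
    rw [dyadic_natCast] at h
    have hms : MeasurableSet {ω | ∃ k ≤ N * 2 ^ n, Z (dyadic n k) ω ≤ ε} := by
      have : {ω | ∃ k ≤ N * 2 ^ n, Z (dyadic n k) ω ≤ ε} =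
          ⋃ k, ⋃ (_ : k ≤ N * 2 ^ n), {ω | Z (dyadic n k) ω ≤ ε} := by ext; simp
      rw [this]
      exact MeasurableSet.iUnion fun k => MeasurableSet.iUnion fun _ =>
        measurableSet_le ((hZ.1 _).measurable.mono (ℱ.le _) le_rfl) measurable_const
    rw [hν, withDensity_apply _ hms, ← ofReal_integral_eq_lintegral_ofReal hint.integrableOn]
    · exact ENNReal.ofReal_le_ofReal h
    · filter_upwards [ae_restrict_of_ae hpos] with ω hω using le_min zero_le_one hω.le
  refine hac.ae_le (?_ : ∀ᵐ ω ∂ν, _)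
  rw [ae_iff]
  have h1 : Tendsto (fun j : ℕ => ENNReal.ofReal (1 / ((j : ℝ) + 2))) atTop
      (𝓝 (ENNReal.ofReal 0)) :=
    (ENNReal.continuous_ofReal.tendsto _).comp
      (tendsto_const_nhds.div_atTop (tendsto_atTop_add_const_right _ _ tendsto_natCast_atTop_atTop))
  rw [ENNReal.ofReal_zero] at h1
  refine le_antisymm (ge_of_tendsto h1 (Eventually.of_forall fun j => ?_)) zero_le
  have hj : (0 : ℝ) < 1 / ((j : ℝ) + 2) := by positivity
  refine le_trans (measure_mono fun ω hω => ?_) (bound (1 / ((j : ℝ) + 2)) hj.le ?_)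
  · simp only [mem_ofPred_eq, not_exists, not_and, not_forall, not_le] at hω
    obtain ⟨q, hq, hqN, h⟩ := hω _ hj
    exact ⟨q, hq, hqN, h.le⟩
  · rw [div_lt_one (by positivity)]
    linarith [Nat.cast_nonneg (α := ℝ) j]

/-- Doob's upcrossing inequality bounds the expected counts independently of `n`. By Fatou's lemma
their liminf is integrable, hence a.s. finite. -/
lemma martingale_frequently_upcrossings_le (hZ : Martingale Z ℱ μ) {a b : ℝ} (hab : a < b)
    (N : ℕ) : ∀ᵐ ω ∂μ, ∃ C : ℕ, ∃ᶠ n in atTop,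
      upcrossingsBefore a b (fun k => Z (dyadic n k)) (N * 2 ^ n) ω ≤ C := by
  set U : ℕ → Ω → ℕ := fun n => upcrossingsBefore a b (fun k => Z (dyadic n k)) (N * 2 ^ n)
  have hmart := fun n => martingale_sample hZ (dyadic_mono n)
  have hU : ∀ n, Measurable (U n) := fun n =>
    StronglyAdapted.measurable_upcrossingsBefore (hmart n).1 hab
  have hU' : ∀ n, Measurable fun ω => (U n ω : ℝ≥0∞) := fun n =>
    (measurable_from_top (f := fun k : ℕ => (k : ℝ≥0∞))).comp (hU n)
  set C : ℝ := (∫ ω, (Z N ω - a)⁺ ∂μ) / (b - a)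
  have hint : ∀ n, ∫⁻ ω, (U n ω : ℝ≥0∞) ∂μ ≤ ENNReal.ofReal C := fun n => by
    have h1 := (hmart n).submartingale.mul_integral_upcrossingsBefore_le_integral_pos_part a b
      (N * 2 ^ n)
    rw [dyadic_natCast] at h1
    have h2 : ∫⁻ ω, (U n ω : ℝ≥0∞) ∂μ = ENNReal.ofReal (∫ ω, (U n ω : ℝ) ∂μ) := by
      rw [ofReal_integral_eq_lintegral_ofReal
        (StronglyAdapted.integrable_upcrossingsBefore (hmart n).1 hab)
        (ae_of_all _ fun ω => Nat.cast_nonneg _)]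
      simp only [ENNReal.ofReal_natCast]
      rfl
    rw [h2]
    refine ENNReal.ofReal_le_ofReal ?_
    rw [le_div_iff₀ (sub_pos.2 hab), mul_comm]
    exact h1
  have hlim : ∫⁻ ω, liminf (fun n => (U n ω : ℝ≥0∞)) atTop ∂μ ≤ ENNReal.ofReal C :=
    (lintegral_liminf_le hU').trans (liminf_le_of_le (by isBoundedDefault) fun x hx => by
      obtain ⟨n, hn⟩ := hx.exists
      exact hn.trans (hint n))
  filter_upwards [ae_lt_top (.liminf hU') (hlim.trans_lt ENNReal.ofReal_lt_top).ne] with ω hω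
  obtain ⟨k, hk⟩ := ENNReal.exists_nat_gt hω.ne
  exact ⟨k, (frequently_lt_of_liminf_lt (by isBoundedDefault) hk).mono fun n hn =>
    (Nat.cast_lt.1 hn).le⟩

lemma martingale_hasDyadicLimits (hZ : Martingale Z ℱ μ) :
    ∀ᵐ ω ∂μ, HasDyadicLimits fun t => Z t ω := by
  have h : ∀ᵐ ω ∂μ, ∀ (a b : ℚ) (N : ℕ), a < b → ∃ C : ℕ, ∃ᶠ n in atTop,
      upcrossingsBefore a b (fun k => Z (dyadic n k)) (N * 2 ^ n) ω ≤ C := by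
    simp only [ae_all_iff]
    exact fun a b N hab => martingale_frequently_upcrossings_le hZ (by exact_mod_cast hab) N
  filter_upwards [martingale_dyadic_bounded hZ, h] with ω h1 h2
  exact hasDyadicLimits_of_upcrossings h1 h2

/-- A martingale for a right-continuous filtration has an RCLL modification. No completeness of
the filtration is needed: the modification is RCLL only almost surely. -/
theorem exists_rcll_modification (hrc : ∀ t, (⨅ s, ⨅ _ : t < s, ℱ s) ≤ ℱ t)
    (hZ : Martingale Z ℱ μ) :
    ∃ Y : ℝ≥0 → Ω → ℝ, Martingale Y ℱ μ ∧ (∀ t, Y t =ᵐ[μ] Z t) ∧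
      ∀ᵐ ω ∂μ, IsRCLL fun t => Y t ω := by
  -- `rightLim` is a limsup along `nextDyadic`, defined for every `ω`. For `s > t` all but finitely
  -- many of its terms are `ℱ_s`-measurable, and right-continuity of `ℱ` then makes `Y_t` measurable
  -- for `ℱ_t`.
  set Y : ℝ≥0 → Ω → ℝ := fun t ω => rightLim (fun s => Z s ω) t with hY
  have hlim := martingale_hasDyadicLimits hZ
  have meas : ∀ t, Measurable[ℱ t] (Y t) := by
    intro t
    refine Measurable.mono (ma := ⨅ s, ⨅ _ : t < s, ℱ s) ?_ (hrc t) le_rfl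
    intro A hA
    simp only [MeasurableSpace.measurableSet_iInf]
    intro s hs
    obtain ⟨n₀, hn₀⟩ : ∃ n₀, ∀ n ≥ n₀, nextDyadic n t ≤ s := eventually_atTop.1
      (((tendsto_nextDyadic t).mono_right nhdsWithin_le_nhds).eventually (Iic_mem_nhds hs))
    have h1 : Y t = fun ω => limsup (fun n => Z (nextDyadic (n + n₀) t) ω) atTop := by
      funext ω
      exact (limsup_nat_add (fun n => Z (nextDyadic n t) ω) n₀).symm
    rw [h1]
    refine (Measurable.limsup (mδ := ℱ s) fun n => ?_) hA
    exact (hZ.1 _).measurable.mono (ℱ.mono (hn₀ _ (Nat.le_add_left _ _))) le_rfl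
  have eq : ∀ t, Y t =ᵐ[μ] Z t := by
    intro t
    set f : ℕ → Ω → ℝ := fun n => Z (nextDyadic n t) with hf
    have hle : ∀ n, nextDyadic n t ≤ t + 1 := fun n => (nextDyadic_le n t).trans (by
      gcongr
      exact pow_le_one₀ (by positivity) (by norm_num [NNReal.half_lt_self]))
    -- The values at the approximating times are conditional expectations of `Z_{t+1}`, hence
    -- uniformly integrable, and their a.s. convergence holds in `L¹` as well.
    have hui' := (hZ.integrable (t + 1)).uniformIntegrable_condExp (ι := ℕ)
      (fun n => ℱ.le (nextDyadic n t))
    have hui : UniformIntegrable f 1 μ :=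
      hui'.ae_eq fun n => hZ.2 _ _ (hle n)
    have hae : ∀ᵐ ω ∂μ, Tendsto (fun n => f n ω) atTop (𝓝 (Y t ω)) := by
      filter_upwards [hlim] with ω hω
      exact (hω.tendsto_rightLim t).comp (tendsto_nextDyadic t)
    have hmem : MemLp (Y t) 1 μ := hui.memLp_of_ae_tendsto hae
    have hL1 := tendsto_Lp_finite_of_tendsto_ae le_rfl ENNReal.one_ne_top
      (fun n => (hZ.integrable _).1) hmem hui.unifIntegrable hae
    have hYsm : StronglyMeasurable[ℱ t] (Y t) := (meas t).stronglyMeasurable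
    have hYint : Integrable (Y t) μ := memLp_one_iff_integrable.1 hmem
    -- `Z_t - Y_t` is the conditional expectation of `f_n - Y_t` given `ℱ_t`, and conditioning
    -- contracts the `L¹` norm.
    have hbound : ∀ n, eLpNorm (Z t - Y t) 1 μ ≤ eLpNorm (f n - Y t) 1 μ := fun n => by
      refine le_trans (le_of_eq (eLpNorm_congr_ae ?_))
        (eLpNorm_condExp_le_eLpNorm (m := ℱ t) (f n - Y t) le_rfl)
      refine EventuallyEq.trans ?_ (condExp_sub (hZ.integrable _) hYint (ℱ t)).symm
      rw [condExp_of_stronglyMeasurable (ℱ.le t) hYsm hYint]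
      exact (hZ.2 _ _ (lt_nextDyadic n t).le).symm.sub (EventuallyEq.refl _ _)
    have h0 : eLpNorm (Z t - Y t) 1 μ = 0 :=
      le_antisymm (ge_of_tendsto hL1 (Eventually.of_forall hbound)) zero_le
    rw [eLpNorm_eq_zero_iff ((hZ.integrable t).sub hYint).1 one_ne_zero] at h0
    filter_upwards [h0] with ω hω
    exact (sub_eq_zero.1 hω).symm
  refine ⟨Y, hZ.congr (fun t => (meas t).stronglyMeasurable) fun t => (eq t).symm, eq, ?_⟩
  filter_upwards [hlim] with ω hω using hω.isRCLL_rightLim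

end Regularization

end

end LongTermRisk

namespace LongTermRisk

noncomputable section

/-! ### RCLL paths. -/

section Paths

variable {f g : ℝ≥0 → ℝ}

lemma IsRCLL.mul (hf : IsRCLL f) (hg : IsRCLL g) : IsRCLL fun t => f t * g t := by
  intro t
  obtain ⟨hf1, l, hl⟩ := hf t
  obtain ⟨hg1, m, hm⟩ := hg t
  exact ⟨hf1.mul hg1, l * m, hl.mul hm⟩

lemma IsRCLL.inv (hf : IsRCLL f) (hpos : ∀ t, 0 < f t) (hl : HasPosLeftLimits f) :
    IsRCLL fun t => (f t)⁻¹ := by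
  intro t
  obtain ⟨l, hl0, hl⟩ := hl t
  exact ⟨(hf t).1.inv₀ (hpos t).ne', l⁻¹, hl.inv₀ hl0.ne'⟩

lemma HasPosLeftLimits.mul (hf : HasPosLeftLimits f) (hg : HasPosLeftLimits g) :
    HasPosLeftLimits fun t => f t * g t := by
  intro t
  obtain ⟨l, hl0, hl⟩ := hf t
  obtain ⟨m, hm0, hm⟩ := hg t
  exact ⟨l * m, mul_pos hl0 hm0, hl.mul hm⟩

lemma HasPosLeftLimits.inv (hf : HasPosLeftLimits f) : HasPosLeftLimits fun t => (f t)⁻¹ := by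
  intro t
  obtain ⟨l, hl0, hl⟩ := hf t
  exact ⟨l⁻¹, inv_pos.2 hl0, hl.inv₀ hl0.ne'⟩

lemma IsRCLL.comp_min (hf : IsRCLL f) (T : ℝ≥0) : IsRCLL fun t => f (min t T) := by
  intro t
  rcases lt_or_ge t T with h | h
  · have h1 : ∀ᶠ s in 𝓝 t, f (min s T) = f s := by
      filter_upwards [Iio_mem_nhds h] with s hs
      rw [min_eq_left (le_of_lt hs)]
    obtain ⟨h2, l, hl⟩ := hf t
    refine ⟨h2.congr_of_eventuallyEq (nhdsWithin_le_nhds h1) (by rw [min_eq_left h.le]), l,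
      hl.congr' ?_⟩
    exact Eventually.mono (nhdsWithin_le_nhds h1) fun s hs => hs.symm
  · refine ⟨?_, ?_⟩
    · refine (continuousWithinAt_const (b := f T)).congr (fun s hs => ?_) ?_
      · rw [min_eq_right (h.trans hs)]
      · rw [min_eq_right h]
    · rcases h.eq_or_lt with rfl | h
      · obtain ⟨-, l, hl⟩ := hf T
        refine ⟨l, hl.congr' ?_⟩
        filter_upwards [self_mem_nhdsWithin] with s hs
        rw [min_eq_left (le_of_lt hs)]
      · refine ⟨f T, tendsto_const_nhds.congr' ?_⟩
        filter_upwards [nhdsWithin_le_nhds (Ioi_mem_nhds h)] with s hs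
        rw [min_eq_right (le_of_lt hs)]

lemma IsRCLL.bounded (hf : IsRCLL f) (t : ℝ≥0) : ∃ K, ∀ s ≤ t, |f s| ≤ K := by
  have h : ∃ K, ∀ s ∈ Icc 0 t, |f s| ≤ K := by
    refine isCompact_Icc.induction_on (p := fun A => ∃ K, ∀ s ∈ A, |f s| ≤ K) ⟨0, by simp⟩
      (fun A B hAB ⟨K, hK⟩ => ⟨K, fun s hs => hK s (hAB hs)⟩) ?_ ?_
    · rintro A B ⟨K, hK⟩ ⟨L, hL⟩
      refine ⟨max K L, fun s hs => ?_⟩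
      rcases hs with hs | hs
      · exact (hK s hs).trans (le_max_left _ _)
      · exact (hL s hs).trans (le_max_right _ _)
    · intro x _
      obtain ⟨h1, l, hl⟩ := hf x
      have e1 : ∀ᶠ s in 𝓝[≥] x, |f s| < |f x| + 1 :=
        h1.abs.eventually (gt_mem_nhds (lt_add_one _))
      have e2 : ∀ᶠ s in 𝓝[<] x, |f s| < |l| + 1 :=
        hl.abs.eventually (gt_mem_nhds (lt_add_one _))
      have e : ∀ᶠ s in 𝓝 x, |f s| ≤ max (|f x| + 1) (|l| + 1) := by
        rw [← nhdsLT_sup_nhdsGE, eventually_sup]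
        exact ⟨e2.mono fun s hs => hs.le.trans (le_max_right _ _),
          e1.mono fun s hs => hs.le.trans (le_max_left _ _)⟩
      exact ⟨_, nhdsWithin_le_nhds e, _, fun s hs => hs⟩
  obtain ⟨K, hK⟩ := h
  exact ⟨K, fun s hs => hK s ⟨zero_le, hs⟩⟩

/-- A right-continuous path that visits an open set before `N` does so at a dyadic time. -/
lemma exists_dyadic_mem {N : ℕ} (hf : ∀ s < (N : ℝ≥0), ContinuousWithinAt f (Ici s) s)
    {U : Set ℝ} (hU : IsOpen U) {s : ℝ≥0} (hs : s ≤ N) (hfs : f s ∈ U) :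
    ∃ q ∈ dyadics, q ≤ N ∧ f q ∈ U := by
  rcases hs.eq_or_lt with rfl | hs
  -- The endpoint `N` is itself dyadic, of level 0, so right-continuity is needed only before `N`.
  · exact ⟨_, ⟨(0, N), by simp [dyadic]⟩, le_rfl, hfs⟩
  · have h1 : ∀ᶠ q in 𝓝[dyadics ∩ Ioi s] s, f q ∈ U :=
      ((hf s hs).mono (inter_subset_right.trans Ioi_subset_Ici_self)).eventually
        (hU.mem_nhds hfs)
    have h2 : ∀ᶠ q in 𝓝[dyadics ∩ Ioi s] s, q < (N : ℝ≥0) := nhdsWithin_le_nhds (Iio_mem_nhds hs)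
    obtain ⟨q, ⟨h1, h2⟩, h3, -⟩ := ((h1.and h2).and self_mem_nhdsWithin).exists
    exact ⟨q, h3, le_of_lt h2, h1⟩

end Paths

/-! ### Stability of `IsControlled` under products and reciprocals. -/

section Control

variable {Ω : Type*} {mΩ : MeasurableSpace Ω} {μ : Measure Ω} {ℱ : Filtration ℝ≥0 mΩ}

/-- The path suprema of an RCLL process on a bounded interval are bounded in probability. -/
lemma exists_measure_sup_le [IsFiniteMeasure μ] {Y : ℝ≥0 → Ω → ℝ} (hY : ∀ t, Measurable (Y t))
    (hr : ∀ᵐ ω ∂μ, IsRCLL fun t => Y t ω) (N : ℕ) {ε : ℝ≥0∞} (hε : 0 < ε) :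
    ∃ K₀ : ℕ, ∀ K : ℝ, K₀ ≤ K → μ {ω | ∃ s ≤ (N : ℝ≥0), K < |Y s ω|} ≤ ε := by
  set G : ℕ → Set Ω := fun K => {ω | ∃ q ∈ dyadics, q ≤ (N : ℝ≥0) ∧ (K : ℝ) < |Y q ω|} with hG
  have Gm : ∀ K, MeasurableSet (G K) := fun K => by
    have : G K = ⋃ q ∈ dyadics, {ω | q ≤ (N : ℝ≥0) ∧ (K : ℝ) < |Y q ω|} := by
      ext ω; simp only [hG, mem_ofPred_eq, mem_iUnion, exists_prop]
    rw [this]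
    refine MeasurableSet.biUnion countable_dyadics fun q _ => ?_
    exact (MeasurableSet.const _).inter (measurableSet_lt measurable_const (hY q).abs)
  have Ga : Antitone G := fun K L hKL ω ⟨q, hq, hqN, h⟩ =>
    ⟨q, hq, hqN, lt_of_le_of_lt (by exact_mod_cast hKL) h⟩
  have Gi : μ (⋂ K, G K) = 0 := by
    refine measure_mono_null ?_ (ae_iff.1 hr)
    intro ω hω hrω
    obtain ⟨K, hK⟩ := hrω.bounded N
    obtain ⟨L, hL⟩ := exists_nat_gt K
    obtain ⟨q, -, hqN, h⟩ := mem_iInter.1 hω L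
    linarith [hK q hqN]
  have hlim := tendsto_measure_iInter_atTop (μ := μ) (fun K => (Gm K).nullMeasurableSet) Ga
    ⟨0, measure_ne_top _ _⟩
  rw [Gi] at hlim
  obtain ⟨K₀, hK₀⟩ := (hlim.eventually (gt_mem_nhds hε)).exists
  refine ⟨K₀, fun K hK => le_trans (measure_mono_ae ?_) hK₀.le⟩
  filter_upwards [hr] with ω hω ⟨s, hs, h⟩
  obtain ⟨q, hq, hqN, h⟩ := exists_dyadic_mem (fun s _ => (hω s).1)
    (isOpen_lt continuous_const continuous_abs) hs (show Y s ω ∈ {x | K < |x|} from h)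
  exact ⟨q, hq, hqN, hK.trans_lt h⟩

/-- Truncation to `[-1, 1]`. -/
def clip (x : ℝ) : ℝ := max (-1) (min x 1)

lemma abs_clip_le (x : ℝ) : |clip x| ≤ 1 :=
  abs_le.2 ⟨le_max_left _ _, max_le (by norm_num) (min_le_right _ _)⟩

lemma clip_of_abs_le {x : ℝ} (h : |x| ≤ 1) : clip x = x := by
  rw [clip, min_eq_left (abs_le.1 h).2, max_eq_right (abs_le.1 h).1]

lemma measurable_clip : Measurable clip := by unfold clip; fun_prop

namespace ElementaryIntegrand

/-- The integrand on the same time grid with coefficients `g i` truncated to `[-1, 1]`. -/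
def withCoef (η : ElementaryIntegrand ℱ) (g : ℕ → Ω → ℝ)
    (hg : ∀ i, Measurable[ℱ (η.time i)] (g i)) : ElementaryIntegrand ℱ where
  n := η.n
  time := η.time
  time_mono := η.time_mono
  init _ := 0
  init_meas := measurable_const
  init_le _ := by simp
  coef i ω := clip (g i ω)
  coef_meas i := measurable_clip.comp (hg i)
  coef_le _ _ := abs_clip_le _

/-- The coefficients used below, such as `coef i * Z / B`, are bounded by one only on a good event,
while an integrand must be bounded everywhere. On that event the truncation has no effect. -/
lemma withCoef_integral (η : ElementaryIntegrand ℱ) {g : ℕ → Ω → ℝ}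
    (hg : ∀ i, Measurable[ℱ (η.time i)] (g i)) (Z : ℝ≥0 → Ω → ℝ) (t : ℝ≥0) {ω : Ω}
    (h : ∀ i, |g i ω| ≤ 1) :
    (η.withCoef g hg).integral Z t ω = ∑ i ∈ Finset.range η.n,
      g i ω * (Z (min (η.time (i + 1)) t) ω - Z (min (η.time i) t) ω) := by
  simp only [integral, withCoef, zero_mul, zero_add]
  exact Finset.sum_congr rfl fun i _ => by rw [clip_of_abs_le (h i)]

open scoped Classical in
/-- The integrand stopped at `t`. -/
def stopAt (η : ElementaryIntegrand ℱ) (t : ℝ≥0) : ElementaryIntegrand ℱ where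
  n := η.n
  time i := min (η.time i) t
  time_mono _ _ h := min_le_min_right t (η.time_mono h)
  init := η.init
  init_meas := η.init_meas
  init_le := η.init_le
  -- After `t` the original coefficient is not known at the stopped time `t`. It multiplies a zero
  -- increment and may be replaced by 0.
  coef i := if η.time i ≤ t then η.coef i else 0
  coef_meas i := by
    split_ifs with h
    · rw [min_eq_left h]
      exact η.coef_meas i
    · exact measurable_const
  coef_le i ω := by
    split_ifs
    · exact η.coef_le i ω
    · simp

lemma stopAt_integral (η : ElementaryIntegrand ℱ) (Z : ℝ≥0 → Ω → ℝ) {s t : ℝ≥0} (hst : s ≤ t)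
    (ω : Ω) : (η.stopAt s).integral Z t ω = η.integral Z s ω := by
  simp only [integral, stopAt]
  congr 1
  refine Finset.sum_congr rfl fun i _ => ?_
  have h1 : ∀ r, min (min r s) t = min r s := fun r =>
    min_eq_left ((min_le_right r s).trans hst)
  rw [h1, h1]
  split_ifs with h
  · rfl
  · rw [min_eq_right (not_le.1 h).le, min_eq_right ((not_le.1 h).le.trans
      (η.time_mono (Nat.le_succ i)))]
    simp

lemma integral_congr_ae (η : ElementaryIntegrand ℱ) {Y Z : ℝ≥0 → Ω → ℝ} {t : ℝ≥0}
    (h : ∀ s ≤ t, Y s =ᵐ[μ] Z s) : η.integral Y t =ᵐ[μ] η.integral Z t := by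
  have h1 : ∀ᵐ ω ∂μ, ∀ i, Y (min (η.time i) t) ω = Z (min (η.time i) t) ω :=
    ae_all_iff.2 fun i => h _ (min_le_right _ _)
  filter_upwards [h1, h 0 zero_le] with ω h1 h2
  simp only [integral, h1, h2]

end ElementaryIntegrand

/-- With probability at least `1 - ε`, the path of `Y` on `[0, t]` is bounded by `A`; and so is
every elementary integral, each with probability at least `1 - ε`. -/
structure IsControlled (ℱ : Filtration ℝ≥0 mΩ) (μ : Measure Ω) (Y : ℝ≥0 → Ω → ℝ) (t : ℝ≥0)
    (A : ℝ) (ε : ℝ≥0∞) : Prop where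
  sup : μ {ω | ∃ s ≤ t, A < |Y s ω|} ≤ ε
  integral : ∀ η : ElementaryIntegrand ℱ, μ {ω | A < |η.integral Y t ω|} ≤ ε

lemma IsControlled.mono {Y : ℝ≥0 → Ω → ℝ} {t : ℝ≥0} {A B : ℝ} {ε δ : ℝ≥0∞}
    (h : IsControlled ℱ μ Y t A ε) (hAB : A ≤ B) (hεδ : ε ≤ δ) : IsControlled ℱ μ Y t B δ :=
  ⟨le_trans (measure_mono (by rintro _ ⟨s, hs, hlt⟩; exact ⟨s, hs, hAB.trans_lt hlt⟩))
      (h.sup.trans hεδ),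
    fun η => le_trans (measure_mono fun _ hlt => hAB.trans_lt hlt) ((h.integral η).trans hεδ)⟩

lemma IsControlled.mono_time {Y : ℝ≥0 → Ω → ℝ} {s t : ℝ≥0} {A : ℝ} {ε : ℝ≥0∞}
    (h : IsControlled ℱ μ Y t A ε) (hst : s ≤ t) : IsControlled ℱ μ Y s A ε := by
  refine ⟨le_trans (measure_mono (by rintro _ ⟨r, hr, hlt⟩; exact ⟨r, hr.trans hst, hlt⟩))
    h.sup, fun η => ?_⟩
  have := h.integral (η.stopAt s)
  simpa only [η.stopAt_integral Y hst] using this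

lemma IsControlled.congr {Y Z : ℝ≥0 → Ω → ℝ} {t : ℝ≥0} {A : ℝ} {ε : ℝ≥0∞}
    (h : IsControlled ℱ μ Y t A ε) (hYZ : ∀ᵐ ω ∂μ, ∀ s ≤ t, Y s ω = Z s ω) :
    IsControlled ℱ μ Z t A ε := by
  refine ⟨le_trans (measure_mono_ae ?_) h.sup, fun η => le_trans (measure_mono_ae ?_)
    (h.integral η)⟩
  · filter_upwards [hYZ] with ω hω ⟨s, hs, hlt⟩
    exact ⟨s, hs, by rwa [hω s hs]⟩
  · filter_upwards [η.integral_congr_ae (μ := μ) (Y := Y) (Z := Z) (t := t)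
      fun s hs => hYZ.mono fun ω hω => hω s hs] with ω hω (hlt : A < _)
    change A < _
    rwa [hω]

/-- Discrete quadratic variation: `∑ (Δy)² = y_n² - y_0² - 2 ∑ y Δy`. The last sum is an elementary
integral with integrand `y / A` bounded by one, so the total is at most `A² + 2A · A`. -/
lemma sum_sq_increment_le {y : ℕ → ℝ} {A : ℝ} (hA : 0 < A) (hy : ∀ i, |y i| ≤ A) (n : ℕ)
    (h : |∑ i ∈ Finset.range n, y i / A * (y (i + 1) - y i)| ≤ A) :
    ∑ i ∈ Finset.range n, (y (i + 1) - y i) ^ 2 ≤ 3 * A ^ 2 := by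
  have h1 : ∑ i ∈ Finset.range n, (y (i + 1) - y i) ^ 2 =
      (y n ^ 2 - y 0 ^ 2) - 2 * A * ∑ i ∈ Finset.range n, y i / A * (y (i + 1) - y i) := by
    rw [← Finset.sum_range_sub (fun i => y i ^ 2), Finset.mul_sum, ← Finset.sum_sub_distrib]
    refine Finset.sum_congr rfl fun i _ => ?_
    field_simp
    ring
  have h2 : y n ^ 2 ≤ A ^ 2 := sq_le_sq' (abs_le.1 (hy n)).1 (abs_le.1 (hy n)).2
  rw [h1]
  nlinarith [(abs_le.1 h).1, sq_nonneg (y 0)]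

/-- Discrete integration by parts: `Δ(yz) = z Δy + y Δz + Δy Δz`. The first two terms are integrals
after normalization by `B` and `A` and contribute `A B` each. The bracket term is at most `3 A B` by
Cauchy–Schwarz and `sum_sq_increment_le`. -/
lemma abs_sum_mul_increment_le {y z h : ℕ → ℝ} {A B : ℝ} (hA : 0 < A) (hB : 0 < B)
    (hh : ∀ i, |h i| ≤ 1) (hy : ∀ i, |y i| ≤ A) (hz : ∀ i, |z i| ≤ B) (n : ℕ)
    (h1 : |∑ i ∈ Finset.range n, h i * (z i / B) * (y (i + 1) - y i)| ≤ A)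
    (h2 : |∑ i ∈ Finset.range n, h i * (y i / A) * (z (i + 1) - z i)| ≤ B)
    (h3 : |∑ i ∈ Finset.range n, y i / A * (y (i + 1) - y i)| ≤ A)
    (h4 : |∑ i ∈ Finset.range n, z i / B * (z (i + 1) - z i)| ≤ B) :
    |∑ i ∈ Finset.range n, h i * (y (i + 1) * z (i + 1) - y i * z i)| ≤ 5 * (A * B) := by
  have q1 := sum_sq_increment_le hA hy n h3
  have q2 := sum_sq_increment_le hB hz n h4
  have dec : ∑ i ∈ Finset.range n, h i * (y (i + 1) * z (i + 1) - y i * z i) =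
      B * ∑ i ∈ Finset.range n, h i * (z i / B) * (y (i + 1) - y i) +
      A * ∑ i ∈ Finset.range n, h i * (y i / A) * (z (i + 1) - z i) +
      ∑ i ∈ Finset.range n, (h i * (y (i + 1) - y i)) * (z (i + 1) - z i) := by
    rw [Finset.mul_sum, Finset.mul_sum, ← Finset.sum_add_distrib, ← Finset.sum_add_distrib]
    refine Finset.sum_congr rfl fun i _ => ?_
    field_simp
    ring
  have cs := Finset.sum_mul_sq_le_sq_mul_sq (Finset.range n)
    (fun i => h i * (y (i + 1) - y i)) (fun i => z (i + 1) - z i)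
  have q3 : ∑ i ∈ Finset.range n, (h i * (y (i + 1) - y i)) ^ 2 ≤ 3 * A ^ 2 := by
    refine le_trans (Finset.sum_le_sum fun i _ => ?_) q1
    rw [mul_pow]
    exact mul_le_of_le_one_left (sq_nonneg _) ((sq_le_one_iff_abs_le_one _).2 (hh i))
  have q4 : |∑ i ∈ Finset.range n, (h i * (y (i + 1) - y i)) * (z (i + 1) - z i)| ≤
      3 * (A * B) := by
    refine abs_le_of_sq_le_sq ?_ (by positivity)
    refine cs.trans ((mul_le_mul q3 q2 (Finset.sum_nonneg fun i _ => sq_nonneg _)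
      (by positivity)).trans (le_of_eq (by ring)))
  rw [dec]
  have b1 : |B * ∑ i ∈ Finset.range n, h i * (z i / B) * (y (i + 1) - y i)| ≤ B * A := by
    rw [abs_mul, abs_of_pos hB]; gcongr
  have b2 : |A * ∑ i ∈ Finset.range n, h i * (y i / A) * (z (i + 1) - z i)| ≤ A * B := by
    rw [abs_mul, abs_of_pos hA]; gcongr
  refine (abs_add_three _ _ _).trans ?_
  linarith

/-- Second-order expansion with exact remainder, where `y'` is the next value: `1/y' - 1/y = -Δy /
y² + (Δy)² / (y² y')`. The first term is an integral with integrand normalized by `A²`, and the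
second is at most `A³` times the quadratic variation. -/
lemma abs_sum_inv_increment_le {y h : ℕ → ℝ} {A : ℝ} (hA : 0 < A)
    (hh : ∀ i, |h i| ≤ 1) (hy : ∀ i, |y i| ≤ A) (hy' : ∀ i, A⁻¹ ≤ y i) (n : ℕ)
    (h1 : |∑ i ∈ Finset.range n, h i * (((y i)⁻¹) ^ 2 / A ^ 2) * (y (i + 1) - y i)| ≤ A)
    (h2 : |∑ i ∈ Finset.range n, y i / A * (y (i + 1) - y i)| ≤ A) :
    |∑ i ∈ Finset.range n, h i * ((y (i + 1))⁻¹ - (y i)⁻¹)| ≤ A ^ 3 + 3 * A ^ 5 := by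
  have q1 := sum_sq_increment_le hA hy n h2
  have pos : ∀ i, 0 < y i := fun i => (inv_pos.2 hA).trans_le (hy' i)
  have inv_le : ∀ i, (y i)⁻¹ ≤ A := fun i => inv_le_of_inv_le₀ hA (hy' i)
  have dec : ∑ i ∈ Finset.range n, h i * ((y (i + 1))⁻¹ - (y i)⁻¹) =
      -(A ^ 2 * ∑ i ∈ Finset.range n, h i * (((y i)⁻¹) ^ 2 / A ^ 2) * (y (i + 1) - y i)) +
      ∑ i ∈ Finset.range n, h i * (y (i + 1) - y i) ^ 2 * (((y i)⁻¹) ^ 2 * (y (i + 1))⁻¹) := by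
    rw [Finset.mul_sum, ← Finset.sum_neg_distrib, ← Finset.sum_add_distrib]
    refine Finset.sum_congr rfl fun i _ => ?_
    have := (pos i).ne'
    have := (pos (i + 1)).ne'
    field_simp
    ring
  have b1 : |A ^ 2 * ∑ i ∈ Finset.range n, h i * (((y i)⁻¹) ^ 2 / A ^ 2) * (y (i + 1) - y i)| ≤
      A ^ 2 * A := by
    rw [abs_mul, abs_of_pos (by positivity)]; gcongr
  have b2 : |∑ i ∈ Finset.range n,
      h i * (y (i + 1) - y i) ^ 2 * (((y i)⁻¹) ^ 2 * (y (i + 1))⁻¹)| ≤ A ^ 3 * (3 * A ^ 2) := by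
    refine (Finset.abs_sum_le_sum_abs _ _).trans (le_trans (Finset.sum_le_sum fun i _ => ?_)
      (le_trans (le_of_eq (Finset.mul_sum _ _ _).symm)
        (mul_le_mul_of_nonneg_left q1 (by positivity))))
    have hp := inv_pos.2 (pos i)
    have hp' := inv_pos.2 (pos (i + 1))
    rw [abs_mul, abs_mul, abs_of_nonneg (sq_nonneg (y (i + 1) - y i)),
      abs_of_pos (a := ((y i)⁻¹) ^ 2 * (y (i + 1))⁻¹) (by positivity), mul_comm]
    refine mul_le_mul ?_ (mul_le_of_le_one_left (sq_nonneg _) (hh i)) (by positivity)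
      (by positivity)
    calc ((y i)⁻¹) ^ 2 * (y (i + 1))⁻¹ ≤ A ^ 2 * A :=
          mul_le_mul (pow_le_pow_left₀ hp.le (inv_le i) 2) (inv_le (i + 1)) hp'.le (by positivity)
      _ = A ^ 3 := by ring
  rw [dec]
  refine (abs_add_le _ _).trans ?_
  rw [abs_neg]
  linarith

variable {Y Z : ℝ≥0 → Ω → ℝ} {t : ℝ≥0} {A B : ℝ} {ε : ℝ≥0∞}

lemma measurable_sample {η : ElementaryIntegrand ℱ} (hY : ∀ s ≤ t, Measurable[ℱ s] (Y s)) (i : ℕ) :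
    Measurable[ℱ (η.time i)] (Y (min (η.time i) t)) :=
  (hY _ (min_le_right _ _)).mono (ℱ.mono (min_le_left _ _)) le_rfl

/-- Products of controlled processes are controlled. -/
theorem IsControlled.mul (hYm : ∀ s ≤ t, Measurable[ℱ s] (Y s))
    (hZm : ∀ s ≤ t, Measurable[ℱ s] (Z s)) (hA : 0 < A) (hB : 0 < B)
    (hY : IsControlled ℱ μ Y t A ε) (hZ : IsControlled ℱ μ Z t B ε) :
    IsControlled ℱ μ (fun s ω => Y s ω * Z s ω) t (6 * (A * B)) (6 * ε) := by
  have hAB : 0 < A * B := mul_pos hA hB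
  refine ⟨?_, fun η => ?_⟩
  · have hsub : {ω | ∃ s ≤ t, 6 * (A * B) < |Y s ω * Z s ω|} ⊆
        {ω | ∃ s ≤ t, A < |Y s ω|} ∪ {ω | ∃ s ≤ t, B < |Z s ω|} := by
      rintro ω ⟨s, hs, h⟩
      by_contra hcon
      simp only [mem_union, mem_ofPred_eq, not_or, not_exists, not_and, not_lt] at hcon
      have h1 : |Y s ω * Z s ω| ≤ A * B := by
        rw [abs_mul]
        exact mul_le_mul (hcon.1 s hs) (hcon.2 s hs) (abs_nonneg _) hA.le
      linarith
    refine (measure_mono hsub).trans ((measure_union_le _ _).trans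
      ((add_le_add hY.sup hZ.sup).trans ?_))
    rw [← two_mul]
    gcongr
    norm_num
  · have mY := measurable_sample (η := η) hYm
    have mZ := measurable_sample (η := η) hZm
    -- These are the four integrals required by `abs_sum_mul_increment_le`. With the two supremum
    -- events they make up the `6 ε`; the initial term adds `A B` to the `5 A B` of that lemma.
    set η₁ := η.withCoef (fun i ω => η.coef i ω * (Z (min (η.time i) t) ω / B))
      fun i => (η.coef_meas i).mul ((mZ i).div_const B)
    set η₂ := η.withCoef (fun i ω => η.coef i ω * (Y (min (η.time i) t) ω / A))
      fun i => (η.coef_meas i).mul ((mY i).div_const A)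
    set η₃ := η.withCoef (fun i ω => Y (min (η.time i) t) ω / A) fun i => (mY i).div_const A
    set η₄ := η.withCoef (fun i ω => Z (min (η.time i) t) ω / B) fun i => (mZ i).div_const B
    have hsub : {ω | 6 * (A * B) < |η.integral (fun s ω => Y s ω * Z s ω) t ω|} ⊆
        ({ω | ∃ s ≤ t, A < |Y s ω|} ∪ {ω | ∃ s ≤ t, B < |Z s ω|}) ∪
        (({ω | A < |η₁.integral Y t ω|} ∪ {ω | B < |η₂.integral Z t ω|}) ∪
        ({ω | A < |η₃.integral Y t ω|} ∪ {ω | B < |η₄.integral Z t ω|})) := by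
      intro ω hω
      by_contra hcon
      simp only [mem_union, mem_ofPred_eq, not_or, not_exists, not_and, not_lt] at hcon
      obtain ⟨⟨hy, hz⟩, ⟨h1, h2⟩, h3, h4⟩ := hcon
      have hy' : ∀ i, |Y (min (η.time i) t) ω| ≤ A := fun i => hy _ (min_le_right _ _)
      have hz' : ∀ i, |Z (min (η.time i) t) ω| ≤ B := fun i => hz _ (min_le_right _ _)
      have hyA : ∀ i, |Y (min (η.time i) t) ω / A| ≤ 1 := fun i => by
        rw [abs_div, abs_of_pos hA]; exact (div_le_one hA).2 (hy' i)
      have hzB : ∀ i, |Z (min (η.time i) t) ω / B| ≤ 1 := fun i => by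
        rw [abs_div, abs_of_pos hB]; exact (div_le_one hB).2 (hz' i)
      have prod : ∀ {a b : ℝ}, |a| ≤ 1 → |b| ≤ 1 → |a * b| ≤ 1 := fun ha hb => by
        rw [abs_mul]; exact mul_le_one₀ ha (abs_nonneg _) hb
      rw [η.withCoef_integral _ _ _ fun i => prod (η.coef_le i ω) (hzB i)] at h1
      rw [η.withCoef_integral _ _ _ fun i => prod (η.coef_le i ω) (hyA i)] at h2
      rw [η.withCoef_integral _ _ _ hyA] at h3
      rw [η.withCoef_integral _ _ _ hzB] at h4
      have main := abs_sum_mul_increment_le (y := fun i => Y (min (η.time i) t) ω)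
        (z := fun i => Z (min (η.time i) t) ω) (h := fun i => η.coef i ω) hA hB
        (fun i => η.coef_le i ω) hy' hz' η.n h1 h2 h3 h4
      have ini : |η.init ω * (Y 0 ω * Z 0 ω)| ≤ A * B := by
        rw [abs_mul, abs_mul]
        refine (mul_le_of_le_one_left (by positivity) (η.init_le ω)).trans ?_
        exact mul_le_mul (hy 0 zero_le) (hz 0 zero_le) (abs_nonneg _) hA.le
      have hω' : 6 * (A * B) < |η.integral (fun s ω => Y s ω * Z s ω) t ω| := hω
      rw [ElementaryIntegrand.integral] at hω'
      have := abs_add_le (η.init ω * (Y 0 ω * Z 0 ω)) (∑ i ∈ Finset.range η.n, η.coef i ω *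
        (Y (min (η.time (i + 1)) t) ω * Z (min (η.time (i + 1)) t) ω -
          Y (min (η.time i) t) ω * Z (min (η.time i) t) ω))
      linarith
    refine (measure_mono hsub).trans ?_
    refine (measure_union_le _ _).trans ((add_le_add ((measure_union_le _ _).trans
      (add_le_add hY.sup hZ.sup)) ((measure_union_le _ _).trans (add_le_add
      ((measure_union_le _ _).trans (add_le_add (hY.integral _) (hZ.integral _)))
      ((measure_union_le _ _).trans (add_le_add (hY.integral _) (hZ.integral _)))))).trans
      (le_of_eq (by ring)))

/-- The reciprocal of a controlled process bounded away from zero is controlled. -/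
theorem IsControlled.inv (hYm : ∀ s ≤ t, Measurable[ℱ s] (Y s)) (hA : 0 < A)
    (hY : IsControlled ℱ μ Y t A ε) (hY' : μ {ω | ∃ s ≤ t, Y s ω < A⁻¹} ≤ ε) :
    IsControlled ℱ μ (fun s ω => (Y s ω)⁻¹) t (A + (A ^ 3 + 3 * A ^ 5)) (4 * ε) := by
  have hA35 : 0 < A ^ 3 + 3 * A ^ 5 := by positivity
  have inv_le : ∀ {y : ℝ}, A⁻¹ ≤ y → |y⁻¹| ≤ A := fun {y} hy => by
    rw [abs_of_pos (inv_pos.2 ((inv_pos.2 hA).trans_le hy))]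
    exact inv_le_of_inv_le₀ hA hy
  refine ⟨?_, fun η => ?_⟩
  · have hsub : {ω | ∃ s ≤ t, A + (A ^ 3 + 3 * A ^ 5) < |(Y s ω)⁻¹|} ⊆
        {ω | ∃ s ≤ t, Y s ω < A⁻¹} := by
      rintro ω ⟨s, hs, h⟩
      refine ⟨s, hs, ?_⟩
      by_contra hcon
      linarith [inv_le (not_lt.1 hcon)]
    refine (measure_mono hsub).trans (hY'.trans (le_mul_of_one_le_left zero_le (by norm_num)))
  · have mY := measurable_sample (η := η) hYm
    -- Two integrals, the supremum event and the event of small values make up the `4 ε`. The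
    -- summand `A` in the level covers the initial term.
    set η₁ := η.withCoef (fun i ω => η.coef i ω * (((Y (min (η.time i) t) ω)⁻¹) ^ 2 / A ^ 2))
      fun i => (η.coef_meas i).mul (((mY i).inv.pow_const 2).div_const _)
    set η₂ := η.withCoef (fun i ω => Y (min (η.time i) t) ω / A) fun i => (mY i).div_const A
    have hsub : {ω | A + (A ^ 3 + 3 * A ^ 5) < |η.integral (fun s ω => (Y s ω)⁻¹) t ω|} ⊆
        ({ω | ∃ s ≤ t, A < |Y s ω|} ∪ {ω | ∃ s ≤ t, Y s ω < A⁻¹}) ∪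
        ({ω | A < |η₁.integral Y t ω|} ∪ {ω | A < |η₂.integral Y t ω|}) := by
      intro ω hω
      by_contra hcon
      simp only [mem_union, mem_ofPred_eq, not_or, not_exists, not_and, not_lt] at hcon
      obtain ⟨⟨hy, hp⟩, h1, h2⟩ := hcon
      have hy' : ∀ i, |Y (min (η.time i) t) ω| ≤ A := fun i => hy _ (min_le_right _ _)
      have hp' : ∀ i, A⁻¹ ≤ Y (min (η.time i) t) ω := fun i => hp _ (min_le_right _ _)
      have hyA : ∀ i, |Y (min (η.time i) t) ω / A| ≤ 1 := fun i => by
        rw [abs_div, abs_of_pos hA]; exact (div_le_one hA).2 (hy' i)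
      have hc : ∀ i, |η.coef i ω * (((Y (min (η.time i) t) ω)⁻¹) ^ 2 / A ^ 2)| ≤ 1 := fun i => by
        rw [abs_mul, abs_div, abs_pow, abs_of_pos (a := A ^ 2) (by positivity)]
        refine mul_le_one₀ (η.coef_le i ω) (by positivity) ?_
        exact (div_le_one (by positivity)).2
          (pow_le_pow_left₀ (abs_nonneg _) (inv_le (hp' i)) 2)
      rw [η.withCoef_integral _ _ _ hc] at h1
      rw [η.withCoef_integral _ _ _ hyA] at h2
      have main := abs_sum_inv_increment_le (y := fun i => Y (min (η.time i) t) ω)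
        (h := fun i => η.coef i ω) hA (fun i => η.coef_le i ω) hy' hp' η.n h1 h2
      have ini : |η.init ω * (Y 0 ω)⁻¹| ≤ A := by
        rw [abs_mul]
        exact (mul_le_of_le_one_left (abs_nonneg _) (η.init_le ω)).trans (inv_le (hp 0 zero_le))
      have hω' : A + (A ^ 3 + 3 * A ^ 5) < |η.integral (fun s ω => (Y s ω)⁻¹) t ω| := hω
      rw [ElementaryIntegrand.integral] at hω'
      have := abs_add_le (η.init ω * (Y 0 ω)⁻¹) (∑ i ∈ Finset.range η.n, η.coef i ω *
        ((Y (min (η.time (i + 1)) t) ω)⁻¹ - (Y (min (η.time i) t) ω)⁻¹))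
      linarith
    refine (measure_mono hsub).trans ?_
    refine (measure_union_le _ _).trans ((add_le_add ((measure_union_le _ _).trans
      (add_le_add hY.sup hY')) ((measure_union_le _ _).trans (add_le_add
      (hY.integral _) (hY.integral _)))).trans (le_of_eq (by ring)))

end Control

/-! ### Control of continuous-time martingales by their `L¹` norm; positivity of paths. -/

section MartingaleControl

variable {Ω : Type*} {mΩ : MeasurableSpace Ω} {μ : Measure Ω} [IsProbabilityMeasure μ]
  {ℱ : Filtration ℝ≥0 mΩ} {Z : ℝ≥0 → Ω → ℝ}

lemma martingale_integral_abs_mono (hZ : Martingale Z ℱ μ) {s t : ℝ≥0} (hst : s ≤ t) :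
    ∫ ω, |Z s ω| ∂μ ≤ ∫ ω, |Z t ω| ∂μ := by
  have h : Submartingale (fun i ω => |Z i ω|) ℱ μ := hZ.submartingale.sup hZ.neg.submartingale
  simpa using h.setIntegral_le hst MeasurableSet.univ

/-- An elementary integral is an initial term plus a discrete transform of the martingale sampled at
the stopped times. At level `K/2` the transform costs `44` and the initial term `2`. -/
lemma martingale_elementaryIntegral_le (hZ : Martingale Z ℱ μ) {K : ℝ} (hK : 0 < K) (t : ℝ≥0)
    (η : ElementaryIntegrand ℱ) :
    μ {ω | K < |η.integral Z t ω|} ≤ ENNReal.ofReal (46 * (∫ ω, |Z t ω| ∂μ) / K) := by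
  have h1 := transform_martingale (martingale_sample hZ (η.stopAt t).time_mono) (half_pos hK)
    (fun i => ((η.stopAt t).coef_meas i).stronglyMeasurable) (η.stopAt t).coef_le η.n
  have h2 := mul_meas_ge_le_integral_of_nonneg (μ := μ) (f := fun ω => |Z 0 ω|)
    (ae_of_all _ fun ω => abs_nonneg _) (hZ.integrable 0).abs (K / 2)
  have hsub : {ω | K < |η.integral Z t ω|} ⊆
      {ω | K / 2 < |∑ i ∈ Finset.range η.n, (η.stopAt t).coef i ω *
        (Z ((η.stopAt t).time (i + 1)) ω - Z ((η.stopAt t).time i) ω)|} ∪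
      {ω | K / 2 ≤ |Z 0 ω|} := by
    intro ω hω
    by_contra hcon
    simp only [mem_union, mem_ofPred_eq, not_or, not_lt, not_le] at hcon hω
    have h3 := η.stopAt_integral Z (le_refl t) ω
    have h4 : (η.stopAt t).integral Z t ω = η.init ω * Z 0 ω + ∑ i ∈ Finset.range η.n,
        (η.stopAt t).coef i ω * (Z ((η.stopAt t).time (i + 1)) ω - Z ((η.stopAt t).time i) ω) := by
      simp [ElementaryIntegrand.integral, ElementaryIntegrand.stopAt]
    have h5 : |η.init ω * Z 0 ω| ≤ |Z 0 ω| := by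
      rw [abs_mul]; exact mul_le_of_le_one_left (abs_nonneg _) (η.init_le ω)
    rw [← h3, h4] at hω
    linarith [abs_add_le (η.init ω * Z 0 ω) (∑ i ∈ Finset.range η.n,
        (η.stopAt t).coef i ω * (Z ((η.stopAt t).time (i + 1)) ω - Z ((η.stopAt t).time i) ω))]
  rw [← ENNReal.ofReal_toReal (measure_ne_top μ _)]
  refine ENNReal.ofReal_le_ofReal ?_
  refine (measureReal_mono hsub).trans ((measureReal_union_le _ _).trans ?_)
  have h3 := martingale_integral_abs_mono hZ (zero_le (a := t))
  have h4 := martingale_integral_abs_mono hZ (s := (η.stopAt t).time η.n) (min_le_right _ t)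
  rw [le_div_iff₀ (by positivity)] at h1
  rw [le_div_iff₀ hK]
  linarith

/-- A process that agrees with a martingale on `[0, N]` and has right-continuous paths there is
controlled by its `L¹` norm. -/
lemma isControlled_of_martingale (hZ : Martingale Z ℱ μ) {Y : ℝ≥0 → Ω → ℝ} {N : ℕ}
    (hYZ : ∀ s ≤ (N : ℝ≥0), Y s =ᵐ[μ] Z s)
    (hr : ∀ᵐ ω ∂μ, ∀ s < (N : ℝ≥0), ContinuousWithinAt (fun t => Y t ω) (Ici s) s) {K : ℝ}
    (hK : 0 < K) :
    IsControlled ℱ μ Y N K (ENNReal.ofReal (46 * (∫ ω, |Z N ω| ∂μ) / K)) := by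
  refine ⟨?_, fun η => ?_⟩
  · have h1 : ∀ᵐ ω ∂μ, ∀ q ∈ dyadics, q ≤ (N : ℝ≥0) → Y q ω = Z q ω := by
      refine (ae_ball_iff countable_dyadics).2 fun q _ => ?_
      by_cases hq : q ≤ (N : ℝ≥0)
      · exact (hYZ q hq).mono fun ω h _ => h
      · exact ae_of_all _ fun ω h => absurd h hq
    refine le_trans (measure_mono_ae ?_) ((martingale_dyadic_maximal_ineq hZ hK N).trans ?_)
    · filter_upwards [hr, h1] with ω hω h1 ⟨s, hs, h⟩
      obtain ⟨q, hq, hqN, h⟩ := exists_dyadic_mem hω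
        (isOpen_lt continuous_const continuous_abs) hs (show Y s ω ∈ {x | K < |x|} from h)
      refine ⟨q, hq, hqN, ?_⟩
      rw [← h1 q hq hqN]
      exact le_of_lt h
    · refine ENNReal.ofReal_le_ofReal ?_
      have : 0 ≤ ∫ ω, |Z N ω| ∂μ := integral_nonneg fun ω => abs_nonneg _
      gcongr
      linarith
  · refine le_trans (measure_mono_ae ?_) (martingale_elementaryIntegral_le hZ hK N η)
    filter_upwards [η.integral_congr_ae hYZ] with ω hω (hlt : K < _)
    change K < _
    rwa [← hω]

/-- An RCLL martingale with positive values has positive paths with positive left limits. -/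
lemma martingale_pos_leftLim (hZ : Martingale Z ℱ μ) (hr : ∀ᵐ ω ∂μ, IsRCLL fun t => Z t ω)
    (hpos : ∀ t, ∀ᵐ ω ∂μ, 0 < Z t ω) :
    ∀ᵐ ω ∂μ, (∀ t, 0 < Z t ω) ∧ HasPosLeftLimits fun t => Z t ω := by
  have h := ae_all_iff.2 fun N : ℕ => martingale_dyadic_bounded_below hZ N (hpos N)
  filter_upwards [hr, h] with ω hω h
  have lower : ∀ t, ∃ ε > 0, ∀ s < t, ε ≤ Z s ω := by
    intro t
    obtain ⟨N, hN⟩ := exists_nat_gt t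
    obtain ⟨ε, hε, h⟩ := h N
    refine ⟨ε, hε, fun s hs => ?_⟩
    by_contra hcon
    obtain ⟨q, hq, hqN, hlt⟩ := exists_dyadic_mem (f := fun t => Z t ω) (fun s _ => (hω s).1)
      isOpen_Iio (hs.trans hN).le (not_le.1 hcon)
    exact absurd (h q hq hqN) (not_le.2 hlt)
  refine ⟨fun t => ?_, fun t => ?_⟩
  · obtain ⟨ε, hε, h⟩ := lower (t + 1)
    exact hε.trans_le (h t (lt_add_one t))
  · obtain ⟨ε, hε, h⟩ := lower t
    rcases (zero_le (a := t)).eq_or_lt with rfl | ht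
    · refine ⟨1, one_pos, ?_⟩
      have : 𝓝[<] (0 : ℝ≥0) = ⊥ := by
        have : Iio (0 : ℝ≥0) = ∅ := by ext x; simp
        rw [this, nhdsWithin_empty]
      rw [this]
      exact tendsto_bot
    · obtain ⟨-, l, hl⟩ := hω t
      have : (𝓝[<] t).NeBot := nhdsLT_neBot_of_exists_lt ⟨0, ht⟩
      refine ⟨l, hε.trans_le (ge_of_tendsto hl ?_), hl⟩
      filter_upwards [self_mem_nhdsWithin] with s hs using h s hs

end MartingaleControl

/-! ### A criterion for convergence in Émery's topology. -/

section Emery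

variable {Ω : Type*} {mΩ : MeasurableSpace Ω} {μ : Measure Ω} [IsProbabilityMeasure μ]
  {ℱ : Filtration ℝ≥0 mΩ}

/-- Convergence in probability at integer horizons, uniform in `η`, suffices: the expectation of `1
∧ |f|` is at most `δ + μ(|f| > δ)`. -/
lemma tendsto_emeryDist {ι : Type*} {l : Filter ι} [l.IsCountablyGenerated]
    {X : ι → ℝ≥0 → Ω → ℝ} {Y : ℝ≥0 → Ω → ℝ}
    (h : ∀ (N : ℕ) (δ : ℝ), 0 < δ → ∀ ε : ℝ≥0∞, 0 < ε → ∀ᶠ i in l, ∀ η : ElementaryIntegrand ℱ,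
      μ {ω | δ < |η.integral (fun t ω => X i t ω - Y t ω) N ω|} ≤ ε) :
    Tendsto (fun i => emeryDist ℱ μ (X i) Y) l (𝓝 0) := by
  set a : ι → ℕ → ℝ≥0∞ := fun i n => ⨆ η : ElementaryIntegrand ℱ,
    ∫⁻ ω, min 1 (ENNReal.ofReal |η.integral (fun t ω => X i t ω - Y t ω) ((n : ℝ≥0) + 1) ω|) ∂μ
    with ha
  have a_le : ∀ i n, a i n ≤ 1 := fun i n => iSup_le fun η => by
    refine (lintegral_mono fun ω => min_le_left _ _).trans ?_
    simp
  have a_lim : ∀ n, Tendsto (fun i => a i n) l (𝓝 0) := by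
    intro n
    refine ENNReal.tendsto_nhds_zero.2 fun ε hε => ?_
    obtain ⟨δ, hδ0, hδε⟩ : ∃ δ : ℝ, 0 < δ ∧ ENNReal.ofReal δ ≤ ε / 2 := by
      rcases eq_or_ne ε ⊤ with rfl | hε'
      · exact ⟨1, one_pos, by simp [ENNReal.top_div_of_ne_top]⟩
      · refine ⟨(ε / 2).toReal, ENNReal.toReal_pos (ENNReal.half_pos hε.ne').ne'
          (ENNReal.div_ne_top hε' (by norm_num)), ENNReal.ofReal_toReal_le⟩
    filter_upwards [h (n + 1) δ hδ0 (ε / 2) (ENNReal.half_pos hε.ne')] with i hi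
    refine iSup_le fun η => ?_
    have hi := hi η
    rw [Nat.cast_add, Nat.cast_one] at hi
    set f : Ω → ℝ := η.integral (fun t ω => X i t ω - Y t ω) ((n : ℝ≥0) + 1)
    set G := toMeasurable μ {ω | δ < |f ω|}
    calc ∫⁻ ω, min 1 (ENNReal.ofReal |f ω|) ∂μ
        ≤ ∫⁻ ω, ENNReal.ofReal δ + G.indicator 1 ω ∂μ := by
          refine lintegral_mono fun ω => ?_
          by_cases hω : δ < |f ω|
          · have : ω ∈ G := subset_toMeasurable _ _ hω
            rw [indicator_of_mem this]
            exact (min_le_left _ _).trans le_add_self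
          · exact (min_le_right _ _).trans ((ENNReal.ofReal_le_ofReal (not_lt.1 hω)).trans
              le_self_add)
      _ = ENNReal.ofReal δ + μ {ω | δ < |f ω|} := by
          rw [lintegral_add_left measurable_const, lintegral_indicator_one
            (measurableSet_toMeasurable _ _), measure_toMeasurable]
          simp
      _ ≤ ε / 2 + ε / 2 := add_le_add hδε hi
      _ = ε := ENNReal.add_halves ε
  have geo : ∑' n : ℕ, (2⁻¹ : ℝ≥0∞) ^ (n + 1) = 1 := by
    rw [ENNReal.tsum_geometric_add_one, ENNReal.one_sub_inv_two, inv_inv,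
      ENNReal.inv_mul_cancel (by norm_num) (by norm_num)]
  -- The series is an integral against counting measure, dominated by the geometric weights.
  have key := tendsto_lintegral_filter_of_dominated_convergence (μ := Measure.count) (l := l)
    (F := fun i n => (2⁻¹ : ℝ≥0∞) ^ (n + 1) * a i n) (f := fun _ => 0)
    (fun n => (2⁻¹ : ℝ≥0∞) ^ (n + 1)) (Eventually.of_forall fun i => measurable_from_top)
    (Eventually.of_forall fun i => ae_of_all _ fun n => mul_le_of_le_one_right' (a_le i n))
    (by rw [lintegral_count, geo]; exact ENNReal.one_ne_top)
    (ae_of_all _ fun n => by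
      have := ENNReal.Tendsto.const_mul (a := (2⁻¹ : ℝ≥0∞) ^ (n + 1)) (a_lim n)
        (Or.inr (ENNReal.pow_ne_top (by norm_num)))
      rwa [mul_zero] at this)
  simp only [lintegral_count, tsum_zero] at key
  exact key

end Emery

end

end LongTermRisk

namespace LongTermRisk

noncomputable section

/-! ### The Markov property for the completed filtration. -/

section Markov

variable {E Ω : Type*} [MetricSpace E] [MeasurableSpace E] [mΩ : MeasurableSpace Ω]

instance (proc : BorelRightProcess E Ω) (x : E) : IsProbabilityMeasure (proc.P x) := proc.prob x

variable (proc : BorelRightProcess E Ω)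

lemma rawSigma_le : rawSigma proc.X ≤ mΩ := fun A hA =>
  (proc.measurableSet_iff A).2 fun _ _ => ⟨A, ∅, hA, @MeasurableSet.empty _ (_), by simp, by simp⟩

lemma rawSigmaUpTo_le (t : ℝ≥0) : rawSigmaUpTo proc.X t ≤ proc.ℱ t := fun A hA =>
  (proc.filtration_iff t A).2 fun _ _ => ⟨A, ∅, hA, @MeasurableSet.empty _ (_), by simp, by simp⟩

lemma measurable_rawSigmaUpTo (t : ℝ≥0) : Measurable[rawSigmaUpTo proc.X t] (proc.X t) :=
  measurable_iff_comap_le.2 (le_iSup₂_of_le t le_rfl le_rfl)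

lemma measurable_rawSigma (t : ℝ≥0) : Measurable[rawSigma proc.X] (proc.X t) :=
  measurable_iff_comap_le.2 (le_iSup_of_le t le_rfl)

lemma measurable_filtration (t : ℝ≥0) : Measurable[proc.ℱ t] (proc.X t) :=
  (measurable_rawSigmaUpTo proc t).mono (rawSigmaUpTo_le proc t) le_rfl

lemma measurable_process (t : ℝ≥0) : Measurable (proc.X t) :=
  (measurable_filtration proc t).mono (proc.ℱ.le t) le_rfl

lemma measurable_shift (t : ℝ≥0) : Measurable[rawSigma proc.X, rawSigma proc.X] (proc.θ t) := by
  rw [measurable_iff_comap_le, rawSigma, MeasurableSpace.comap_iSup]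
  refine iSup_le fun s => ?_
  rw [MeasurableSpace.comap_comp]
  refine le_iSup_of_le (t + s) (le_of_eq ?_)
  congr 1
  exact funext fun ω => proc.shift s t ω

/-- The law `P_y` on `σ(X_s : s ≥ 0)`. -/
def rawProb (y : E) : @Measure Ω (rawSigma proc.X) := (proc.P y).trim (rawSigma_le proc)

lemma measurable_rawProb :
    @Measurable E (@Measure Ω (rawSigma proc.X)) _ (@Measure.instMeasurableSpace Ω (rawSigma proc.X))
      (rawProb proc) := by
  refine @Measure.measurable_of_measurable_coe Ω E (rawSigma proc.X) _ _ fun A hA => ?_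
  simp only [rawProb, trim_measurableSet_eq (rawSigma_le proc) hA]
  exact proc.measurable_prob A hA

/-- The law `P_μ` on `σ(X_s : s ≥ 0)`. -/
def rawLaw (μ : Measure E) : @Measure Ω (rawSigma proc.X) :=
  @Measure.bind E Ω _ (rawSigma proc.X) μ (rawProb proc)

lemma rawLaw_apply (μ : Measure E) {A : Set Ω} (hA : MeasurableSet[rawSigma proc.X] A) :
    rawLaw proc μ A = ∫⁻ y, proc.P y A ∂μ := by
  rw [rawLaw, @Measure.bind_apply E Ω _ (rawSigma proc.X) _ _ _ hA
    (@Measurable.aemeasurable _ _ _ (_) _ _ (measurable_rawProb proc))]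
  simp only [rawProb, trim_measurableSet_eq (rawSigma_le proc) hA]

lemma nullMeasurableSet_rawLaw (μ : Measure E) [IsProbabilityMeasure μ] {A : Set Ω}
    (hA : MeasurableSet A) : @NullMeasurableSet Ω (rawSigma proc.X) A (rawLaw proc μ) := by
  obtain ⟨A₀, N, hA₀, hN, hN0, hsub⟩ := (proc.measurableSet_iff A).1 hA μ inferInstance
  refine @NullMeasurableSet.congr Ω (rawSigma proc.X) _ _ _
    (@MeasurableSet.nullMeasurableSet _ (rawSigma proc.X) _ _ hA₀) ?_
  have h0 : rawLaw proc μ N = 0 := (rawLaw_apply proc μ hN).trans hN0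
  refine (measure_symmDiff_eq_zero_iff.1 ?_)
  rw [symmDiff_comm]
  exact measure_mono_null hsub h0

/-- A function measurable for the completion agrees with a `σ(X_s : s ≥ 0)`-measurable one outside
a null set of `P_μ`. -/
lemma exists_raw_version (μ : Measure E) [IsProbabilityMeasure μ] {f : Ω → ℝ≥0∞}
    (hf : Measurable f) :
    ∃ (f₀ : Ω → ℝ≥0∞) (N : Set Ω), Measurable[rawSigma proc.X] f₀ ∧
      MeasurableSet[rawSigma proc.X] N ∧ ∫⁻ y, proc.P y N ∂μ = 0 ∧ ∀ ω ∉ N, f ω = f₀ ω := by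
  have h1 : @NullMeasurable Ω _ (rawSigma proc.X) _ f (rawLaw proc μ) :=
    fun A hA => nullMeasurableSet_rawLaw proc μ (hf hA)
  obtain ⟨f₀, hf₀, heq⟩ := @NullMeasurable.aemeasurable _ _ (rawSigma proc.X) _ _ _ _ h1
  set N := @toMeasurable Ω (rawSigma proc.X) (rawLaw proc μ) {ω | ¬ f ω = f₀ ω}
  have hN : MeasurableSet[rawSigma proc.X] N :=
    @measurableSet_toMeasurable Ω (rawSigma proc.X) _ _
  refine ⟨f₀, N, hf₀, hN, ?_, fun ω hω => ?_⟩
  · rw [← rawLaw_apply proc μ hN]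
    exact (@measure_toMeasurable Ω (rawSigma proc.X) _ _).trans (ae_iff.1 heq)
  · by_contra h
    exact hω (@subset_toMeasurable Ω (rawSigma proc.X) (rawLaw proc μ) _ _ h)

/-- For each initial law `μ`, `φ` agrees with a Borel function outside a set that is null for the
law of `X_t` under `P_μ`. The preimage of this set is a null set allowed by the completion. -/
lemma measurable_comp_of_universally {φ : E → ℝ} (hφ : IsUniversallyMeasurable φ) (t : ℝ≥0) :
    Measurable[proc.ℱ t] fun ω => φ (proc.X t ω) := by
  intro U hU
  refine (proc.filtration_iff t _).2 fun μ hμ => ?_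
  set ν : Measure E := @Measure.map Ω E (rawSigma proc.X) _ (proc.X t) (rawLaw proc μ) with hν
  have ν_apply : ∀ {B : Set E}, MeasurableSet B → ν B = ∫⁻ y, proc.P y (proc.X t ⁻¹' B) ∂μ := by
    intro B hB
    rw [hν, @Measure.map_apply Ω E (rawSigma proc.X) _ _ _ (measurable_rawSigma proc t) _ hB,
      rawLaw_apply proc μ (measurable_rawSigma proc t hB)]
  have : IsProbabilityMeasure ν := ⟨by rw [ν_apply MeasurableSet.univ]; simp⟩
  obtain ⟨g, hg, heq⟩ := hφ ν this
  set N := toMeasurable ν {y | ¬ φ y = g y}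
  have hN : MeasurableSet N := measurableSet_toMeasurable _ _
  refine ⟨proc.X t ⁻¹' (g ⁻¹' U), proc.X t ⁻¹' N, measurable_rawSigmaUpTo proc t (hg hU),
    measurable_rawSigma proc t hN, ?_, ?_⟩
  · rw [← ν_apply hN, measure_toMeasurable]
    exact ae_iff.1 heq
  · intro ω hω
    refine subset_toMeasurable ν _ fun h => ?_
    have h' : φ (proc.X t ω) = g (proc.X t ω) := h
    rcases hω with ⟨h1, h2⟩ | ⟨h1, h2⟩
    · exact h2 (by rw [mem_preimage, mem_preimage, ← h']; exact h1)
    · exact h2 (by rw [mem_preimage, h']; exact h1)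

lemma markov_set (x : E) (t : ℝ≥0) {Γ A : Set Ω} (hΓ : MeasurableSet[proc.ℱ t] Γ)
    (hA : MeasurableSet[rawSigma proc.X] A) :
    proc.P x (Γ ∩ proc.θ t ⁻¹' A) = ∫⁻ ω in Γ, proc.P (proc.X t ω) A ∂(proc.P x) := by
  have hτ : IsStoppingTime proc.ℱ fun _ => (t : WithTop ℝ≥0) := isStoppingTime_const _ t
  have h := proc.strong_markov x (fun _ => (t : WithTop ℝ≥0)) hτ Γ
    (by rwa [IsStoppingTime.measurableSpace_const]) A hA
  have hset : Γ ∩ proc.θ t ⁻¹' A = {ω | ω ∈ Γ ∧ proc.θ t ω ∈ A} := rfl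
  have htop : (t : WithTop ℝ≥0) ≠ ⊤ := WithTop.coe_ne_top
  simp only [htop, ne_eq, not_false_eq_true, and_true, true_and, WithTop.untopD_coe,
    Set.ofPred_mem_eq] at h
  rw [hset]
  exact h

/-- The Markov property at a fixed time for nonnegative functions measurable with respect to the
completed σ-algebra. -/
theorem exists_markov_version (x : E) (t : ℝ≥0) {f : Ω → ℝ≥0∞} (hf : Measurable f) :
    ∃ F : E → ℝ≥0∞, Measurable F ∧
      (∀ᵐ ω ∂(proc.P x), ∫⁻ ω', f ω' ∂(proc.P (proc.X t ω)) = F (proc.X t ω)) ∧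
      AEMeasurable (fun ω => f (proc.θ t ω)) (proc.P x) ∧
      ∀ g : Ω → ℝ≥0∞, Measurable[proc.ℱ t] g →
        ∫⁻ ω, g ω * f (proc.θ t ω) ∂(proc.P x) = ∫⁻ ω, g ω * F (proc.X t ω) ∂(proc.P x) := by
  have hX := measurable_process proc t
  set ν : Measure E := (proc.P x).map (proc.X t) with hν
  have : IsProbabilityMeasure ν := Measure.isProbabilityMeasure_map hX.aemeasurable
  -- The raw version is taken relative to the law of `X_t` under `P_x`. By the Markov property for
  -- sets, `N` is then null for `P_{X_t}` almost surely, and `θ_t⁻¹ N` is null for `P_x`.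
  obtain ⟨f₀, N, hf₀, hN, hN0, heq⟩ := exists_raw_version proc ν hf
  set F : E → ℝ≥0∞ := fun y => @lintegral Ω (rawSigma proc.X) (rawProb proc y) f₀ with hF
  have hFm : Measurable F :=
    (@Measure.measurable_lintegral Ω (rawSigma proc.X) f₀ hf₀).comp (measurable_rawProb proc)
  have hθ : Measurable[mΩ, rawSigma proc.X] (proc.θ t) :=
    (measurable_shift proc t).mono (rawSigma_le proc) le_rfl
  have hNt : proc.P x (proc.θ t ⁻¹' N) = 0 := by
    have h := markov_set proc x t (Γ := univ) MeasurableSet.univ hN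
    rw [univ_inter, Measure.restrict_univ] at h
    rw [h, ← hN0, hν, lintegral_map (proc.measurable_prob N hN) hX]
  have hfθ : ∀ᵐ ω ∂(proc.P x), f (proc.θ t ω) = f₀ (proc.θ t ω) := by
    filter_upwards [measure_eq_zero_iff_ae_notMem.1 hNt] with ω hω using heq _ hω
  have hf₀θ : Measurable fun ω => f₀ (proc.θ t ω) := hf₀.comp hθ
  have hae : AEMeasurable (fun ω => f (proc.θ t ω)) (proc.P x) := ⟨_, hf₀θ, hfθ⟩
  have hFX : ∀ᵐ ω ∂(proc.P x), ∫⁻ ω', f ω' ∂(proc.P (proc.X t ω)) = F (proc.X t ω) := by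
    have h1 : ∀ᵐ y ∂ν, proc.P y N = 0 :=
      (lintegral_eq_zero_iff (proc.measurable_prob N hN)).1 hN0
    filter_upwards [ae_of_ae_map hX.aemeasurable h1] with ω hω
    have h2 : ∀ᵐ ω' ∂(proc.P (proc.X t ω)), f ω' = f₀ ω' := by
      filter_upwards [measure_eq_zero_iff_ae_notMem.1 hω] with ω' h using heq _ h
    rw [lintegral_congr_ae h2, hF]
    exact (lintegral_trim (rawSigma_le proc) hf₀).symm
  have hset : ∀ Γ, MeasurableSet[proc.ℱ t] Γ →
      ∫⁻ ω in Γ, f₀ (proc.θ t ω) ∂(proc.P x) = ∫⁻ ω in Γ, F (proc.X t ω) ∂(proc.P x) := by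
    intro Γ hΓ
    -- On raw events, the image of `P_x` restricted to `Γ` under the shift is the law of the process
    -- started from the law of `X_t` on `Γ`. As an equality of measures it applies to all raw
    -- functions at once.
    have h1 : @Measure.map Ω Ω _ (rawSigma proc.X) (proc.θ t) ((proc.P x).restrict Γ) =
        rawLaw proc (((proc.P x).restrict Γ).map (proc.X t)) := by
      refine @Measure.ext Ω (rawSigma proc.X) _ _ fun A hA => ?_
      rw [rawLaw_apply proc _ hA, lintegral_map (proc.measurable_prob A hA) hX,
        ← markov_set proc x t hΓ hA, @Measure.map_apply Ω Ω _ (rawSigma proc.X) _ _ hθ _ hA,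
        Measure.restrict_apply (hθ hA), inter_comm]
    rw [← @lintegral_map Ω Ω _ (rawSigma proc.X) _ _ _ hf₀ hθ, h1, rawLaw,
      @Measure.lintegral_bind E Ω _ (rawSigma proc.X) _ _ _
        (@Measurable.aemeasurable _ _ _ (_) _ _ (measurable_rawProb proc))
        (@Measurable.aemeasurable _ _ (rawSigma proc.X) _ _ _ hf₀), lintegral_map hFm hX]
  refine ⟨F, hFm, hFX, hae, fun g hg => ?_⟩
  have hle := proc.ℱ.le t
  have hFXm : Measurable fun ω => F (proc.X t ω) := hFm.comp hX
  have hg' : Measurable g := hg.mono hle le_rfl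
  -- Two densities with the same integrals over the sets of `ℱ_t` define the same measure on `ℱ_t`,
  -- hence the same integral of `g`.
  have hmeas : ((proc.P x).withDensity fun ω => f₀ (proc.θ t ω)).trim hle =
      ((proc.P x).withDensity fun ω => F (proc.X t ω)).trim hle := by
    refine @Measure.ext Ω (proc.ℱ t) _ _ fun Γ hΓ => ?_
    rw [trim_measurableSet_eq hle hΓ, trim_measurableSet_eq hle hΓ,
      withDensity_apply _ (hle _ hΓ), withDensity_apply _ (hle _ hΓ), hset Γ hΓ]
  have h1 : ∫⁻ ω, g ω * f (proc.θ t ω) ∂(proc.P x) =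
      ∫⁻ ω, g ω ∂((proc.P x).withDensity fun ω => f₀ (proc.θ t ω)) := by
    rw [lintegral_withDensity_eq_lintegral_mul _ hf₀θ hg']
    refine lintegral_congr_ae ?_
    filter_upwards [hfθ] with ω hω
    rw [hω, Pi.mul_apply, mul_comm]
  have h2 : ∫⁻ ω, g ω * F (proc.X t ω) ∂(proc.P x) =
      ∫⁻ ω, g ω ∂((proc.P x).withDensity fun ω => F (proc.X t ω)) := by
    rw [lintegral_withDensity_eq_lintegral_mul _ hFXm hg']
    exact lintegral_congr fun ω => mul_comm _ _
  rw [h1, h2, ← lintegral_trim hle hg, ← lintegral_trim hle hg, hmeas]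

end Markov

/-! ### Conditional pricing and the eigen-martingale. -/

section Pricing

variable {E Ω : Type*} [MetricSpace E] [MeasurableSpace E] [mΩ : MeasurableSpace Ω]
  {proc : BorelRightProcess E Ω} {S : ℝ≥0 → Ω → ℝ}

/-- The Markov property of the pricing kernel:
`E_x[S_{t+τ} φ(X_{t+τ}) | ℱ_t] = S_t 𝒫_τ φ(X_t)`. -/
theorem condExp_pricing (hS : IsMarkovianPricingKernel proc S) {φ : E → ℝ}
    (hφ : IsUniversallyMeasurable φ) (hφ0 : ∀ y, 0 ≤ φ y)
    (hint : ∀ t y, Integrable (fun ω => S t ω * φ (proc.X t ω)) (proc.P y)) (x : E) (t τ : ℝ≥0) :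
    (proc.P x)[fun ω => S (t + τ) ω * φ (proc.X (t + τ) ω) | proc.ℱ t] =ᵐ[proc.P x]
      fun ω => S t ω * pricingOp proc S τ φ (proc.X t ω) := by
  have hSm : ∀ t, Measurable[proc.ℱ t] (S t) := (hS.semimartingale x).adapted
  have hSm' : ∀ t, Measurable (S t) := fun t => (hSm t).mono (proc.ℱ.le t) le_rfl
  have hφm : ∀ t, Measurable fun ω => φ (proc.X t ω) := fun t =>
    (measurable_comp_of_universally proc hφ t).mono (proc.ℱ.le t) le_rfl
  have hf : Measurable fun ω => ENNReal.ofReal (S τ ω * φ (proc.X τ ω)) :=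
    ((hSm' τ).mul (hφm τ)).ennreal_ofReal
  have nonneg : ∀ t y, 0 ≤ᵐ[proc.P y] fun ω => S t ω * φ (proc.X t ω) := fun t y =>
    (hS.pos y).mono fun ω hω => mul_nonneg (hω t).le (hφ0 _)
  have price_nonneg : ∀ y, 0 ≤ pricingOp proc S τ φ y := fun y => integral_nonneg_of_ae (nonneg τ y)
  obtain ⟨F, hF, hFX, hfm, hmark⟩ := exists_markov_version proc x t hf
  have hFX' : ∀ᵐ ω ∂(proc.P x), F (proc.X t ω) =
      ENNReal.ofReal (pricingOp proc S τ φ (proc.X t ω)) := by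
    filter_upwards [hFX] with ω hω
    rw [← hω, pricingOp, ofReal_integral_eq_lintegral_ofReal (hint τ _) (nonneg τ _)]
  have hsplit : ∀ᵐ ω ∂(proc.P x), ENNReal.ofReal (S (t + τ) ω * φ (proc.X (t + τ) ω)) =
      ENNReal.ofReal (S t ω) * ENNReal.ofReal (S τ (proc.θ t ω) * φ (proc.X τ (proc.θ t ω))) := by
    filter_upwards [hS.multiplicative x t τ, hS.pos x] with ω h1 h2
    rw [← ENNReal.ofReal_mul (h2 t).le, proc.shift, h1, mul_assoc]
  have hset : ∀ Γ, MeasurableSet[proc.ℱ t] Γ →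
      ∫⁻ ω in Γ, ENNReal.ofReal (S (t + τ) ω * φ (proc.X (t + τ) ω)) ∂(proc.P x) =
      ∫⁻ ω in Γ, ENNReal.ofReal (S t ω * pricingOp proc S τ φ (proc.X t ω)) ∂(proc.P x) := by
    intro Γ hΓ
    -- The `ℱ_t`-measurable factor in the Markov property is `1_Γ S_t`.
    have h := hmark (Γ.indicator fun ω => ENNReal.ofReal (S t ω))
      ((hSm t).ennreal_ofReal.indicator hΓ)
    have hΓ' := proc.ℱ.le t _ hΓ
    rw [← lintegral_indicator hΓ', ← lintegral_indicator hΓ']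
    refine Eq.trans (lintegral_congr_ae ?_) (h.trans (lintegral_congr_ae ?_))
    · filter_upwards [hsplit] with ω hω
      by_cases hm : ω ∈ Γ
      · rw [indicator_of_mem hm, indicator_of_mem hm, hω]
      · rw [indicator_of_notMem hm, indicator_of_notMem hm, zero_mul]
    · filter_upwards [hFX', hS.pos x] with ω hω h2
      by_cases hm : ω ∈ Γ
      · rw [indicator_of_mem hm, indicator_of_mem hm, hω, ENNReal.ofReal_mul (h2 t).le]
      · rw [indicator_of_notMem hm, indicator_of_notMem hm, zero_mul]
  have hnn : 0 ≤ᵐ[proc.P x] fun ω => S t ω * pricingOp proc S τ φ (proc.X t ω) :=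
    (hS.pos x).mono fun ω hω => mul_nonneg (hω t).le (price_nonneg _)
  -- `pricingOp` of `φ` need not be Borel, since `S_τ` is measurable only for the completion.
  -- Composed with `X_t` it agrees a.s. with the Borel function `F`.
  have hsm : AEStronglyMeasurable[proc.ℱ t]
      (fun ω => S t ω * pricingOp proc S τ φ (proc.X t ω)) (proc.P x) := by
    refine ⟨fun ω => S t ω * (F (proc.X t ω)).toReal, ?_, ?_⟩
    · exact ((hSm t).mul (hF.comp (measurable_filtration proc t)).ennreal_toReal).stronglyMeasurable
    · filter_upwards [hFX'] with ω hω
      rw [hω, ENNReal.toReal_ofReal (price_nonneg _)]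
  have hi := hint (t + τ) x
  have hgi : Integrable (fun ω => S t ω * pricingOp proc S τ φ (proc.X t ω)) (proc.P x) := by
    refine ⟨hsm.mono (proc.ℱ.le t), ?_⟩
    rw [hasFiniteIntegral_iff_ofReal hnn]
    have h := hset univ MeasurableSet.univ
    rw [Measure.restrict_univ] at h
    rw [← h]
    exact (hasFiniteIntegral_iff_ofReal (nonneg _ x)).1 hi.2
  refine (ae_eq_condExp_of_forall_setIntegral_eq (proc.ℱ.le t) hi (fun _ _ _ => hgi.integrableOn)
    (fun Γ hΓ _ => ?_) hsm).symm
  rw [integral_eq_lintegral_of_nonneg_ae (ae_restrict_of_ae hnn) hgi.1.restrict,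
    integral_eq_lintegral_of_nonneg_ae (ae_restrict_of_ae (nonneg _ x)) hi.1.restrict, hset Γ hΓ]

lemma integrable_pricingKernel (hS : IsMarkovianPricingKernel proc S) (t : ℝ≥0) (y : E) :
    Integrable (S t) (proc.P y) := by
  rcases (zero_le (a := t)).eq_or_lt with rfl | ht
  · exact (integrable_const (1 : ℝ)).congr ((hS.init y).mono fun ω h => h.symm)
  · exact hS.integrable y t ht

lemma condExp_pricingKernel (hS : IsMarkovianPricingKernel proc S) (x : E) {t T : ℝ≥0}
    (htT : t ≤ T) : (proc.P x)[S T | proc.ℱ t] =ᵐ[proc.P x]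
      fun ω => S t ω * pricingOp proc S (T - t) (fun _ => 1) (proc.X t ω) := by
  have h := condExp_pricing hS (φ := fun _ => 1) (fun _ _ => measurable_const.aemeasurable) (fun _ => zero_le_one)
    (fun t y => by simpa using integrable_pricingKernel hS t y) x t (T - t)
  simpa only [mul_one, add_tsub_cancel_of_le htT] using h

variable {lam : ℝ} {π : E → ℝ}

/-- If the variable were not integrable its Bochner integral would be 0, against the positive value
in the eigenvalue equation. That equation is given only for `t > 0`, so time 0 is treated directly.
-/
lemma integrable_eigen (hS : IsMarkovianPricingKernel proc S)
    (hπ : IsPositiveEigenfunction proc S lam π) (t : ℝ≥0) (y : E) :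
    Integrable (fun ω => S t ω * π (proc.X t ω)) (proc.P y) := by
  rcases (zero_le (a := t)).eq_or_lt with rfl | ht
  · refine (integrable_const (π y)).congr ?_
    filter_upwards [hS.init y, proc.start y] with ω h1 h2
    rw [h1, h2, one_mul]
  · by_contra hcon
    have h := hπ.eigen t ht y
    rw [pricingOp, integral_undef hcon] at h
    exact (mul_pos (Real.exp_pos _) (hπ.pos y)).ne h

lemma pricingOp_eigen (hS : IsMarkovianPricingKernel proc S)
    (hπ : IsPositiveEigenfunction proc S lam π) (t : ℝ≥0) (y : E) :
    pricingOp proc S t π y = Real.exp (-lam * t) * π y := by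
  rcases (zero_le (a := t)).eq_or_lt with rfl | ht
  · have h : (fun ω => S 0 ω * π (proc.X 0 ω)) =ᵐ[proc.P y] fun _ => π y := by
      filter_upwards [hS.init y, proc.start y] with ω h1 h2
      rw [h1, h2, one_mul]
    rw [pricingOp, integral_congr_ae h]
    simp
  · exact hπ.eigen t ht y

lemma measurable_eigenMartingale (hS : IsMarkovianPricingKernel proc S)
    (hπ : IsPositiveEigenfunction proc S lam π) (x : E) (t : ℝ≥0) :
    Measurable[proc.ℱ t] (eigenMartingale proc S lam π t) :=
  (((hS.semimartingale x).adapted t).mul_const _).mul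
    ((measurable_comp_of_universally proc hπ.measurable t).div
      ((measurable_comp_of_universally proc hπ.measurable 0).mono (proc.ℱ.mono zero_le) le_rfl))

lemma eigenMartingale_ae_eq (x : E) :
    ∀ᵐ ω ∂(proc.P x), ∀ t : ℝ≥0, eigenMartingale proc S lam π t ω =
      (Real.exp (lam * t) / π x) * (S t ω * π (proc.X t ω)) := by
  filter_upwards [proc.start x] with ω hω t
  rw [eigenMartingale, hω]
  ring

lemma eigenMartingale_pos (hS : IsMarkovianPricingKernel proc S)
    (hπ : IsPositiveEigenfunction proc S lam π) (x : E) :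
    ∀ᵐ ω ∂(proc.P x), ∀ t, 0 < eigenMartingale proc S lam π t ω := by
  filter_upwards [hS.pos x] with ω hω t
  exact mul_pos (mul_pos (hω t) (Real.exp_pos _)) (div_pos (hπ.pos _) (hπ.pos _))

lemma martingale_eigenMartingale (hS : IsMarkovianPricingKernel proc S)
    (hπ : IsPositiveEigenfunction proc S lam π) (x : E) :
    Martingale (eigenMartingale proc S lam π) proc.ℱ (proc.P x) := by
  refine ⟨fun t => (measurable_eigenMartingale hS hπ x t).stronglyMeasurable, fun s t hst => ?_⟩
  have h1 := condExp_pricing hS hπ.measurable (fun y => (hπ.pos y).le) (integrable_eigen hS hπ)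
    x s (t - s)
  rw [add_tsub_cancel_of_le hst] at h1
  have h2 : eigenMartingale proc S lam π t =ᵐ[proc.P x]
      (Real.exp (lam * t) / π x) • fun ω => S t ω * π (proc.X t ω) :=
    (eigenMartingale_ae_eq x).mono fun ω h => h t
  refine (condExp_congr_ae h2).trans ((condExp_smul _ _ _).trans ?_)
  filter_upwards [h1, eigenMartingale_ae_eq (S := S) (lam := lam) (π := π) x] with ω h1 h3
  rw [Pi.smul_apply, h1, h3 s, pricingOp_eigen hS hπ, smul_eq_mul, NNReal.coe_sub hst]
  have h4 : Real.exp (lam * s) = Real.exp (lam * t) * Real.exp (-lam * (t - s)) := by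
    rw [← Real.exp_add]
    congr 1
    ring
  rw [h4]
  ring

lemma integral_eigenMartingale (hS : IsMarkovianPricingKernel proc S)
    (hπ : IsPositiveEigenfunction proc S lam π) (x : E) (t : ℝ≥0) :
    ∫ ω, eigenMartingale proc S lam π t ω ∂(proc.P x) = 1 := by
  rw [integral_congr_ae ((eigenMartingale_ae_eq x).mono fun ω h => h t), integral_const_mul]
  have h := pricingOp_eigen hS hπ t x
  rw [pricingOp] at h
  have h2 : Real.exp (lam * t) * Real.exp (-lam * t) = 1 := by
    rw [← Real.exp_add]; simp
  rw [h, div_mul_eq_mul_div, ← mul_assoc, h2, one_mul, div_self (hπ.pos x).ne']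

end Pricing

end

end LongTermRisk

namespace LongTermRisk

noncomputable section

/-! ### Long-term pricing and `L¹` convergence of the forward densities. -/

section LongTermPricing

variable {E Ω : Type*} [MetricSpace E] [MeasurableSpace E] [mΩ : MeasurableSpace Ω]
  {proc : BorelRightProcess E Ω} {S : ℝ≥0 → Ω → ℝ} {lam : ℝ} {π : E → ℝ} {ς : Measure E}
  {c α : ℝ} {t₀ : ℝ≥0}

lemma integral_eigenMeasure (hS : IsMarkovianPricingKernel proc S)
    (hπ : IsPositiveEigenfunction proc S lam π) {f : E → ℝ} (hf : Measurable f) (t : ℝ≥0) (x : E) :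
    ∫ ω, f (proc.X t ω) / π (proc.X t ω) ∂(eigenMeasure proc S lam π x t) =
      Real.exp (lam * t) / π x * pricingOp proc S t f x := by
  have hm : StronglyMeasurable[proc.ℱ t] fun ω => f (proc.X t ω) / π (proc.X t ω) :=
    ((hf.comp (measurable_filtration proc t)).div
      (measurable_comp_of_universally proc hπ.measurable t)).stronglyMeasurable
  have hM : Measurable fun ω => ENNReal.ofReal (eigenMartingale proc S lam π t ω) :=
    ((measurable_eigenMartingale hS hπ x t).mono (proc.ℱ.le t) le_rfl).ennreal_ofReal
  rw [eigenMeasure, densityMeasure, ← integral_trim (proc.ℱ.le t) hm,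
    integral_withDensity_eq_integral_toReal_smul hM (ae_of_all _ fun _ => ENNReal.ofReal_lt_top),
    pricingOp, ← integral_const_mul]
  refine integral_congr_ae ?_
  filter_upwards [eigenMartingale_pos hS hπ x,
    eigenMartingale_ae_eq (S := S) (lam := lam) (π := π) x] with ω h1 h2
  rw [ENNReal.toReal_ofReal (h1 t).le, h2 t, smul_eq_mul]
  have := (hπ.pos (proc.X t ω)).ne'
  field_simp

/-- Multiplication by `π(x)` removes the factor `1 / π(x)` from the error. The bound is then uniform
in `x`, so that `X_t` may be substituted for `x`. -/
lemma pricingOp_estimate (hS : IsMarkovianPricingKernel proc S)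
    (hπ : IsPositiveEigenfunction proc S lam π)
    (herg : IsExponentiallyErgodic proc S lam π ς c α t₀) {f : E → ℝ} (hf : Measurable f)
    (hf1 : ∀ y, |f y| ≤ 1) {t : ℝ≥0} (ht : t₀ ≤ t) (x : E) :
    |Real.exp (lam * t) * pricingOp proc S t f x - (∫ y, f y / π y ∂ς) * π x| ≤
      c * Real.exp (-α * t) := by
  have h := herg.estimate f hf hf1 t ht x
  rw [integral_eigenMeasure hS hπ hf] at h
  have hx := hπ.pos x
  have h2 : Real.exp (lam * t) * pricingOp proc S t f x - (∫ y, f y / π y ∂ς) * π x =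
      (Real.exp (lam * t) / π x * pricingOp proc S t f x - ∫ y, f y / π y ∂ς) * π x := by
    field_simp
  rw [h2, abs_mul, abs_of_pos hx]
  exact (le_div_iff₀ hx).1 h

theorem pricingOp_exponential_estimate (hS : IsMarkovianPricingKernel proc S)
    (hπ : IsPositiveEigenfunction proc S lam π)
    (herg : IsExponentiallyErgodic proc S lam π ς c α t₀) {f : E → ℝ} (hf : Measurable f)
    (hfb : ∃ C, ∀ y, |f y| ≤ C) {t : ℝ≥0} (ht : t₀ ≤ t) (x : E) :
    |pricingOp proc S t f x - (∫ y, f y / π y ∂ς) * Real.exp (-lam * t) * π x| ≤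
      c * (⨆ y, |f y|) * Real.exp (-(lam + α) * t) := by
  obtain ⟨C₀, hC₀⟩ := hfb
  set C := ⨆ y, |f y| with hC
  have hfC : ∀ y, |f y| ≤ C := le_ciSup ⟨C₀, by rintro _ ⟨y, rfl⟩; exact hC₀ y⟩
  have hC0 : 0 ≤ C := (abs_nonneg _).trans (hfC x)
  rcases hC0.eq_or_lt with h0 | hpos
  · have hf0 : ∀ y, f y = 0 := fun y => abs_nonpos_iff.1 (h0 ▸ hfC y)
    simp [pricingOp, hf0, ← h0]
  · have h := pricingOp_estimate hS hπ herg (f := fun y => f y / C) (hf.div_const C)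
      (fun y => by rw [abs_div, abs_of_pos hpos]; exact (div_le_one hpos).2 (hfC y)) ht x
    have e1 : pricingOp proc S t (fun y => f y / C) x = pricingOp proc S t f x / C := by
      simp only [pricingOp, ← mul_div_assoc]
      rw [integral_div]
    have e2 : ∫ y, f y / C / π y ∂ς = (∫ y, f y / π y ∂ς) / C := by
      simp only [div_right_comm _ C]
      rw [integral_div]
    have e3 : Real.exp (-lam * t) * Real.exp (lam * t) = 1 := by rw [← Real.exp_add]; simp
    have e4 : Real.exp (-(lam + α) * t) = Real.exp (-lam * t) * Real.exp (-α * t) := by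
      rw [← Real.exp_add]; congr 1; ring
    rw [e1, e2] at h
    have e5 : pricingOp proc S t f x - (∫ y, f y / π y ∂ς) * Real.exp (-lam * t) * π x =
        C * Real.exp (-lam * t) * (Real.exp (lam * t) * (pricingOp proc S t f x / C) -
          (∫ y, f y / π y ∂ς) / C * π x) := by
      have : C * Real.exp (-lam * t) * (Real.exp (lam * t) * (pricingOp proc S t f x / C) -
          (∫ y, f y / π y ∂ς) / C * π x) = (Real.exp (-lam * t) * Real.exp (lam * t)) *
          pricingOp proc S t f x - (∫ y, f y / π y ∂ς) * Real.exp (-lam * t) * π x := by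
        field_simp
      rw [this, e3, one_mul]
    have hp : 0 < C * Real.exp (-lam * t) := by positivity
    rw [e5, abs_mul, abs_of_pos hp, e4]
    exact (mul_le_mul_of_nonneg_left h hp.le).trans (le_of_eq (by ring))

/-- The density `E_x[S_T | ℱ_t] / E_x[S_T]` of the forward measure. -/
def forwardDensity (proc : BorelRightProcess E Ω) (S : ℝ≥0 → Ω → ℝ) (x : E) (T t : ℝ≥0)
    (ω : Ω) : ℝ :=
  ((proc.P x)[S T | proc.ℱ t]) ω / ∫ ω', S T ω' ∂(proc.P x)

lemma martingale_forwardDensity (x : E) (T : ℝ≥0) :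
    Martingale (forwardDensity proc S x T) proc.ℱ (proc.P x) := by
  have h := (martingale_condExp (S T) proc.ℱ (proc.P x)).smul (∫ ω', S T ω' ∂(proc.P x))⁻¹
  have e : forwardDensity proc S x T =
      (∫ ω', S T ω' ∂(proc.P x))⁻¹ • fun t => (proc.P x)[S T | proc.ℱ t] := by
    funext t ω
    simp only [forwardDensity, Pi.smul_apply, smul_eq_mul, div_eq_inv_mul]
  rw [e]
  exact h

lemma integral_kernel_pos (hS : IsMarkovianPricingKernel proc S) (x : E) (T : ℝ≥0) :
    0 < ∫ ω, S T ω ∂(proc.P x) := by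
  refine (integral_pos_iff_support_of_nonneg_ae ((hS.pos x).mono fun ω h => (h T).le)
    (integrable_pricingKernel hS T x)).2 ?_
  have h : Function.support (S T) =ᵐ[proc.P x] (univ : Set Ω) := by
    filter_upwards [hS.pos x] with ω hω
    exact eq_true (hω T).ne'
  rw [measure_congr h]
  simp

lemma pricingOp_one (x : E) (T : ℝ≥0) :
    pricingOp proc S T (fun _ => 1) x = ∫ ω, S T ω ∂(proc.P x) := by
  simp [pricingOp]

/-- The condition `ε ≤ κq/2` keeps `b` above `κq/2`. The bound is affine in `p`, hence integrable
against `S_t` for `p = π(X_t)`. -/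
lemma abs_ratio_sub_le {a b κ p q ε : ℝ} (hκ : 0 < κ) (hp : 0 < p) (hq : 0 < q)
    (ha : |a - κ * p| ≤ ε) (hb : |b - κ * q| ≤ ε) (hε : ε ≤ κ * q / 2) :
    |a / b - p / q| ≤ ε * ((p + q) * (2 / (κ * q ^ 2))) := by
  have hb' : κ * q / 2 ≤ b := by linarith [(abs_le.1 hb).1]
  have hκq : 0 < κ * q := mul_pos hκ hq
  have hb0 : 0 < b := by linarith
  have hε0 : 0 ≤ ε := (abs_nonneg _).trans ha
  have e : a / b - p / q = ((a - κ * p) * q - p * (b - κ * q)) / (b * q) := by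
    field_simp
    ring
  have hnum : |(a - κ * p) * q - p * (b - κ * q)| ≤ ε * (p + q) := by
    refine (abs_sub _ _).trans ?_
    rw [abs_mul, abs_mul, abs_of_pos hp, abs_of_pos hq]
    nlinarith
  have hden : κ * q ^ 2 / 2 ≤ b * q := by nlinarith
  rw [e, abs_div, abs_of_pos (mul_pos hb0 hq)]
  calc |(a - κ * p) * q - p * (b - κ * q)| / (b * q)
      ≤ ε * (p + q) / (κ * q ^ 2 / 2) := by
        gcongr
    _ = ε * ((p + q) * (2 / (κ * q ^ 2))) := by
        field_simp

theorem tendsto_integral_abs_forwardDensity_sub (hS : IsMarkovianPricingKernel proc S)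
    (hπ : IsPositiveEigenfunction proc S lam π)
    (herg : IsExponentiallyErgodic proc S lam π ς c α t₀) (x : E) (t : ℝ≥0) :
    Tendsto (fun T => ∫ ω, |forwardDensity proc S x T t ω - eigenMartingale proc S lam π t ω|
      ∂(proc.P x)) atTop (𝓝 0) := by
  have := herg.prob
  set κ := ∫ y, 1 / π y ∂ς with hκd
  have hκ : 0 < κ := by
    refine (integral_pos_iff_support_of_nonneg (fun y => (one_div_pos.2 (hπ.pos y)).le)
      herg.integrable).2 ?_
    have : Function.support (fun y => 1 / π y) = univ :=
      eq_univ_of_forall fun y => (one_div_pos.2 (hπ.pos y)).ne'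
    rw [this]
    simp
  -- `S_t e^{λt}` times the factor of `ε` in `abs_ratio_sub_le`, with `p = π(X_t)` and `q = π(x)`.
  set W : Ω → ℝ := fun ω => Real.exp (lam * t) * (2 / (κ * π x ^ 2)) *
    (S t ω * π (proc.X t ω) + π x * S t ω) with hW
  have hWi : Integrable W (proc.P x) :=
    ((integrable_eigen hS hπ t x).add ((integrable_pricingKernel hS t x).const_mul _)).const_mul _
  -- The ergodic error at the remaining horizon `T - t`, which dominates the error at horizon `T` in
  -- the denominator.
  set ε : ℝ≥0 → ℝ := fun T => c * Real.exp (-α * (T - t)) with hε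
  have hεlim : Tendsto ε atTop (𝓝 0) := by
    have h1 : Tendsto (fun T : ℝ≥0 => α * ((T : ℝ) - t)) atTop atTop :=
      (tendsto_atTop_add_const_right _ (-(t : ℝ))
        (NNReal.tendsto_coe_atTop.2 tendsto_id)).const_mul_atTop herg.α_pos
    have h2 := (Real.tendsto_exp_neg_atTop_nhds_zero.comp h1).const_mul c
    rw [mul_zero] at h2
    refine h2.congr fun T => ?_
    simp only [hε, Function.comp, neg_mul]
  have hκx : 0 < κ * π x / 2 := half_pos (mul_pos hκ (hπ.pos x))
  have bound : ∀ᶠ T in atTop, ∀ᵐ ω ∂(proc.P x),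
      |forwardDensity proc S x T t ω - eigenMartingale proc S lam π t ω| ≤ ε T * W ω := by
    filter_upwards [eventually_ge_atTop (t + t₀), hεlim.eventually (ge_mem_nhds hκx)] with T hT hεT
    have htT : t ≤ T := le_self_add.trans hT
    have ht₀ : t₀ ≤ T - t := le_tsub_of_add_le_left hT
    filter_upwards [condExp_pricingKernel hS x htT, hS.pos x,
      eigenMartingale_ae_eq (S := S) (lam := lam) (π := π) x] with ω h1 h2 h3
    have ea := pricingOp_estimate hS hπ herg (f := fun _ => 1) measurable_const (by simp) ht₀
      (proc.X t ω)
    have eb := pricingOp_estimate hS hπ herg (f := fun _ => 1) measurable_const (by simp)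
      (le_add_self.trans hT) x
    rw [NNReal.coe_sub htT] at ea
    rw [pricingOp_one] at eb
    have eb' : c * Real.exp (-α * T) ≤ ε T := by
      refine mul_le_mul_of_nonneg_left (Real.exp_le_exp.2 ?_) herg.c_pos.le
      have := mul_nonneg herg.α_pos.le (NNReal.coe_nonneg t)
      linarith
    have hr := abs_ratio_sub_le hκ (hπ.pos (proc.X t ω)) (hπ.pos x) ea (eb.trans eb') hεT
    have hSe : 0 < S t ω * Real.exp (lam * t) := mul_pos (h2 t) (Real.exp_pos _)
    have hkpos := integral_kernel_pos hS x T
    have e : forwardDensity proc S x T t ω - eigenMartingale proc S lam π t ω =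
        S t ω * Real.exp (lam * t) * ((Real.exp (lam * (T - t)) *
          pricingOp proc S (T - t) (fun _ => 1) (proc.X t ω)) /
          (Real.exp (lam * T) * ∫ ω, S T ω ∂(proc.P x)) - π (proc.X t ω) / π x) := by
      have hexp : Real.exp (lam * T) = Real.exp (lam * t) * Real.exp (lam * (T - t)) := by
        rw [← Real.exp_add]; congr 1; ring
      have := (Real.exp_pos (lam * t)).ne'
      have := (Real.exp_pos (lam * (T - t))).ne'
      have := hkpos.ne'
      have := (hπ.pos x).ne'
      rw [forwardDensity, h1, h3 t, hexp]
      field_simp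
    rw [e, abs_mul, abs_of_pos hSe]
    refine (mul_le_mul_of_nonneg_left hr hSe.le).trans (le_of_eq ?_)
    simp only [hW]
    ring
  have hlim : Tendsto (fun T => ε T * ∫ ω, W ω ∂(proc.P x)) atTop (𝓝 0) := by
    simpa using hεlim.mul_const (∫ ω, W ω ∂(proc.P x))
  refine tendsto_of_tendsto_of_tendsto_of_le_of_le' tendsto_const_nhds hlim
    (Eventually.of_forall fun T => integral_nonneg fun ω => abs_nonneg _) ?_
  filter_upwards [bound] with T hT
  rw [← integral_const_mul]
  exact integral_mono_ae (((martingale_forwardDensity x T).integrable t).sub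
    ((martingale_eigenMartingale hS hπ x).integrable t)).abs (hWi.const_mul _) hT

end LongTermPricing

/-! ### Bonds, roll-over strategies and the long bond. -/

section Bonds

variable {Ω : Type*} {p : ℝ≥0 → ℝ≥0 → Ω → ℝ}

/-- Only the first period matters below: with `s` fixed and `T → ∞`, the strategy has not yet been
rolled over at time `s`. -/
lemma rollOver_of_lt {T s : ℝ≥0} (hs : s < T) (ω : Ω) :
    rollOver p T s ω = (p T 0 ω)⁻¹ * p T s ω := by
  have hT : 0 < T := (zero_le (a := s)).trans_lt hs
  have h : ⌊s / T⌋₊ = 0 := Nat.floor_eq_zero.2 ((div_lt_one hT).2 hs)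
  simp [rollOver, h]

variable {E : Type*} [MetricSpace E] [MeasurableSpace E] [mΩ : MeasurableSpace Ω]
  {proc : BorelRightProcess E Ω} {S : ℝ≥0 → Ω → ℝ} {lam : ℝ} {π : E → ℝ} {x : E}

lemma ae_rcll_inv (hS : IsMarkovianPricingKernel proc S) (x : E) :
    ∀ᵐ ω ∂(proc.P x), IsRCLL fun t => (S t ω)⁻¹ := by
  filter_upwards [(hS.semimartingale x).rcll, hS.pos x, hS.leftLim_pos x] with ω h1 h2 h3
  exact h1.inv h2 h3

theorem exists_zeroCouponBond (hS : IsMarkovianPricingKernel proc S) (x : E) (T : ℝ≥0) :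
    ∃ p, IsZeroCouponBond proc.ℱ (proc.P x) S T p := by
  obtain ⟨Y, hY, hYS, hYr⟩ := exists_rcll_modification proc.filtration_right_cont
    (martingale_condExp (S T) proc.ℱ (proc.P x))
  refine ⟨fun t ω => Y t ω * (S t ω)⁻¹, fun t _ => ?_, ?_, fun t _ => ?_⟩
  · exact (hY.1 t).measurable.mul ((hS.semimartingale x).adapted t).inv
  · filter_upwards [hYr, ae_rcll_inv hS x] with ω h1 h2
    exact (h1.mul h2).comp_min T
  · filter_upwards [hYS t] with ω hω
    rw [hω, div_eq_mul_inv]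

/-- The Markov property at time 0 together with `X_0 = x` and `S_0 = 1` makes the initial price
deterministic. -/
lemma bond_initial_price (hS : IsMarkovianPricingKernel proc S) {T : ℝ≥0} {q : ℝ≥0 → Ω → ℝ}
    (hq : IsZeroCouponBond proc.ℱ (proc.P x) S T q) :
    ∀ᵐ ω ∂(proc.P x), q 0 ω = ∫ ω', S T ω' ∂(proc.P x) := by
  filter_upwards [hq.price 0 zero_le, condExp_pricingKernel hS x (zero_le (a := T)),
    hS.init x, proc.start x] with ω h1 h2 h3 h4
  rw [h1, h2, h3, h4, tsub_zero, pricingOp_one, one_mul, div_one]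

lemma kernel_mul_rollOver (hS : IsMarkovianPricingKernel proc S) {T : ℝ≥0}
    (hp : IsZeroCouponBond proc.ℱ (proc.P x) S T (p T)) {s : ℝ≥0} (hs : s < T) :
    (fun ω => S s ω * rollOver p T s ω) =ᵐ[proc.P x] forwardDensity proc S x T s := by
  filter_upwards [hp.price s hs.le, bond_initial_price hS hp, hS.pos x] with ω h1 h2 h3
  have := (h3 s).ne'
  rw [rollOver_of_lt hs, h1, h2, forwardDensity]
  field_simp

lemma measurable_rollOver {T : ℝ≥0} (hp : IsZeroCouponBond proc.ℱ (proc.P x) S T (p T))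
    {s : ℝ≥0} (hs : s < T) : Measurable[proc.ℱ s] (rollOver p T s) := by
  have : rollOver p T s = fun ω => (p T 0 ω)⁻¹ * p T s ω := funext (rollOver_of_lt hs)
  rw [this]
  exact ((hp.adapted 0 zero_le).mono (proc.ℱ.mono zero_le) le_rfl).inv.mul (hp.adapted s hs.le)

lemma rollOver_right_continuous {T : ℝ≥0}
    (hp : IsZeroCouponBond proc.ℱ (proc.P x) S T (p T)) :
    ∀ᵐ ω ∂(proc.P x), ∀ s < T, ContinuousWithinAt (fun s => rollOver p T s ω) (Ici s) s := by
  filter_upwards [hp.rcll] with ω hω s hs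
  have h1 : ∀ᶠ r in 𝓝[≥] s, rollOver p T r ω = (p T 0 ω)⁻¹ * p T (min r T) ω := by
    filter_upwards [nhdsWithin_le_nhds (Iio_mem_nhds hs)] with r hr
    rw [rollOver_of_lt hr, min_eq_left (le_of_lt hr)]
  refine ((hω s).1.const_mul (p T 0 ω)⁻¹).congr_of_eventuallyEq h1 ?_
  rw [rollOver_of_lt hs, min_eq_left hs.le]

lemma exists_ofReal_div_le (C : ℝ) {ε : ℝ≥0∞} (hε : 0 < ε) :
    ∃ K : ℝ, 0 < K ∧ ENNReal.ofReal (C / K) ≤ ε := by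
  have h : Tendsto (fun K : ℝ => ENNReal.ofReal (C / K)) atTop (𝓝 (ENNReal.ofReal 0)) :=
    (ENNReal.continuous_ofReal.tendsto _).comp (tendsto_const_nhds.div_atTop tendsto_id)
  rw [ENNReal.ofReal_zero] at h
  obtain ⟨K, h1, h2⟩ := ((eventually_gt_atTop (0 : ℝ)).and (h.eventually (ge_mem_nhds hε))).exists
  exact ⟨K, h1, h2⟩

/-- Small values of `S` are large values of `1/S`, whose paths are RCLL because `S` and its left
limits are positive. The elementary integrals of `S` are bounded in probability since `S` is a
semimartingale, and `IsControlled.inv` applies. -/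
lemma isControlled_kernel_inv (hS : IsMarkovianPricingKernel proc S) (x : E) (N : ℕ) {ε : ℝ≥0∞}
    (hε : 0 < ε) :
    ∃ A : ℝ, 0 < A ∧ IsControlled proc.ℱ (proc.P x) (fun s ω => (S s ω)⁻¹) N A ε := by
  have hSm : ∀ t, Measurable (S t) := fun t =>
    ((hS.semimartingale x).adapted t).mono (proc.ℱ.le t) le_rfl
  have hε4 : 0 < ε / 4 := ENNReal.div_pos hε.ne' (by norm_num)
  obtain ⟨K₁, hK₁⟩ := exists_measure_sup_le hSm (hS.semimartingale x).rcll N hε4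
  obtain ⟨K₂, hK₂⟩ := exists_measure_sup_le (fun t => (hSm t).inv) (ae_rcll_inv hS x) N hε4
  obtain ⟨K₃, hK₃⟩ := (hS.semimartingale x).bounded_in_prob N (ε / 4) hε4
  set A : ℝ := max (max K₁ K₂) (max K₃ 1) with hA
  have hA0 : 0 < A := one_pos.trans_le ((le_max_right _ _).trans (le_max_right _ _))
  have hc : IsControlled proc.ℱ (proc.P x) S N A (ε / 4) := by
    refine ⟨hK₁ A ((le_max_left _ _).trans (le_max_left _ _)), fun η => le_trans
      (measure_mono ?_) (hK₃ η)⟩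
    intro ω (hω : A < _)
    exact ((le_max_left _ _).trans (le_max_right _ _)).trans_lt hω
  have hlow : proc.P x {ω | ∃ s ≤ (N : ℝ≥0), S s ω < A⁻¹} ≤ ε / 4 := by
    refine le_trans (measure_mono_ae ?_) (hK₂ A ((le_max_right _ _).trans (le_max_left _ _)))
    filter_upwards [hS.pos x] with ω hω ⟨s, hs, hlt⟩
    refine ⟨s, hs, ?_⟩
    rw [Pi.inv_apply, abs_of_pos (inv_pos.2 (hω s))]
    exact lt_inv_of_lt_inv₀ (hω s) hlt
  have h := hc.inv (fun s _ => (hS.semimartingale x).adapted s) hA0 hlow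
  refine ⟨_, by positivity, h.mono le_rfl (le_of_eq ?_)⟩
  exact ENNReal.mul_div_cancel (by norm_num) (by norm_num)

variable {M : ℝ≥0 → Ω → ℝ}

lemma isControlled_martingale (hM : Martingale M proc.ℱ (proc.P x))
    (hMr : ∀ᵐ ω ∂(proc.P x), IsRCLL fun t => M t ω) (N : ℕ) {ε : ℝ≥0∞} (hε : 0 < ε) :
    ∃ A : ℝ, 0 < A ∧ IsControlled proc.ℱ (proc.P x) M N A ε := by
  obtain ⟨K, hK, h⟩ := exists_ofReal_div_le (46 * ∫ ω, |M N ω| ∂(proc.P x)) hε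
  exact ⟨K, hK, (isControlled_of_martingale hM (fun _ _ => EventuallyEq.rfl)
    (hMr.mono fun ω hω s _ => (hω s).1) hK).mono le_rfl h⟩

/-- `M / S` is a valuation process for every positive martingale `M`. -/
theorem isValuationProcess_of_martingale (hS : IsMarkovianPricingKernel proc S)
    (hM : Martingale M proc.ℱ (proc.P x))
    (hMr : ∀ᵐ ω ∂(proc.P x), IsRCLL fun t => M t ω)
    (hMp : ∀ᵐ ω ∂(proc.P x), (∀ t, 0 < M t ω) ∧ HasPosLeftLimits fun t => M t ω) :
    IsValuationProcess proc.ℱ (proc.P x) S fun t ω => M t ω * (S t ω)⁻¹ := by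
  have hSm := (hS.semimartingale x).adapted
  have ad : ∀ t, Measurable[proc.ℱ t] fun ω => M t ω * (S t ω)⁻¹ := fun t =>
    (hM.1 t).measurable.mul (hSm t).inv
  refine ⟨⟨ad, ?_, ?_⟩, ?_, ?_, ?_⟩
  · filter_upwards [hMr, ae_rcll_inv hS x] with ω h1 h2 using h1.mul h2
  · intro t ε hε
    obtain ⟨N, hN⟩ := exists_nat_ge t
    have hε6 : 0 < ε / 6 := ENNReal.div_pos hε.ne' (by norm_num)
    obtain ⟨A, hA, h1⟩ := isControlled_martingale hM hMr N hε6
    obtain ⟨B, hB, h2⟩ := isControlled_kernel_inv hS x N hε6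
    have h := (h1.mul (fun s _ => (hM.1 s).measurable) (fun s _ => (hSm s).inv) hA hB
      h2).mono_time hN
    refine ⟨_, fun η => (h.integral η).trans (le_of_eq ?_)⟩
    exact ENNReal.mul_div_cancel (by norm_num) (by norm_num)
  · filter_upwards [hMp, hS.pos x] with ω h1 h2 t using mul_pos (h1.1 t) (inv_pos.2 (h2 t))
  · filter_upwards [hMp, hS.leftLim_pos x] with ω h1 h2 using h1.2.mul h2.inv
  · refine hM.congr (fun t => ((hSm t).mul (ad t)).stronglyMeasurable) fun t => ?_
    filter_upwards [hS.pos x] with ω hω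
    have := (hω t).ne'
    field_simp

/-- If the forward densities converge in `L¹` to a martingale `M`, then the discounted roll-over
strategies are eventually close to `M`. -/
lemma eventually_isControlled_sub (hS : IsMarkovianPricingKernel proc S)
    (hM : Martingale M proc.ℱ (proc.P x)) (hMr : ∀ᵐ ω ∂(proc.P x), IsRCLL fun t => M t ω)
    (hlim : ∀ t, Tendsto (fun T => ∫ ω, |forwardDensity proc S x T t ω - M t ω| ∂(proc.P x))
      atTop (𝓝 0))
    (hp : ∀ T, 0 < T → IsZeroCouponBond proc.ℱ (proc.P x) S T (p T)) (N : ℕ) {K : ℝ} (hK : 0 < K)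
    {ε : ℝ≥0∞} (hε : 0 < ε) :
    ∀ᶠ T in atTop, IsControlled proc.ℱ (proc.P x)
      (fun t ω => S t ω * rollOver p T t ω - M t ω) N K ε := by
  have h1 : Tendsto (fun T => ENNReal.ofReal (46 * (∫ ω, |forwardDensity proc S x T N ω - M N ω|
      ∂(proc.P x)) / K)) atTop (𝓝 (ENNReal.ofReal (46 * 0 / K))) :=
    (ENNReal.continuous_ofReal.tendsto _).comp (((hlim N).const_mul 46).div_const K)
  rw [mul_zero, zero_div, ENNReal.ofReal_zero] at h1
  filter_upwards [h1.eventually (ge_mem_nhds hε), eventually_gt_atTop (N : ℝ≥0)] with T h2 hT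
  have hpT := hp T (zero_le.trans_lt hT)
  -- For `T > N` the process in question is a version of this martingale on `[0, N]`, with
  -- right-continuous paths there.
  have hZ : Martingale (fun t ω => forwardDensity proc S x T t ω - M t ω) proc.ℱ (proc.P x) :=
    (martingale_forwardDensity x T).sub hM
  refine (isControlled_of_martingale hZ (fun s hs => ?_) ?_ hK).mono le_rfl h2
  · exact (kernel_mul_rollOver hS hpT (hs.trans_lt hT)).sub EventuallyEq.rfl
  · filter_upwards [(hS.semimartingale x).rcll, rollOver_right_continuous hpT, hMr]
      with ω h3 h4 h5 s hs
    exact ((h3 s).1.mul (h4 s (hs.trans hT))).sub (h5 s).1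

/-- The difference of the bonds is `(S B^T - M) S⁻¹`, a product of an eventually small factor and a
fixed controlled one. The level `K / (6B)` for the first factor compensates the constant of
`IsControlled.mul`. -/
lemma eventually_isControlled_rollOver_sub (hS : IsMarkovianPricingKernel proc S)
    (hM : Martingale M proc.ℱ (proc.P x)) (hMr : ∀ᵐ ω ∂(proc.P x), IsRCLL fun t => M t ω)
    (hlim : ∀ t, Tendsto (fun T => ∫ ω, |forwardDensity proc S x T t ω - M t ω| ∂(proc.P x))
      atTop (𝓝 0))
    (hp : ∀ T, 0 < T → IsZeroCouponBond proc.ℱ (proc.P x) S T (p T)) (N : ℕ) {K : ℝ} (hK : 0 < K)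
    {ε : ℝ≥0∞} (hε : 0 < ε) :
    ∀ᶠ T in atTop, IsControlled proc.ℱ (proc.P x)
      (fun t ω => rollOver p T t ω - M t ω * (S t ω)⁻¹) N K ε := by
  have hSm := (hS.semimartingale x).adapted
  have hε6 : 0 < ε / 6 := ENNReal.div_pos hε.ne' (by norm_num)
  obtain ⟨B, hB, h2⟩ := isControlled_kernel_inv hS x N hε6
  have hK6 : 0 < K / (6 * B) := by positivity
  filter_upwards [eventually_isControlled_sub hS hM hMr hlim hp N hK6 hε6,
    eventually_gt_atTop (N : ℝ≥0)] with T h1 hT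
  have hpT := hp T (zero_le.trans_lt hT)
  have h := h1.mul (fun s hs => ((hSm s).mul (measurable_rollOver hpT (hs.trans_lt hT))).sub
    (hM.1 s).measurable) (fun s _ => (hSm s).inv) hK6 hB h2
  refine (h.mono (le_of_eq ?_) (le_of_eq (ENNReal.mul_div_cancel (by norm_num)
    (by norm_num)))).congr ?_
  · field_simp
  · filter_upwards [hS.pos x] with ω hω s _
    have := (hω s).ne'
    simp only [Pi.mul_apply, Pi.sub_apply, Pi.inv_apply]
    field_simp

end Bonds

/-! ### Forward measures and their limit. -/

section ForwardMeasures

variable {Ω : Type*} {mΩ : MeasurableSpace Ω} {μ : Measure Ω} {ℱ : Filtration ℝ≥0 mΩ}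
  {D : ℝ≥0 → Ω → ℝ}

lemma densityMeasure_apply (D : ℝ≥0 → Ω → ℝ) {t : ℝ≥0} {A : Set Ω} (hA : MeasurableSet[ℱ t] A) :
    densityMeasure ℱ μ D t A = ∫⁻ ω in A, ENNReal.ofReal (D t ω) ∂μ := by
  rw [densityMeasure, trim_measurableSet_eq (ℱ.le t) hA, withDensity_apply _ (ℱ.le t _ hA)]

lemma densityMeasure_eq_ofReal {t : ℝ≥0} (hi : Integrable (D t) μ) (h0 : 0 ≤ᵐ[μ] D t) {A : Set Ω}
    (hA : MeasurableSet[ℱ t] A) :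
    densityMeasure ℱ μ D t A = ENNReal.ofReal (∫ ω in A, D t ω ∂μ) := by
  rw [densityMeasure_apply D hA, ofReal_integral_eq_lintegral_ofReal hi.integrableOn
    (ae_restrict_of_ae h0)]

end ForwardMeasures

section LongForward

variable {E Ω : Type*} [MetricSpace E] [MeasurableSpace E] [mΩ : MeasurableSpace Ω]
  {proc : BorelRightProcess E Ω} {S : ℝ≥0 → Ω → ℝ} {lam : ℝ} {π : E → ℝ} {x : E}
  {p : ℝ≥0 → ℝ≥0 → Ω → ℝ}

lemma eigenMeasure_eq_ofReal (hS : IsMarkovianPricingKernel proc S)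
    (hπ : IsPositiveEigenfunction proc S lam π) (x : E) {t : ℝ≥0} {A : Set Ω}
    (hA : MeasurableSet[proc.ℱ t] A) : eigenMeasure proc S lam π x t A =
      ENNReal.ofReal (∫ ω in A, eigenMartingale proc S lam π t ω ∂(proc.P x)) :=
  densityMeasure_eq_ofReal ((martingale_eigenMartingale hS hπ x).integrable t)
    ((eigenMartingale_pos hS hπ x).mono fun _ h => (h t).le) hA

lemma forwardMeasure_eq_ofReal (hS : IsMarkovianPricingKernel proc S) {t T : ℝ≥0} (htT : t < T)
    (hp : IsZeroCouponBond proc.ℱ (proc.P x) S T (p T)) {A : Set Ω}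
    (hA : MeasurableSet[proc.ℱ t] A) : forwardMeasure proc.ℱ (proc.P x) S p T t A =
      ENNReal.ofReal (∫ ω in A, forwardDensity proc S x T t ω ∂(proc.P x)) := by
  have h := kernel_mul_rollOver hS hp htT
  have h0 : 0 ≤ᵐ[proc.P x] forwardDensity proc S x T t := by
    filter_upwards [condExp_nonneg (m := proc.ℱ t) ((hS.pos x).mono fun ω h => (h T).le :
      0 ≤ᵐ[proc.P x] S T)] with ω hω
    exact div_nonneg hω (integral_kernel_pos hS x T).le
  rw [forwardMeasure, densityMeasure_eq_ofReal
    (((martingale_forwardDensity x T).integrable t).congr h.symm)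
    (h0.trans_eq h.symm) hA]
  exact congrArg ENNReal.ofReal (integral_congr_ae (ae_restrict_of_ae h))

lemma forwardDensity_setIntegral_nonneg (hS : IsMarkovianPricingKernel proc S) (x : E) (T t : ℝ≥0)
    (A : Set Ω) : 0 ≤ ∫ ω in A, forwardDensity proc S x T t ω ∂(proc.P x) := by
  refine integral_nonneg_of_ae (ae_restrict_of_ae ?_)
  have hn : 0 ≤ᵐ[proc.P x] S T := (hS.pos x).mono fun ω h => (h T).le
  have hc : 0 ≤ᵐ[proc.P x] (proc.P x)[S T | proc.ℱ t] := condExp_nonneg hn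
  filter_upwards [hc] with ω hω
  exact div_nonneg hω (integral_kernel_pos hS x T).le

/-- The bound does not depend on `A`, so it yields total variation as well as setwise convergence.
-/
lemma abs_setIntegral_forwardDensity_sub_le (hS : IsMarkovianPricingKernel proc S)
    (hπ : IsPositiveEigenfunction proc S lam π) (x : E) (T t : ℝ≥0) (A : Set Ω) :
    |∫ ω in A, forwardDensity proc S x T t ω ∂(proc.P x) -
      ∫ ω in A, eigenMartingale proc S lam π t ω ∂(proc.P x)| ≤
      ∫ ω, |forwardDensity proc S x T t ω - eigenMartingale proc S lam π t ω| ∂(proc.P x) := by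
  have i1 : Integrable (forwardDensity proc S x T t) (proc.P x) :=
    (martingale_forwardDensity x T).integrable t
  have i2 := (martingale_eigenMartingale hS hπ x).integrable t
  rw [← integral_sub i1.integrableOn i2.integrableOn]
  exact (abs_integral_le_integral_abs).trans
    (setIntegral_le_integral (i1.sub i2).abs (ae_of_all _ fun ω => abs_nonneg _))

theorem isLongForwardMeasure_eigenMeasure (hS : IsMarkovianPricingKernel proc S)
    (hπ : IsPositiveEigenfunction proc S lam π)
    (hlim : ∀ t, Tendsto (fun T => ∫ ω, |forwardDensity proc S x T t ω -
      eigenMartingale proc S lam π t ω| ∂(proc.P x)) atTop (𝓝 0))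
    (hp : ∀ T, 0 < T → IsZeroCouponBond proc.ℱ (proc.P x) S T (p T)) :
    IsLongForwardMeasure proc.ℱ (proc.P x) S p (eigenMeasure proc S lam π x) := by
  have hM := martingale_eigenMartingale hS hπ x
  have hMpos := eigenMartingale_pos hS hπ x
  refine ⟨fun t => ⟨?_⟩, fun s t hst => ?_, fun t => ?_, fun t => ?_, fun t A hA => ?_⟩
  · rw [eigenMeasure_eq_ofReal hS hπ x (@MeasurableSet.univ _ (proc.ℱ t)), setIntegral_univ,
      integral_eigenMartingale hS hπ, ENNReal.ofReal_one]
  · refine @Measure.ext Ω (proc.ℱ s) _ _ fun A hA => ?_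
    rw [trim_measurableSet_eq (proc.ℱ.mono hst) hA, eigenMeasure_eq_ofReal hS hπ x hA,
      eigenMeasure_eq_ofReal hS hπ x (proc.ℱ.mono hst _ hA), hM.setIntegral_eq hst hA]
  · refine @Measure.AbsolutelyContinuous.mk _ (proc.ℱ t) _ _ fun A hA h => ?_
    rw [trim_measurableSet_eq (proc.ℱ.le t) hA] at h
    rw [eigenMeasure, densityMeasure_apply _ hA, Measure.restrict_eq_zero.2 h,
      lintegral_zero_measure]
  · refine @Measure.AbsolutelyContinuous.mk _ (proc.ℱ t) _ _ fun A hA h => ?_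
    rw [trim_measurableSet_eq (proc.ℱ.le t) hA]
    have hmeas : Measurable fun ω => ENNReal.ofReal (eigenMartingale proc S lam π t ω) :=
      ((hM.1 t).measurable.mono (proc.ℱ.le t) le_rfl).ennreal_ofReal
    rw [eigenMeasure, densityMeasure_apply _ hA, lintegral_eq_zero_iff hmeas] at h
    by_contra hne
    have : (ae ((proc.P x).restrict A)).NeBot := by
      rw [ae_neBot]
      exact fun h0 => hne (Measure.restrict_eq_zero.1 h0)
    obtain ⟨ω, h1, h2⟩ := (h.and (ae_restrict_of_ae hMpos)).exists
    exact (ENNReal.ofReal_pos.2 (h2 t)).ne' h1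
  · rw [eigenMeasure_eq_ofReal hS hπ x hA]
    have h1 : Tendsto (fun T => ∫ ω in A, forwardDensity proc S x T t ω ∂(proc.P x)) atTop
        (𝓝 (∫ ω in A, eigenMartingale proc S lam π t ω ∂(proc.P x))) := by
      rw [tendsto_iff_norm_sub_tendsto_zero]
      exact squeeze_zero (fun T => norm_nonneg _)
        (fun T => abs_setIntegral_forwardDensity_sub_le hS hπ x T t A) (hlim t)
    refine ((ENNReal.continuous_ofReal.tendsto _).comp h1).congr' ?_
    filter_upwards [eventually_gt_atTop t] with T hT
    exact (forwardMeasure_eq_ofReal hS hT (hp T (zero_le.trans_lt hT)) hA).symm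

theorem forwardMeasure_tendsto_totalVariation (hS : IsMarkovianPricingKernel proc S)
    (hπ : IsPositiveEigenfunction proc S lam π)
    (hlim : ∀ t, Tendsto (fun T => ∫ ω, |forwardDensity proc S x T t ω -
      eigenMartingale proc S lam π t ω| ∂(proc.P x)) atTop (𝓝 0))
    (hp : ∀ T, 0 < T → IsZeroCouponBond proc.ℱ (proc.P x) S T (p T)) (t : ℝ≥0) {ε : ℝ}
    (hε : 0 < ε) : ∀ᶠ T in atTop, ∀ A, MeasurableSet[proc.ℱ t] A →
      |(forwardMeasure proc.ℱ (proc.P x) S p T t A).toReal -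
        (eigenMeasure proc S lam π x t A).toReal| ≤ ε := by
  filter_upwards [(hlim t).eventually (ge_mem_nhds hε), eventually_gt_atTop t] with T h1 hT A hA
  rw [forwardMeasure_eq_ofReal hS hT (hp T (zero_le.trans_lt hT)) hA,
    eigenMeasure_eq_ofReal hS hπ x hA,
    ENNReal.toReal_ofReal (forwardDensity_setIntegral_nonneg hS x T t A),
    ENNReal.toReal_ofReal (integral_nonneg_of_ae (ae_restrict_of_ae
      ((eigenMartingale_pos hS hπ x).mono fun ω h => (h t).le)))]
  exact (abs_setIntegral_forwardDensity_sub_le hS hπ x T t A).trans h1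

end LongForward

end

end LongTermRisk

/-! ### Assembly of the theorem. -/

theorem theorem4p2 {E Ω : Type*} [MetricSpace E] [MeasurableSpace E] [BorelSpace E]
    [MeasurableSpace Ω] (proc : BorelRightProcess E Ω)
    (S : ℝ≥0 → Ω → ℝ) (hS : IsMarkovianPricingKernel proc S)
    (lam : ℝ) (π : E → ℝ) (hπ : IsRecurrentEigenfunction proc S lam π)
    (ς : Measure E) (c α : ℝ) (t₀ : ℝ≥0)
    (herg : IsExponentiallyErgodic proc S lam π ς c α t₀) :
    (∀ x : E,
      -- the `L¹`-convergence condition, with limit `M_t^π`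
      (∀ t : ℝ≥0, 0 < t →
        Measurable[proc.ℱ t] (eigenMartingale proc S lam π t) ∧
        (∀ᵐ ω ∂(proc.P x), 0 < eigenMartingale proc S lam π t ω) ∧
        Tendsto (fun T : ℝ≥0 => eLpNorm
            (fun ω => ((proc.P x)[S T | proc.ℱ t]) ω / (∫ ω', S T ω' ∂(proc.P x)) -
              eigenMartingale proc S lam π t ω) 1 (proc.P x))
          atTop (𝓝 0)) ∧
      -- the zero-coupon bond price processes exist
      (∀ T : ℝ≥0, 0 < T → ∃ p, IsZeroCouponBond proc.ℱ (proc.P x) S T p) ∧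
      ∃ M B : ℝ≥0 → Ω → ℝ,
        -- `M` is the martingale `M^π`, `B_t = e^{λ t} π(X_t) / π(x)`, and `S_t = M_t / B_t`
        Martingale M proc.ℱ (proc.P x) ∧
        (∀ᵐ ω ∂(proc.P x), IsRCLL (fun t => M t ω) ∧ ∀ t, 0 < M t ω) ∧
        (∀ t, M t =ᵐ[proc.P x] eigenMartingale proc S lam π t) ∧
        IsValuationProcess proc.ℱ (proc.P x) S B ∧
        (∀ t : ℝ≥0, ∀ᵐ ω ∂(proc.P x),
          B t ω = Real.exp (lam * t) * π (proc.X t ω) / π x) ∧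
        (∀ᵐ ω ∂(proc.P x), ∀ t, S t ω = 1 / B t ω * M t ω) ∧
        ∀ p : ℝ≥0 → ℝ≥0 → Ω → ℝ,
          (∀ T, 0 < T → IsZeroCouponBond proc.ℱ (proc.P x) S T (p T)) →
          -- `B` is the long bond
          IsLongBond proc.ℱ (proc.P x) p B ∧
          -- convergence in the semimartingale topology
          Tendsto (fun T => emeryDist proc.ℱ (proc.P x)
            (fun t ω => S t ω * rollOver p T t ω) M) atTop (𝓝 0) ∧
          Tendsto (fun T => emeryDist proc.ℱ (proc.P x) (rollOver p T) B) atTop (𝓝 0) ∧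
          -- the eigen-measure is the long forward measure, with convergence in total variation
          IsLongForwardMeasure proc.ℱ (proc.P x) S p (eigenMeasure proc S lam π x) ∧
          (∀ t : ℝ≥0, ∀ ε : ℝ, 0 < ε → ∀ᶠ T in atTop, ∀ A, MeasurableSet[proc.ℱ t] A →
            |(forwardMeasure proc.ℱ (proc.P x) S p T t A).toReal -
              (eigenMeasure proc S lam π x t A).toReal| ≤ ε)) ∧
    -- long-term pricing with an exponential error estimate
    (∀ f : E → ℝ, Measurable f → (∃ C, ∀ y, |f y| ≤ C) → ∀ t : ℝ≥0, t₀ ≤ t → ∀ x,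
      |pricingOp proc S t f x - (∫ y, f y / π y ∂ς) * Real.exp (-lam * t) * π x| ≤
        c * (⨆ y, |f y|) * Real.exp (-(lam + α) * t)) := by
  have hπ' := hπ.toIsPositiveEigenfunction
  refine ⟨fun x => ?_, fun f hf hfb t ht x => pricingOp_exponential_estimate hS hπ' herg hf hfb ht x⟩
  have hlim := tendsto_integral_abs_forwardDensity_sub hS hπ' herg x
  have hmart := martingale_eigenMartingale hS hπ' x
  refine ⟨fun t _ => ⟨measurable_eigenMartingale hS hπ' x t,
    (eigenMartingale_pos hS hπ' x).mono fun ω h => h t, ?_⟩,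
    fun T _ => exists_zeroCouponBond hS x T, ?_⟩
  · have h1 := (ENNReal.continuous_ofReal.tendsto _).comp (hlim t)
    rw [ENNReal.ofReal_zero] at h1
    refine h1.congr fun T => ?_
    rw [eLpNorm_one_eq_lintegral_enorm]
    exact ofReal_integral_norm_eq_lintegral_enorm
      (((martingale_forwardDensity x T).integrable t).sub (hmart.integrable t))
  -- The eigen-martingale itself may have irregular paths, since `π` is only universally measurable.
  -- From here on it is replaced by its RCLL modification `M`, and `M / S` is the long bond.
  obtain ⟨M, hM, hMeq, hMr⟩ := exists_rcll_modification proc.filtration_right_cont hmart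
  have hMp := martingale_pos_leftLim hM hMr fun t => by
    filter_upwards [hMeq t, eigenMartingale_pos hS hπ' x] with ω h1 h2
    rw [h1]
    exact h2 t
  have hlimM : ∀ t, Tendsto (fun T => ∫ ω, |forwardDensity proc S x T t ω - M t ω| ∂(proc.P x))
      atTop (𝓝 0) := fun t => (hlim t).congr fun T => integral_congr_ae (by
    filter_upwards [hMeq t] with ω hω
    rw [hω])
  have hB := isValuationProcess_of_martingale hS hM hMr hMp
  refine ⟨M, fun t ω => M t ω * (S t ω)⁻¹, hM, ?_, hMeq, hB, fun t => ?_, ?_, fun p hp =>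
    ⟨⟨hB.semimartingale, hB.pos, fun t _ K hK => ?_⟩, ?_, ?_,
      isLongForwardMeasure_eigenMeasure hS hπ' hlim hp,
      fun t ε hε => forwardMeasure_tendsto_totalVariation hS hπ' hlim hp t hε⟩⟩
  · filter_upwards [hMr, hMp] with ω h1 h2 using ⟨h1, h2.1⟩
  · filter_upwards [hMeq t, eigenMartingale_ae_eq (S := S) (lam := lam) (π := π) x, hS.pos x]
      with ω h1 h2 h3
    have := (h3 t).ne'
    rw [h1, h2 t]
    field_simp
  · filter_upwards [hMp, hS.pos x] with ω h1 h2 t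
    have := (h1.1 t).ne'
    have := (h2 t).ne'
    field_simp
  · refine ENNReal.tendsto_nhds_zero.2 fun ε hε => ?_
    obtain ⟨N, hN⟩ := exists_nat_ge t
    filter_upwards [eventually_isControlled_rollOver_sub hS hM hMr hlimM hp N hK hε] with T h
    exact (h.mono_time hN).sup
  · exact tendsto_emeryDist fun N δ hδ ε hε =>
      (eventually_isControlled_sub hS hM hMr hlimM hp N hδ hε).mono fun T h η => h.integral η
  · exact tendsto_emeryDist fun N δ hδ ε hε =>
      (eventually_isControlled_rollOver_sub hS hM hMr hlimM hp N hδ hε).mono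
        fun T h η => h.integral η
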